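/- Let $M$ be a smooth manifold of dimension $2n+1$ ($n\ge 0$). On $TM\oplus T^*M$ consider the pairing $\langle X+\alpha,Y+\beta\rangle=\frac12(\iota_X\beta+\iota_Y\alpha)$ and the Courant bracket $[\![X+\alpha,Y+\beta]\!]=[X,Y]+\mathcal L_X\beta-\mathcal L_Y\alpha-\frac12 d(\iota_X\beta-\iota_Y\alpha)$, both extended complex-bilinearly to $(TM\oplus T^*M)_{\mathbb C}$, and the anchor $\rho$ given by the projection to $TM_{\mathbb C}$. A generalized almost contact pair $(\Phi,F+\eta)$ consists of a bundle endomorphism $\Phi$ of $TM\oplus T^*M$, a vector field $F$ and a 1-form $\eta$ (all smooth) with $\Phi+\Phi^*=0$, $\eta(F)=1$, $\Phi(F)=0$, $\Phi(\eta)=0$ and $\Phi^2(X+\alpha)=-(X+\alpha)+\eta(X)F+\alpha(F)\eta$. A generalized almost contact structure is an equivalence class of such pairs under $(\Phi,F+\eta)\sim(\Phi,\frac1fF+f\eta)$, where $f$ is a smooth function without zeros. Let $L_F$ and $L_\eta$ be the complex line bundles spanned by $F$ and $\eta$, and put $$E^{(1,0)}=\{e-i\Phi(e)\},\quad E^{(0,1)}=\{e+i\Phi(e)\}\quad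 (e\in\ker\eta\oplus\ker F),\qquad L=L_F\oplus E^{(1,0)},\quad L^*=L_\eta\oplus E^{(0,1)}.$$ The structure is a strong generalized contact structure if $\Gamma(L)$ and $\Gamma(L^*)$ are both closed under the Courant bracket. Let $(\eta,\theta)$ be a cosymplectic structure on $M$: a closed 1-form $\eta$ and a closed 2-form $\theta$ such that $\eta\wedge\theta^n$ vanishes nowhere. Let $\flat(X)=\iota_X\theta-\eta(X)\eta$ and $\pi(\alpha,\beta)=\theta(\flat^{-1}\alpha,\flat^{-1}\beta)$. Then there is exactly one generalized almost contact pair $(\Phi,F+\eta)$ with this $\eta$, with $\iota_F\theta=0$ and with $\Phi(X+\alpha)=\pi^\sharp\alpha+\iota_X\theta$, where $\beta(\pi^\sharp\alpha)=\pi(\alpha,\beta)$. The generalized almost contact structure that it represents is a strong generalized contact structure. Moreover, for each representative, the pairs $(L,L^*)$ and $(E^{(1,0)},E^{(0,1)})$, with the anchor $\rho$, the induced Courant bracket and the duality given by $\langle\cdot,\cdot\rangle$, are both Lie bialgebroids. That is, both members $A$, $B$ of the pair are complex Lie algebroids, the pairing of $A$ with $B$ is non-degenerate, and $d_B[\![s,t]\!]=[\![d_Bs,t]\!]+[\![s,d_Bt]\!]$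 for all $s,t\in\Gamma(A)$, where $d_B$ is the Lie algebroid differential of $B$ and the brackets on the right are Schouten brackets on $\Gamma(\wedge^\bullet A)$. -/

import Mathlib

open Bundle
open scoped Manifold ContDiff Topology

noncomputable section

set_option linter.unusedSectionVars false

namespace GenContact

/-! ### Complexification of a real vector space -/

/-- The complexification `V ⊕ iV` of a real vector space `V`; the element `⟨a, b⟩` is `a + i b`. -/
@[ext]
structure Cplx (V : Type*) where
  re : V
  im : V

namespace Cplx

variable {V : Type*} [AddCommGroup V]

def equivProd (V : Type*) : Cplx V ≃ V × V where
  toFun v := (v.re, v.im)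
  invFun p := ⟨p.1, p.2⟩
  left_inv _ := rfl
  right_inv _ := rfl

instance : AddCommGroup (Cplx V) := (equivProd V).addCommGroup

@[simp] theorem zero_re : (0 : Cplx V).re = 0 := rfl
@[simp] theorem zero_im : (0 : Cplx V).im = 0 := rfl
@[simp] theorem add_re (u v : Cplx V) : (u + v).re = u.re + v.re := rfl
@[simp] theorem add_im (u v : Cplx V) : (u + v).im = u.im + v.im := rfl
@[simp] theorem neg_re (u : Cplx V) : (-u).re = -u.re := rfl
@[simp] theorem neg_im (u : Cplx V) : (-u).im = -u.im := rfl
@[simp] theorem sub_re (u v : Cplx V) : (u - v).re = u.re - v.re := rfl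
@[simp] theorem sub_im (u v : Cplx V) : (u - v).im = u.im - v.im := rfl

variable [Module ℝ V]

instance : SMul ℂ (Cplx V) :=
  ⟨fun c v => ⟨c.re • v.re - c.im • v.im, c.re • v.im + c.im • v.re⟩⟩

@[simp] theorem smul_re (c : ℂ) (v : Cplx V) : (c • v).re = c.re • v.re - c.im • v.im := rfl
@[simp] theorem smul_im (c : ℂ) (v : Cplx V) : (c • v).im = c.re • v.im + c.im • v.re := rfl

instance : Module ℂ (Cplx V) where
  one_smul v := by ext <;> simp
  mul_smul c d v := by ext <;> simp <;> module
  smul_zero c := by ext <;> simp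
  smul_add c u v := by ext <;> simp <;> module
  add_smul c d v := by ext <;> simp <;> module
  zero_smul v := by ext <;> simp

end Cplx

/-! ### Tangent, cotangent and generalized tangent bundles

`M` is a manifold modelled on the real normed space `E`, without boundary. A section of a bundle is
a (rough) dependent function; its smoothness is a separate predicate. -/

section Calculus

variable {E : Type*} [NormedAddCommGroup E] [NormedSpace ℝ E] [FiniteDimensional ℝ E]
  {M : Type*} [TopologicalSpace M] [ChartedSpace E M]

/-- The tangent space `T_x M`. -/
abbrev Tan (E : Type*) [NormedAddCommGroup E] [NormedSpace ℝ E] {M : Type*} [TopologicalSpace M]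
    [ChartedSpace E M] (x : M) : Type _ :=
  TangentSpace 𝓘(ℝ, E) x

/-- The cotangent space `T_x^* M`. -/
abbrev Cotan (E : Type*) [NormedAddCommGroup E] [NormedSpace ℝ E] {M : Type*} [TopologicalSpace M]
    [ChartedSpace E M] (x : M) : Type _ :=
  TangentSpace 𝓘(ℝ, E) x →L[ℝ] ℝ

/-- The fibre of `TM ⊕ T^*M` at `x`. -/
abbrev GTan (E : Type*) [NormedAddCommGroup E] [NormedSpace ℝ E] {M : Type*} [TopologicalSpace M]
    [ChartedSpace E M] (x : M) : Type _ :=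
  Tan E x × Cotan E x

variable [IsManifold 𝓘(ℝ, E) ∞ M]

/-- `X` is a smooth vector field on the open set `U`. -/
def SmoothVFOn (X : ∀ x : M, Tan E x) (U : Set M) : Prop :=
  ContMDiffOn 𝓘(ℝ, E) (𝓘(ℝ, E).prod 𝓘(ℝ, E)) ∞
    (fun x => TotalSpace.mk' E (E := fun x : M => TangentSpace 𝓘(ℝ, E) x) x (X x)) U

/-- `α` is a smooth 1-form on the open set `U`. -/
def SmoothOneFormOn (α : ∀ x : M, Cotan E x) (U : Set M) : Prop :=
  ContMDiffOn 𝓘(ℝ, E) (𝓘(ℝ, E).prod 𝓘(ℝ, E →L[ℝ] ℝ)) ∞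
    (fun x => TotalSpace.mk' (E →L[ℝ] ℝ)
      (E := fun x : M => TangentSpace 𝓘(ℝ, E) x →L[ℝ] ℝ) x (α x)) U

/-- `b` is a smooth field of bilinear forms. -/
def SmoothBilin (b : ∀ x : M, Tan E x →L[ℝ] Tan E x →L[ℝ] ℝ) : Prop :=
  ContMDiff 𝓘(ℝ, E) (𝓘(ℝ, E).prod 𝓘(ℝ, E →L[ℝ] E →L[ℝ] ℝ)) ∞
    (fun x => TotalSpace.mk' (E →L[ℝ] E →L[ℝ] ℝ)
      (E := fun x : M => TangentSpace 𝓘(ℝ, E) x →L[ℝ] TangentSpace 𝓘(ℝ, E) x →L[ℝ] ℝ) x (b x))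

/-- `Φ` is a smooth bundle endomorphism of `TM ⊕ T^*M`. -/
def SmoothEnd (Φ : ∀ x : M, GTan E x →L[ℝ] GTan E x) : Prop :=
  ContMDiff 𝓘(ℝ, E) (𝓘(ℝ, E).prod 𝓘(ℝ, (E × (E →L[ℝ] ℝ)) →L[ℝ] (E × (E →L[ℝ] ℝ)))) ∞
    (fun x => TotalSpace.mk' ((E × (E →L[ℝ] ℝ)) →L[ℝ] (E × (E →L[ℝ] ℝ)))
      (E := fun x : M =>
        ((fun y : M => TangentSpace 𝓘(ℝ, E) y) ×ᵇ
          (fun y : M => TangentSpace 𝓘(ℝ, E) y →L[ℝ] ℝ)) x →L[ℝ]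
        ((fun y : M => TangentSpace 𝓘(ℝ, E) y) ×ᵇ
          (fun y : M => TangentSpace 𝓘(ℝ, E) y →L[ℝ] ℝ)) x) x (Φ x))

/-! ### Lie derivative of 1-forms and exterior derivative -/

/-- The invariant expression `(L_X β)(Z) = X(β(Z)) - β([X, Z])` at the point `x`. -/
def lieDerivExpr (X : ∀ x : M, Tan E x) (β : ∀ x : M, Cotan E x) (x : M)
    (Z : ∀ x : M, Tan E x) : ℝ :=
  mvfderiv 𝓘(ℝ, E) (fun y => β y (Z y)) x (X x) - β x (VectorField.mlieBracket 𝓘(ℝ, E) X Z x)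

open Classical in
/-- The Lie derivative `L_X β` of a 1-form: the covector at `x` with
`(L_X β)(Z) = X(β(Z)) - β([X, Z])` for vector fields `Z`. The right-hand side depends on `Z x` only
as soon as `β` is differentiable (see `lieDeriv_apply`); the value is `0` otherwise. -/
def lieDeriv (X : ∀ x : M, Tan E x) (β : ∀ x : M, Cotan E x) (x : M) : Cotan E x :=
  if h : TensorialAt 𝓘(ℝ, E) E (lieDerivExpr X β x) x then
    TensorialAt.mkHom (lieDerivExpr X β x) x h
  else 0

theorem tensorialAt_lieDerivExpr (X : ∀ x : M, Tan E x) {β : ∀ x : M, Cotan E x}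
    (hβ : SmoothOneFormOn β Set.univ) (x : M) :
    TensorialAt 𝓘(ℝ, E) E (lieDerivExpr X β x) x := by
  have hβx : MDifferentiableAt 𝓘(ℝ, E) (𝓘(ℝ, E).prod 𝓘(ℝ, E →L[ℝ] ℝ))
      (fun x => TotalSpace.mk' (E →L[ℝ] ℝ)
        (E := fun x : M => TangentSpace 𝓘(ℝ, E) x →L[ℝ] ℝ) x (β x)) x :=
    (contMDiffOn_univ.1 hβ).mdifferentiableAt (by simp)
  have key : ∀ Z : (∀ x : M, Tan E x), MDifferentiableAt 𝓘(ℝ, E) (𝓘(ℝ, E).prod 𝓘(ℝ, E))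
      (fun x => TotalSpace.mk' E (E := fun x : M => TangentSpace 𝓘(ℝ, E) x) x (Z x)) x →
      MDifferentiableAt 𝓘(ℝ, E) 𝓘(ℝ, ℝ) (fun y => β y (Z y)) x := by
    intro Z hZ
    have := MDifferentiableAt.clm_bundle_apply (IB := 𝓘(ℝ, E)) (F₁ := E) (F₂ := ℝ)
      (E₁ := fun x : M => TangentSpace 𝓘(ℝ, E) x) (E₂ := Bundle.Trivial M ℝ)
      (b := fun y => y) (ϕ := β) (v := Z) hβx hZ
    rw [mdifferentiableAt_totalSpace] at this
    exact this.2
  constructor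
  · intro f σ hf hσ
    have e1 : (fun y => β y ((f • σ) y)) = f • fun y => β y (σ y) := by
      ext y; simp
    simp only [lieDerivExpr]
    rw [e1, VectorField.mlieBracket_smul_right hf hσ, mvfderiv_smul hf (key σ hσ)]
    simp
    ring
  · intro σ σ' hσ hσ'
    have e1 : (fun y => β y ((σ + σ') y)) = (fun y => β y (σ y)) + fun y => β y (σ' y) := by
      ext y; simp
    simp only [lieDerivExpr]
    rw [e1, VectorField.mlieBracket_add_right hσ hσ', mvfderiv_add (key σ hσ) (key σ' hσ')]
    simp
    ring

theorem lieDeriv_apply (X : ∀ x : M, Tan E x) {β : ∀ x : M, Cotan E x}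
    (hβ : SmoothOneFormOn β Set.univ) {Z : ∀ x : M, Tan E x} (hZ : SmoothVFOn Z Set.univ) (x : M) :
    lieDeriv X β x (Z x) =
      mvfderiv 𝓘(ℝ, E) (fun y => β y (Z y)) x (X x) -
        β x (VectorField.mlieBracket 𝓘(ℝ, E) X Z x) := by
  have h := tensorialAt_lieDerivExpr X hβ x
  rw [lieDeriv, dif_pos h]
  exact TensorialAt.mkHom_apply h ((contMDiffOn_univ.1 hZ).mdifferentiableAt (by simp))

/-- `dα(X, Y)` at `x` for a 1-form `α`. -/
def extDerivOne (α : ∀ x : M, Cotan E x) (X Y : ∀ x : M, Tan E x) (x : M) : ℝ :=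
  mvfderiv 𝓘(ℝ, E) (fun y => α y (Y y)) x (X x) - mvfderiv 𝓘(ℝ, E) (fun y => α y (X y)) x (Y x)
    - α x (VectorField.mlieBracket 𝓘(ℝ, E) X Y x)

/-- `dθ(X, Y, Z)` at `x` for a 2-form `θ`. -/
def extDerivTwo (θ : ∀ x : M, Tan E x →L[ℝ] Tan E x →L[ℝ] ℝ) (X Y Z : ∀ x : M, Tan E x)
    (x : M) : ℝ :=
  mvfderiv 𝓘(ℝ, E) (fun y => θ y (Y y) (Z y)) x (X x)
    - mvfderiv 𝓘(ℝ, E) (fun y => θ y (X y) (Z y)) x (Y x)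
    + mvfderiv 𝓘(ℝ, E) (fun y => θ y (X y) (Y y)) x (Z x)
    - θ x (VectorField.mlieBracket 𝓘(ℝ, E) X Y x) (Z x)
    + θ x (VectorField.mlieBracket 𝓘(ℝ, E) X Z x) (Y x)
    - θ x (VectorField.mlieBracket 𝓘(ℝ, E) Y Z x) (X x)

/-- `dα = 0`. -/
def ClosedOne (α : ∀ x : M, Cotan E x) : Prop :=
  ∀ (U : Set M) (X Y : ∀ x : M, Tan E x), IsOpen U → SmoothVFOn X U → SmoothVFOn Y U →
    ∀ x ∈ U, extDerivOne α X Y x = 0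

/-- `dθ = 0`. -/
def ClosedTwo (θ : ∀ x : M, Tan E x →L[ℝ] Tan E x →L[ℝ] ℝ) : Prop :=
  ∀ (U : Set M) (X Y Z : ∀ x : M, Tan E x), IsOpen U → SmoothVFOn X U → SmoothVFOn Y U →
    SmoothVFOn Z U → ∀ x ∈ U, extDerivTwo θ X Y Z x = 0

/-! ### The Courant algebroid `TM ⊕ T^*M` and its complexification -/

/-- The pairing `⟨X + α, Y + β⟩ = (β(X) + α(Y)) / 2` on the fibre at `x`. -/
def pairing {x : M} (u v : GTan E x) : ℝ := (1 / 2) * (v.2 u.1 + u.2 v.1)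

/-- The Courant bracket
`⟦X + α, Y + β⟧ = [X, Y] + L_X β - L_Y α - (1/2) d(ι_X β - ι_Y α)`. -/
def courant (s t : ∀ x : M, GTan E x) (x : M) : GTan E x :=
  (VectorField.mlieBracket 𝓘(ℝ, E) (fun y => (s y).1) (fun y => (t y).1) x,
    lieDeriv (fun y => (s y).1) (fun y => (t y).2) x
      - lieDeriv (fun y => (t y).1) (fun y => (s y).2) x
      - (1 / 2 : ℝ) • mvfderiv 𝓘(ℝ, E) (fun y => (t y).2 (s y).1 - (s y).2 (t y).1) x)

/-- The fibre at `x` of the complexified tangent bundle. -/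
abbrev CTan (E : Type*) [NormedAddCommGroup E] [NormedSpace ℝ E] {M : Type*} [TopologicalSpace M]
    [ChartedSpace E M] (x : M) : Type _ :=
  Cplx (Tan E x)

/-- The fibre at `x` of `(TM ⊕ T^*M)_ℂ`. -/
abbrev CGTan (E : Type*) [NormedAddCommGroup E] [NormedSpace ℝ E] {M : Type*} [TopologicalSpace M]
    [ChartedSpace E M] (x : M) : Type _ :=
  Cplx (GTan E x)

/-- The complex bilinear extension of a real bilinear bracket of sections. -/
def cplxBracket {V : M → Type*} [∀ x, AddCommGroup (V x)]
    (br : (∀ x, V x) → (∀ x, V x) → ∀ x, V x) (s t : ∀ x, Cplx (V x)) (x : M) : Cplx (V x) :=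
  ⟨br (fun y => (s y).re) (fun y => (t y).re) x - br (fun y => (s y).im) (fun y => (t y).im) x,
    br (fun y => (s y).re) (fun y => (t y).im) x + br (fun y => (s y).im) (fun y => (t y).re) x⟩

/-- The Lie bracket of complex vector fields. -/
def cLieBracket (X Y : ∀ x : M, CTan E x) : ∀ x : M, CTan E x :=
  cplxBracket (V := fun x : M => Tan E x) (VectorField.mlieBracket 𝓘(ℝ, E)) X Y

/-- The complex bilinear extension of the Courant bracket. -/
def cCourant (s t : ∀ x : M, CGTan E x) : ∀ x : M, CGTan E x :=
  cplxBracket (V := fun x : M => GTan E x) courant s t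

/-- The complex bilinear extension of the pairing. -/
def cPairing {x : M} (u v : CGTan E x) : ℂ :=
  ⟨pairing u.re v.re - pairing u.im v.im, pairing u.re v.im + pairing u.im v.re⟩

/-- The derivative `X f` of a complex function along a complex vector field. -/
def cDeriv (X : ∀ x : M, CTan E x) (f : M → ℂ) (x : M) : ℂ :=
  mvfderiv 𝓘(ℝ, E) f x (X x).re + Complex.I * mvfderiv 𝓘(ℝ, E) f x (X x).im

/-- The projection `ρ : (TM ⊕ T^*M)_ℂ → TM_ℂ`. -/
def anchor (x : M) : CGTan E x →ₗ[ℂ] CTan E x where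
  toFun v := ⟨v.re.1, v.im.1⟩
  map_add' _ _ := rfl
  map_smul' _ _ := rfl

/-- `X` is a smooth complex vector field. -/
def SmoothCVF (X : ∀ x : M, CTan E x) : Prop :=
  SmoothVFOn (fun x => (X x).re) Set.univ ∧ SmoothVFOn (fun x => (X x).im) Set.univ

/-- `s` is a smooth section of `(TM ⊕ T^*M)_ℂ` on the open set `U`. -/
def SmoothCSectionOn (s : ∀ x : M, CGTan E x) (U : Set M) : Prop :=
  SmoothVFOn (fun x => (s x).re.1) U ∧ SmoothOneFormOn (fun x => (s x).re.2) U ∧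
    SmoothVFOn (fun x => (s x).im.1) U ∧ SmoothOneFormOn (fun x => (s x).im.2) U

/-! ### Complex subbundles, Lie algebroids and Lie bialgebroids -/

/-- The space `Γ(A)` of global smooth sections of a family `A` of complex subspaces of the fibres
of `(TM ⊕ T^*M)_ℂ`. -/
def Sections (A : ∀ x : M, Submodule ℂ (CGTan E x)) : Set (∀ x : M, CGTan E x) :=
  {s | SmoothCSectionOn s Set.univ ∧ ∀ x, s x ∈ A x}

/-- `A` is a smooth complex vector subbundle of `(TM ⊕ T^*M)_ℂ`: it has smooth local frames. -/
def IsSubbundle (A : ∀ x : M, Submodule ℂ (CGTan E x)) : Prop :=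
  ∀ x₀ : M, ∃ U : Set M, IsOpen U ∧ x₀ ∈ U ∧
    ∃ (r : ℕ) (e : Fin r → ∀ x : M, CGTan E x), (∀ i, SmoothCSectionOn (e i) U) ∧
      ∀ x ∈ U, LinearIndependent ℂ (fun i => e i x) ∧
        Submodule.span ℂ (Set.range fun i => e i x) = A x

/-- `Γ(A)` is closed under the Courant bracket. -/
def CourantClosed (A : ∀ x : M, Submodule ℂ (CGTan E x)) : Prop :=
  ∀ s ∈ Sections A, ∀ t ∈ Sections A, cCourant s t ∈ Sections A

/-- The subbundle `A` of `(TM ⊕ T^*M)_ℂ`, with the anchor `ρ` and the bracket `br` restricted to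
`Γ(A)`, is a complex Lie algebroid. -/
structure IsLieAlgebroid (ρ : ∀ x : M, CGTan E x →ₗ[ℂ] CTan E x)
    (br : (∀ x : M, CGTan E x) → (∀ x : M, CGTan E x) → ∀ x : M, CGTan E x)
    (A : ∀ x : M, Submodule ℂ (CGTan E x)) : Prop where
  subbundle : IsSubbundle A
  anchor_smooth : ∀ s ∈ Sections A, SmoothCVF fun x => ρ x (s x)
  closed : ∀ s ∈ Sections A, ∀ t ∈ Sections A, br s t ∈ Sections A
  skew : ∀ s ∈ Sections A, ∀ t ∈ Sections A, br s t = -br t s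
  add_right : ∀ s ∈ Sections A, ∀ t ∈ Sections A, ∀ u ∈ Sections A,
    br s (t + u) = br s t + br s u
  jacobi : ∀ s ∈ Sections A, ∀ t ∈ Sections A, ∀ u ∈ Sections A,
    br (br s t) u + br (br t u) s + br (br u s) t = 0
  leibniz : ∀ s ∈ Sections A, ∀ t ∈ Sections A, ∀ f : M → ℂ,
    ContMDiff 𝓘(ℝ, E) 𝓘(ℝ, ℂ) ∞ f → ∀ x,
      br s (fun y => f y • t y) x = f x • br s t x + cDeriv (fun y => ρ y (s y)) f x • t x
  anchor_bracket : ∀ s ∈ Sections A, ∀ t ∈ Sections A, ∀ x,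
    ρ x (br s t x) = cLieBracket (fun y => ρ y (s y)) (fun y => ρ y (t y)) x

/-- The Lie algebroid differential of `B` in degree one. A section `a` of `A ≅ B^*` is seen as the 1-form
`ξ ↦ ⟨a, ξ⟩` on `B`, and `(d_B a)(ξ₁, ξ₂) = ρ(ξ₁)⟨a, ξ₂⟩ - ρ(ξ₂)⟨a, ξ₁⟩ - ⟨a, [ξ₁, ξ₂]⟩`. -/
def algebroidDiff (ρ : ∀ x : M, CGTan E x →ₗ[ℂ] CTan E x)
    (br : (∀ x : M, CGTan E x) → (∀ x : M, CGTan E x) → ∀ x : M, CGTan E x)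
    (a ξ₁ ξ₂ : ∀ x : M, CGTan E x) (x : M) : ℂ :=
  cDeriv (fun y => ρ y (ξ₁ y)) (fun y => cPairing (a y) (ξ₂ y)) x
    - cDeriv (fun y => ρ y (ξ₂ y)) (fun y => cPairing (a y) (ξ₁ y)) x
    - cPairing (a x) (br ξ₁ ξ₂ x)

/-- `D` is the Lie derivative of `A` on sections of its dual `B ≅ A^*`: for `X` in `Γ(A)` and `ξ` in
`Γ(B)`, `D X ξ = L_X ξ` is the section of `B` with `⟨L_X ξ, Y⟩ = ρ(X)⟨ξ, Y⟩ - ⟨ξ, [X, Y]⟩` for all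
`Y` in `Γ(A)`. -/
def IsDualLieDeriv (ρ : ∀ x : M, CGTan E x →ₗ[ℂ] CTan E x)
    (br : (∀ x : M, CGTan E x) → (∀ x : M, CGTan E x) → ∀ x : M, CGTan E x)
    (A B : ∀ x : M, Submodule ℂ (CGTan E x))
    (D : (∀ x : M, CGTan E x) → (∀ x : M, CGTan E x) → ∀ x : M, CGTan E x) : Prop :=
  ∀ X ∈ Sections A, ∀ ξ ∈ Sections B, D X ξ ∈ Sections B ∧
    ∀ Y ∈ Sections A, ∀ x, cPairing (D X ξ x) (Y x) =
      cDeriv (fun y => ρ y (X y)) (fun y => cPairing (ξ y) (Y y)) x - cPairing (ξ x) (br X Y x)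

/-- The Schouten bracket `[X, Ω] = L_X Ω` of a section `X` of `A` with a section `Ω` of `⋀² A`, the
latter written as an alternating form on `Γ(B)`, `B ≅ A^*`; `D` is the Lie derivative of `A` on
sections of `B`. -/
def schouten (ρ : ∀ x : M, CGTan E x →ₗ[ℂ] CTan E x)
    (D : (∀ x : M, CGTan E x) → (∀ x : M, CGTan E x) → ∀ x : M, CGTan E x)
    (X : ∀ x : M, CGTan E x)
    (Ω : (∀ x : M, CGTan E x) → (∀ x : M, CGTan E x) → M → ℂ)
    (ξ₁ ξ₂ : ∀ x : M, CGTan E x) (x : M) : ℂ :=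
  cDeriv (fun y => ρ y (X y)) (Ω ξ₁ ξ₂) x - Ω (D X ξ₁) ξ₂ x - Ω ξ₁ (D X ξ₂) x

/-- `(A, B)` is a Lie bialgebroid for the anchor `ρ` and the bracket `br`: `A` and `B` are Lie
algebroids, they are dual to each other under the pairing, and
`d_B [X, Y] = [d_B X, Y] + [X, d_B Y]` for all `X`, `Y` in `Γ(A)`, where
`[d_B X, Y] = -[Y, d_B X]` for the Schouten bracket. -/
structure IsLieBialgebroid (ρ : ∀ x : M, CGTan E x →ₗ[ℂ] CTan E x)
    (br : (∀ x : M, CGTan E x) → (∀ x : M, CGTan E x) → ∀ x : M, CGTan E x)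
    (A B : ∀ x : M, Submodule ℂ (CGTan E x)) : Prop where
  left : IsLieAlgebroid ρ br A
  right : IsLieAlgebroid ρ br B
  nondeg_left : ∀ x, ∀ a ∈ A x, (∀ b ∈ B x, cPairing a b = 0) → a = 0
  nondeg_right : ∀ x, ∀ b ∈ B x, (∀ a ∈ A x, cPairing a b = 0) → b = 0
  compatible : ∃ D, IsDualLieDeriv ρ br A B D ∧
    ∀ X ∈ Sections A, ∀ Y ∈ Sections A, ∀ ξ₁ ∈ Sections B, ∀ ξ₂ ∈ Sections B, ∀ x,
      algebroidDiff ρ br (br X Y) ξ₁ ξ₂ x =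
        -schouten ρ D Y (algebroidDiff ρ br X) ξ₁ ξ₂ x
          + schouten ρ D X (algebroidDiff ρ br Y) ξ₁ ξ₂ x

/-! ### Generalized almost contact structures -/

variable (E M)

/-- A generalized almost contact pair `(Φ, F + η)`. -/
@[ext]
structure GACPair where
  Φ : ∀ x : M, GTan E x →L[ℝ] GTan E x
  F : ∀ x : M, Tan E x
  η : ∀ x : M, Cotan E x
  smooth_Φ : SmoothEnd Φ
  smooth_F : SmoothVFOn F Set.univ
  smooth_η : SmoothOneFormOn η Set.univ
  skew : ∀ x u v, pairing (Φ x u) v + pairing u (Φ x v) = 0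
  η_F : ∀ x, η x (F x) = 1
  Φ_F : ∀ x, Φ x (F x, 0) = 0
  Φ_η : ∀ x, Φ x (0, η x) = 0
  Φ_Φ : ∀ x u, Φ x (Φ x u) = -u + (η x u.1 • F x, u.2 (F x) • η x)

variable {E M}

namespace GACPair

/-- `(Φ, F + η) ∼ (Φ, f⁻¹ F + f η)` for functions `f` without zero. -/
def Equivalent (J J' : GACPair E M) : Prop :=
  ∃ f : M → ℝ, ContMDiff 𝓘(ℝ, E) 𝓘(ℝ, ℝ) ∞ f ∧ (∀ x, f x ≠ 0) ∧
    J'.Φ = J.Φ ∧ (∀ x, J'.η x = f x • J.η x) ∧ ∀ x, J'.F x = (1 / f x) • J.F x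

theorem equivalent_refl (J : GACPair E M) : J.Equivalent J :=
  ⟨fun _ => 1, contMDiff_const, fun _ => one_ne_zero, rfl, by simp, by simp⟩

theorem equivalent_symm {J J' : GACPair E M} (h : J.Equivalent J') : J'.Equivalent J := by
  obtain ⟨f, hf, h0, h1, h2, h3⟩ := h
  refine ⟨fun x => (f x)⁻¹, ?_, fun x => inv_ne_zero (h0 x), h1.symm, fun x => ?_, fun x => ?_⟩
  · exact hf.inv₀ h0
  · rw [h2, smul_smul, inv_mul_cancel₀ (h0 x), one_smul]
  · rw [h3, smul_smul, one_div, one_div, inv_inv, mul_inv_cancel₀ (h0 x), one_smul]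

theorem equivalent_trans {J J' J'' : GACPair E M} (h : J.Equivalent J') (h' : J'.Equivalent J'') :
    J.Equivalent J'' := by
  obtain ⟨f, hf, h0, h1, h2, h3⟩ := h
  obtain ⟨g, hg, g0, g1, g2, g3⟩ := h'
  refine ⟨fun x => g x * f x, hg.mul hf, fun x => mul_ne_zero (g0 x) (h0 x), g1.trans h1,
    fun x => ?_, fun x => ?_⟩
  · rw [g2, h2, smul_smul]
  · rw [g3, h3, smul_smul, one_div_mul_one_div]

instance : Setoid (GACPair E M) :=
  ⟨Equivalent, equivalent_refl, equivalent_symm, equivalent_trans⟩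

/-- `L_F`, the complex line spanned by `F`. -/
def bundleLF (J : GACPair E M) (x : M) : Submodule ℂ (CGTan E x) :=
  Submodule.span ℂ {⟨(J.F x, 0), 0⟩}

/-- `L_η`, the complex line spanned by `η`. -/
def bundleLη (J : GACPair E M) (x : M) : Submodule ℂ (CGTan E x) :=
  Submodule.span ℂ {⟨(0, J.η x), 0⟩}

theorem Φ_zero (J : GACPair E M) (x : M) : J.Φ x 0 = 0 := ContinuousLinearMap.map_zero _

theorem Φ_add (J : GACPair E M) (x : M) (u v : GTan E x) : J.Φ x (u + v) = J.Φ x u + J.Φ x v :=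
  ContinuousLinearMap.map_add _ _ _

theorem Φ_smul (J : GACPair E M) (x : M) (c : ℝ) (u : GTan E x) : J.Φ x (c • u) = c • J.Φ x u :=
  ContinuousLinearMap.map_smul _ _ _

/-- `e` lies in `ker η ⊕ ker F`. -/
def InKer (J : GACPair E M) {x : M} (e : GTan E x) : Prop :=
  J.η x e.1 = 0 ∧ e.2 (J.F x) = 0

theorem inKer_Φ (J : GACPair E M) {x : M} (e : GTan E x) : J.InKer (J.Φ x e) := by
  have h1 := J.skew x e (J.F x, 0)
  have h2 := J.skew x e (0, J.η x)
  rw [J.Φ_F] at h1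
  rw [J.Φ_η] at h2
  simp [pairing] at h1 h2
  exact ⟨h2, h1⟩

theorem Φ_Φ_of_inKer (J : GACPair E M) {x : M} {e : GTan E x} (he : J.InKer e) :
    J.Φ x (J.Φ x e) = -e := by
  rw [J.Φ_Φ, he.1, he.2]
  simp

theorem InKer.combo {J : GACPair E M} {x : M} {e e' : GTan E x} (he : J.InKer e)
    (he' : J.InKer e') (a b : ℝ) : J.InKer (a • e + b • e') := by
  constructor
  · simp [he.1, he'.1]
  · simp [he.2, he'.2]

/-- `E^{(1,0)} = {e - i Φ(e) | e ∈ ker η ⊕ ker F}`. -/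
def bundleE10 (J : GACPair E M) (x : M) : Submodule ℂ (CGTan E x) where
  carrier := {w | ∃ e : GTan E x, J.InKer e ∧ w = ⟨e, -J.Φ x e⟩}
  zero_mem' := ⟨0, by simp [InKer], by ext1 <;> simp [Φ_zero]⟩
  add_mem' := by
    rintro _ _ ⟨e, he, rfl⟩ ⟨e', he', rfl⟩
    refine ⟨e + e', by simpa using he.combo he' 1 1, ?_⟩
    ext1
    · rfl
    · simp only [Cplx.add_im, Φ_add]; abel
  smul_mem' := by
    rintro c _ ⟨e, he, rfl⟩
    refine ⟨c.re • e + c.im • J.Φ x e, he.combo (J.inKer_Φ e) _ _, ?_⟩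
    ext1
    · simp only [Cplx.smul_re]; module
    · simp only [Cplx.smul_im, Φ_add, Φ_smul, J.Φ_Φ_of_inKer he]; module

/-- `E^{(0,1)} = {e + i Φ(e) | e ∈ ker η ⊕ ker F}`. -/
def bundleE01 (J : GACPair E M) (x : M) : Submodule ℂ (CGTan E x) where
  carrier := {w | ∃ e : GTan E x, J.InKer e ∧ w = ⟨e, J.Φ x e⟩}
  zero_mem' := ⟨0, by simp [InKer], by ext1 <;> simp [Φ_zero]⟩
  add_mem' := by
    rintro _ _ ⟨e, he, rfl⟩ ⟨e', he', rfl⟩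
    refine ⟨e + e', by simpa using he.combo he' 1 1, ?_⟩
    ext1
    · rfl
    · simp only [Cplx.add_im, Φ_add]
  smul_mem' := by
    rintro c _ ⟨e, he, rfl⟩
    refine ⟨c.re • e + (-c.im) • J.Φ x e, he.combo (J.inKer_Φ e) _ _, ?_⟩
    ext1
    · simp only [Cplx.smul_re]; module
    · simp only [Cplx.smul_im, Φ_add, Φ_smul, J.Φ_Φ_of_inKer he]; module

/-- `L = L_F ⊕ E^{(1,0)}`. -/
def bundleL (J : GACPair E M) (x : M) : Submodule ℂ (CGTan E x) :=
  J.bundleLF x ⊔ J.bundleE10 x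

/-- `L^* = L_η ⊕ E^{(0,1)}`. -/
def bundleLstar (J : GACPair E M) (x : M) : Submodule ℂ (CGTan E x) :=
  J.bundleLη x ⊔ J.bundleE01 x

end GACPair

variable (E M)

/-- A generalized almost contact structure: an equivalence class of pairs. -/
def GACStructure : Type _ := Quotient (inferInstance : Setoid (GACPair E M))

variable {E M}

namespace GACStructure

/-- `J` represents `𝒥`. -/
def Represents (J : GACPair E M) (𝒥 : GACStructure E M) : Prop :=
  Quotient.mk _ J = 𝒥

/-- Strong generalized contact structure: `Γ(L)` and `Γ(L^*)` are closed under the Courant bracket.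
These bundles do not depend on the representative. -/
def IsStrong (𝒥 : GACStructure E M) : Prop :=
  ∀ J : GACPair E M, Represents J 𝒥 → CourantClosed J.bundleL ∧ CourantClosed J.bundleLstar

end GACStructure

/-! ### Cosymplectic structures -/

/-- `(η ∧ θ^n)(v_0, …, v_{2n})`, for the wedge product of alternating forms in the normalization
`α ∧ β = (1 / (p! q!)) ∑_σ sgn(σ) (α ⊗ β)^σ`. -/
def wedgePow {V : Type*} [AddCommGroup V] [Module ℝ V] (n : ℕ) (η : V → ℝ) (θ : V → V → ℝ)
    (v : Fin (2 * n + 1) → V) : ℝ :=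
  (1 / 2 ^ n) * ∑ σ : Equiv.Perm (Fin (2 * n + 1)),
    ((Equiv.Perm.sign σ : ℤ) : ℝ) * (η (v (σ ⟨0, by omega⟩)) *
      ∏ i : Fin n, θ (v (σ ⟨2 * i + 1, by omega⟩)) (v (σ ⟨2 * i + 2, by omega⟩)))

/-- A cosymplectic structure on a manifold of dimension `2n + 1`: a smooth closed 1-form `η` and a
smooth closed 2-form `θ` such that `η ∧ θ^n` vanishes nowhere. -/
structure IsCosymplectic (n : ℕ) (η : ∀ x : M, Cotan E x)
    (θ : ∀ x : M, Tan E x →L[ℝ] Tan E x →L[ℝ] ℝ) : Prop where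
  smooth_η : SmoothOneFormOn η Set.univ
  smooth_θ : SmoothBilin θ
  alternating : ∀ x v, θ x v v = 0
  wedge_ne_zero : ∀ x, ∃ v : Fin (2 * n + 1) → Tan E x,
    wedgePow n (fun a => η x a) (fun a b => θ x a b) v ≠ 0
  closed_η : ClosedOne η
  closed_θ : ClosedTwo θ

/-- `♭(X) = ι_X θ - η(X) η`. -/
def flat (η : ∀ x : M, Cotan E x) (θ : ∀ x : M, Tan E x →L[ℝ] Tan E x →L[ℝ] ℝ) (x : M) :
    Tan E x →L[ℝ] Cotan E x :=
  θ x - (η x).smulRight (η x)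

/-- The bivector `π(α, β) = θ(♭⁻¹ α, ♭⁻¹ β)`. -/
def bivector (η : ∀ x : M, Cotan E x) (θ : ∀ x : M, Tan E x →L[ℝ] Tan E x →L[ℝ] ℝ) (x : M)
    (α β : Cotan E x) : ℝ :=
  θ x ((flat η θ x).inverse α) ((flat η θ x).inverse β)

/-- `J` is the generalized almost contact pair of the (almost) cosymplectic structure `(η, θ)`: its
1-form is `η`, its vector field `F` satisfies `ι_F θ = 0` (and `η(F) = 1`), and
`Φ(X + α) = π^♯ α + θ^♭ X`, where `(π^♯ α)(β) = π(α, β)` and `θ^♭ X = ι_X θ`. -/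
structure GACPair.IsAssociated (J : GACPair E M) (η : ∀ x : M, Cotan E x)
    (θ : ∀ x : M, Tan E x →L[ℝ] Tan E x →L[ℝ] ℝ) : Prop where
  η_eq : J.η = η
  θ_F : ∀ x, θ x (J.F x) = 0
  Φ_fst : ∀ x (u : GTan E x) (β : Cotan E x), β (J.Φ x u).1 = bivector η θ x u.2 β
  Φ_snd : ∀ x (u : GTan E x), (J.Φ x u).2 = θ x u.1

end Calculus

end GenContact

end

/-! All four bundles are graphs over `TM`. Since `ι_F θ = 0` and `θ(π^♯ α) = -α` whenever `α(F) =
0`, the element `e - iΦ(e)` with `e = X + α` equals `v - i ι_v θ` for `v = X - i π^♯ α`. Thus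
`E^{(1,0)}` and `E^{(0,1)}` are `{v ∓ i ι_v θ | η(v) = 0}`. Adding `F` to the first drops the
condition `η(v) = 0`, and adding `η` to the second allows an extra term `c η`. So everything takes
place in the family `graphBundle` of elements `v + κ ι_v θ + c η`, where `κ = ±i` and `v` or `c` may
be constrained.

Because `dθ = 0` and `dη = 0`, the Courant bracket of the graphs of `(X, a)` and `(Y, b)` is the
graph of `([X, Y], X b - Y a)`, provided that `η` kills `X` and `Y` or that `a = b = 0`
(`cCourant_graph`). The Lie algebroid axioms are then those of vector fields acting on functions by
derivations (`isLieAlgebroid`).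

For the bialgebroid condition, let `j` send `v + i ι_v θ + c η` to `v - i ι_v θ`, and let `Ω(ξ, ζ) =
⟨ξ, jζ⟩`, which is `i θ` on the vector parts. Closedness of `θ` and `η` gives `d_B a = L_a Ω` for
every section `a` of `A`. Hence `d_B` is a coboundary, and `d_B [a, b] = L_{[a,b]} Ω = L_a L_b Ω -
L_b L_a Ω` is the required identity (`compatible_of_potential`).

Existence and uniqueness of the pair are linear algebra. A skew form in odd dimension has a kernel,
and the volume condition makes `ker η ∩ ker θ` zero, so `♭` is invertible, the Reeb field is `-♭⁻¹
η`, and `π^♯ = -♭⁻¹ - F ⊗ F`. Smoothness holds because inversion of linear maps is smooth. -/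

noncomputable section

set_option linter.unusedSectionVars false

namespace GenContact

/-! ### Sections of smooth vector bundles: global extension, homomorphisms, inverses -/

section Bundles

open ContinuousLinearMap

variable {E : Type*} [NormedAddCommGroup E] [NormedSpace ℝ E] [FiniteDimensional ℝ E]
  {M : Type*} [TopologicalSpace M] [ChartedSpace E M] [IsManifold 𝓘(ℝ, E) ∞ M]
  {F₁ : Type*} [NormedAddCommGroup F₁] [NormedSpace ℝ F₁]
  {V₁ : M → Type*} [TopologicalSpace (TotalSpace F₁ V₁)] [∀ x, AddCommGroup (V₁ x)]
  [∀ x, Module ℝ (V₁ x)] [∀ x, TopologicalSpace (V₁ x)]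
  [FiberBundle F₁ V₁] [VectorBundle ℝ F₁ V₁] [ContMDiffVectorBundle ∞ F₁ V₁ 𝓘(ℝ, E)]
  {F₂ : Type*} [NormedAddCommGroup F₂] [NormedSpace ℝ F₂]
  {V₂ : M → Type*} [TopologicalSpace (TotalSpace F₂ V₂)] [∀ x, AddCommGroup (V₂ x)]
  [∀ x, Module ℝ (V₂ x)] [∀ x, TopologicalSpace (V₂ x)]
  [FiberBundle F₂ V₂] [VectorBundle ℝ F₂ V₂] [ContMDiffVectorBundle ∞ F₂ V₂ 𝓘(ℝ, E)]

variable (F₁) in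
/-- A section that is smooth near `x₀` agrees near `x₀` with a globally smooth one. -/
theorem exists_contMDiff_section_eventuallyEq [T2Space M] {x₀ : M} {s : ∀ x, V₁ x} {U : Set M}
    (hU : U ∈ 𝓝 x₀)
    (hs : ContMDiffOn 𝓘(ℝ, E) (𝓘(ℝ, E).prod 𝓘(ℝ, F₁)) ∞ (fun x => TotalSpace.mk' F₁ x (s x)) U) :
    ∃ t : ∀ x, V₁ x,
      ContMDiff 𝓘(ℝ, E) (𝓘(ℝ, E).prod 𝓘(ℝ, F₁)) ∞ (fun x => TotalSpace.mk' F₁ x (t x)) ∧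
      ∀ᶠ x in 𝓝 x₀, t x = s x := by
  obtain ⟨W, hWU, hW, hxW⟩ := mem_nhds_iff.1 hU
  -- Multiplying by a bump function supported in `W` and equal to `1` near `x₀` globalizes the
  -- section without changing its germ.
  obtain ⟨f, hf, -⟩ := (SmoothBumpFunction.nhds_basis_support (I := 𝓘(ℝ, E))
    (hW.mem_nhds hxW)).mem_iff.1 (hW.mem_nhds hxW)
  refine ⟨(f : M → ℝ) • s,
    ContMDiffOn.smul_section_of_tsupport f.contMDiff.contMDiffOn hW hf (hs.mono hWU), ?_⟩
  filter_upwards [f.eventuallyEq_one] with x hx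
  simp [hx]

variable (F₁) in
theorem exists_contMDiff_section [T2Space M] {x₀ : M} (v : V₁ x₀) :
    ∃ t : ∀ x, V₁ x,
      ContMDiff 𝓘(ℝ, E) (𝓘(ℝ, E).prod 𝓘(ℝ, F₁)) ∞ (fun x => TotalSpace.mk' F₁ x (t x)) ∧
      t x₀ = v := by
  obtain ⟨U, hU, hs⟩ := FiberBundle.exists_contMDiffOn_extend (k := ∞) 𝓘(ℝ, E) F₁ v
  obtain ⟨t, ht, hts⟩ := exists_contMDiff_section_eventuallyEq F₁ hU hs
  exact ⟨t, ht, by simpa using hts.self_of_nhds⟩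

variable [∀ x, IsTopologicalAddGroup (V₂ x)] [∀ x, ContinuousSMul ℝ (V₂ x)]

/-- A field of linear maps is smooth if it maps smooth sections to smooth sections. -/
theorem contMDiff_hom_of_forall [T2Space M] [FiniteDimensional ℝ F₁] (ϕ : ∀ x, V₁ x →L[ℝ] V₂ x)
    (h : ∀ s : ∀ x, V₁ x,
      ContMDiff 𝓘(ℝ, E) (𝓘(ℝ, E).prod 𝓘(ℝ, F₁)) ∞ (fun x => TotalSpace.mk' F₁ x (s x)) →
      ContMDiff 𝓘(ℝ, E) (𝓘(ℝ, E).prod 𝓘(ℝ, F₂)) ∞ (fun x => TotalSpace.mk' F₂ x (ϕ x (s x)))) :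
    ContMDiff 𝓘(ℝ, E) (𝓘(ℝ, E).prod 𝓘(ℝ, F₁ →L[ℝ] F₂)) ∞
      (fun x => TotalSpace.mk' (F₁ →L[ℝ] F₂) (E := fun x => V₁ x →L[ℝ] V₂ x) x (ϕ x)) := by
  intro x₀
  rw [contMDiffAt_hom_bundle]
  refine ⟨contMDiffAt_id, ?_⟩
  let b := Module.finBasis ℝ F₁
  -- The local section with constant coordinates `v` agrees near `x₀` with a global smooth section,
  -- and the hypothesis applies to the latter.
  have key : ∀ v : F₁, ContMDiffAt 𝓘(ℝ, E) 𝓘(ℝ, F₂) ∞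
      (fun x => inCoordinates F₁ V₁ F₂ V₂ x₀ x x₀ x (ϕ x) v) x₀ := by
    intro v
    have hmem := FiberBundle.mem_baseSet_trivializationAt' (F := F₁) (E := V₁) x₀
    have hU := (trivializationAt F₁ V₁ x₀).open_baseSet.mem_nhds hmem
    have hs : ContMDiffOn 𝓘(ℝ, E) (𝓘(ℝ, E).prod 𝓘(ℝ, F₁)) ∞
        (fun x => TotalSpace.mk' F₁ x ((trivializationAt F₁ V₁ x₀).symm x v))
        (trivializationAt F₁ V₁ x₀).baseSet := by
      rw [(trivializationAt F₁ V₁ x₀).contMDiffOn_section_baseSet_iff]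
      refine (contMDiffOn_const (c := v)).congr fun x hx => ?_
      simp [hx]
    obtain ⟨t, ht, hts⟩ := exists_contMDiff_section_eventuallyEq F₁ hU hs
    have h2 := (contMDiffAt_section _).1 (h t ht x₀)
    refine h2.congr_of_eventuallyEq ?_
    filter_upwards [hts, hU, (trivializationAt F₂ V₂ x₀).open_baseSet.mem_nhds
      (FiberBundle.mem_baseSet_trivializationAt' (F := F₂) (E := V₂) x₀)] with x hx hxU hx2
    rw [hx]
    simp [inCoordinates, Trivialization.coe_linearMapAt_of_mem _ hx2, Trivialization.symmL_apply,
      hxU]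
  -- A linear map is encoded by the images of the basis vectors, so smoothness can be checked on
  -- each of them.
  let Λ : (F₁ →L[ℝ] F₂) ≃L[ℝ] (Fin (Module.finrank ℝ F₁) → F₂) :=
    ((b.equivFunL.arrowCongr (ContinuousLinearEquiv.refl ℝ F₂)).trans
      (ContinuousLinearEquiv.piRing _))
  have h3 : ContMDiffAt 𝓘(ℝ, E) 𝓘(ℝ, Fin (Module.finrank ℝ F₁) → F₂) ∞
      (fun x => Λ (inCoordinates F₁ V₁ F₂ V₂ x₀ x x₀ x (ϕ x))) x₀ := by
    rw [contMDiffAt_pi_space]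
    intro i
    refine (key (b i)).congr_of_eventuallyEq (Filter.Eventually.of_forall fun x => ?_)
    change inCoordinates F₁ V₁ F₂ V₂ x₀ x x₀ x (ϕ x) (b.equivFunL.symm (Pi.single i 1)) = _
    congr 1
    rw [ContinuousLinearEquiv.symm_apply_eq]
    ext j
    simp [Pi.single_apply, Finsupp.single_apply, eq_comm]
  have h4 := (Λ.symm : (Fin (Module.finrank ℝ F₁) → F₂) →L[ℝ] (F₁ →L[ℝ] F₂)).contMDiff.contMDiffAt
    (n := ∞) |>.comp x₀ h3
  simpa [Function.comp_def] using h4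

variable [∀ x, IsTopologicalAddGroup (V₁ x)] [∀ x, ContinuousSMul ℝ (V₁ x)]

/-- The pointwise inverse of a smooth field of invertible linear maps maps smooth sections to
smooth sections. -/
theorem contMDiff_inverse_apply [CompleteSpace F₁] {ϕ : ∀ x, V₁ x →L[ℝ] V₂ x}
    (hϕ : ContMDiff 𝓘(ℝ, E) (𝓘(ℝ, E).prod 𝓘(ℝ, F₁ →L[ℝ] F₂)) ∞
      (fun x => TotalSpace.mk' (F₁ →L[ℝ] F₂) (E := fun x => V₁ x →L[ℝ] V₂ x) x (ϕ x)))
    (hinv : ∀ x, (ϕ x).IsInvertible) {t : ∀ x, V₂ x}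
    (ht : ContMDiff 𝓘(ℝ, E) (𝓘(ℝ, E).prod 𝓘(ℝ, F₂)) ∞ (fun x => TotalSpace.mk' F₂ x (t x))) :
    ContMDiff 𝓘(ℝ, E) (𝓘(ℝ, E).prod 𝓘(ℝ, F₁)) ∞
      (fun x => TotalSpace.mk' F₁ x ((ϕ x).inverse (t x))) := by
  intro x₀
  have h1 := ((contMDiffAt_hom_bundle _).1 (hϕ x₀)).2
  have hm1 := FiberBundle.mem_baseSet_trivializationAt' (F := F₁) (E := V₁) x₀
  have hm2 := FiberBundle.mem_baseSet_trivializationAt' (F := F₂) (E := V₂) x₀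
  refine ContMDiffAt.clm_apply_of_inCoordinates (b₁ := id) (b₂ := id) ?_ (ht x₀) contMDiffAt_id
  -- Operator inversion is smooth at invertible operators. Near `x₀` the inverse of the coordinate
  -- expression is the coordinate expression of the inverse.
  have h2 : ContMDiffAt 𝓘(ℝ, E) 𝓘(ℝ, F₂ →L[ℝ] F₁) ∞
      (ContinuousLinearMap.inverse ∘ fun x => inCoordinates F₁ V₁ F₂ V₂ x₀ x x₀ x (ϕ x)) x₀ := by
    refine ContMDiffAt.comp x₀ (ContDiffAt.contMDiffAt ?_) h1
    apply IsInvertible.contDiffAt_map_inverse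
    rw [inCoordinates_eq hm1 hm2]
    exact isInvertible_equiv.comp ((hinv x₀).comp isInvertible_equiv)
  refine h2.congr_of_eventuallyEq ?_
  filter_upwards [(trivializationAt F₁ V₁ x₀).open_baseSet.mem_nhds hm1,
    (trivializationAt F₂ V₂ x₀).open_baseSet.mem_nhds hm2] with x hx1 hx2
  obtain ⟨e, he⟩ := hinv x
  simp only [Function.comp_apply, id]
  rw [inCoordinates_eq hx1 hx2, inCoordinates_eq hx2 hx1, ← he]
  rw [inverse_equiv, inverse_equiv_comp]
  ext v
  simp

end Bundles

/-! ### Smoothness of real vector fields and one-forms; the bracket as a commutator -/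

section RealCalculus

theorem minSmoothness_natCast_le_infty (k : ℕ) : minSmoothness ℝ (k : WithTop ℕ∞) ≤ ∞ := by
  rw [minSmoothness_of_isRCLikeNormedField]
  exact WithTop.coe_le_coe.2 (le_top (a := (k : ℕ∞)))

variable {E : Type*} [NormedAddCommGroup E] [NormedSpace ℝ E] [FiniteDimensional ℝ E]
  {M : Type*} [TopologicalSpace M] [ChartedSpace E M] [IsManifold 𝓘(ℝ, E) ∞ M]

namespace SmoothVFOn

variable {X Y Z : ∀ x : M, Tan E x}

theorem contMDiff (hX : SmoothVFOn X Set.univ) :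
    ContMDiff 𝓘(ℝ, E) (𝓘(ℝ, E).prod 𝓘(ℝ, E)) ∞
      (fun x => TotalSpace.mk' E (E := fun x : M => TangentSpace 𝓘(ℝ, E) x) x (X x)) :=
  contMDiffOn_univ.1 hX

theorem mdifferentiableAt (hX : SmoothVFOn X Set.univ) (x : M) :
    MDifferentiableAt 𝓘(ℝ, E) (𝓘(ℝ, E).prod 𝓘(ℝ, E))
      (fun x => TotalSpace.mk' E (E := fun x : M => TangentSpace 𝓘(ℝ, E) x) x (X x)) x :=
  hX.contMDiff.mdifferentiableAt (by simp)

theorem add (hX : SmoothVFOn X Set.univ) (hY : SmoothVFOn Y Set.univ) :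
    SmoothVFOn (fun x => X x + Y x) Set.univ :=
  ContMDiffOn.add_section hX hY

theorem sub (hX : SmoothVFOn X Set.univ) (hY : SmoothVFOn Y Set.univ) :
    SmoothVFOn (fun x => X x - Y x) Set.univ :=
  ContMDiffOn.sub_section hX hY

theorem neg (hX : SmoothVFOn X Set.univ) : SmoothVFOn (fun x => -X x) Set.univ :=
  ContMDiffOn.neg_section hX

theorem smul {f : M → ℝ} (hf : ContMDiff 𝓘(ℝ, E) 𝓘(ℝ, ℝ) ∞ f) (hX : SmoothVFOn X Set.univ) :
    SmoothVFOn (fun x => f x • X x) Set.univ :=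
  ContMDiffOn.smul_section hf.contMDiffOn hX

theorem zero : SmoothVFOn (fun x : M => (0 : Tan E x)) Set.univ :=
  (contMDiff_zeroSection ℝ (fun x : M => TangentSpace 𝓘(ℝ, E) x)).contMDiffOn

theorem mlieBracket (hX : SmoothVFOn X Set.univ) (hY : SmoothVFOn Y Set.univ) :
    SmoothVFOn (VectorField.mlieBracket 𝓘(ℝ, E) X Y) Set.univ := by
  have : IsManifold 𝓘(ℝ, E) (minSmoothness ℝ 2) M :=
    IsManifold.of_le (n := ∞) (minSmoothness_natCast_le_infty 2)
  have : IsManifold 𝓘(ℝ, E) (((⊤ : ℕ∞) : WithTop ℕ∞) + 1) M := IsManifold.of_le (n := ∞) (by simp)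
  refine contMDiffOn_univ.2 ?_
  exact ContDiff.mlieBracket_vectorField (m := ⊤) (n := ⊤) hX.contMDiff hY.contMDiff (by simp)

/-- The function `X f` is the fibre component of the tangent map of `f` composed with `X`. -/
theorem mvfderiv_apply {F : Type*} [NormedAddCommGroup F] [NormedSpace ℝ F] {f : M → F}
    (hf : ContMDiff 𝓘(ℝ, E) 𝓘(ℝ, F) ∞ f) (hX : SmoothVFOn X Set.univ) :
    ContMDiff 𝓘(ℝ, E) 𝓘(ℝ, F) ∞ (fun x => mvfderiv 𝓘(ℝ, E) f x (X x)) := by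
  have h1 := (hf.contMDiff_tangentMap (m := ∞) (by simp)).comp hX.contMDiff
  exact (contMDiff_snd_tangentBundle_modelSpace F 𝓘(ℝ, F)).comp h1

end SmoothVFOn

namespace SmoothOneFormOn

variable {α β : ∀ x : M, Cotan E x} {X : ∀ x : M, Tan E x}

theorem add (hα : SmoothOneFormOn α Set.univ) (hβ : SmoothOneFormOn β Set.univ) :
    SmoothOneFormOn (fun x => α x + β x) Set.univ :=
  ContMDiffOn.add_section hα hβ

theorem sub (hα : SmoothOneFormOn α Set.univ) (hβ : SmoothOneFormOn β Set.univ) :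
    SmoothOneFormOn (fun x => α x - β x) Set.univ :=
  ContMDiffOn.sub_section hα hβ

theorem smul {f : M → ℝ} (hf : ContMDiff 𝓘(ℝ, E) 𝓘(ℝ, ℝ) ∞ f)
    (hα : SmoothOneFormOn α Set.univ) : SmoothOneFormOn (fun x => f x • α x) Set.univ :=
  ContMDiffOn.smul_section hf.contMDiffOn hα

theorem zero : SmoothOneFormOn (fun x : M => (0 : Cotan E x)) Set.univ :=
  (contMDiff_zeroSection ℝ (fun x : M => TangentSpace 𝓘(ℝ, E) x →L[ℝ] ℝ)).contMDiffOn

theorem apply (hα : SmoothOneFormOn α Set.univ) (hX : SmoothVFOn X Set.univ) :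
    ContMDiff 𝓘(ℝ, E) 𝓘(ℝ, ℝ) ∞ (fun x => α x (X x)) := by
  have h := ContMDiff.clm_bundle_apply (IB := 𝓘(ℝ, E)) (F₁ := E) (F₂ := ℝ)
    (E₁ := fun x : M => TangentSpace 𝓘(ℝ, E) x) (E₂ := Bundle.Trivial M ℝ)
    (b := fun y => y) (ϕ := α) (v := X) (contMDiffOn_univ.1 hα) hX.contMDiff
  intro x
  exact ((Bundle.contMDiffAt_totalSpace).1 (h x)).2

/-- A one-form is smooth if its values on smooth vector fields are smooth. -/
theorem of_forall [T2Space M] (h : ∀ Z : ∀ x : M, Tan E x, SmoothVFOn Z Set.univ →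
    ContMDiff 𝓘(ℝ, E) 𝓘(ℝ, ℝ) ∞ (fun x => α x (Z x))) : SmoothOneFormOn α Set.univ := by
  refine contMDiffOn_univ.2 (contMDiff_hom_of_forall (F₁ := E) (F₂ := ℝ)
    (V₁ := fun x : M => TangentSpace 𝓘(ℝ, E) x) (V₂ := Bundle.Trivial M ℝ) α fun Z hZ => ?_)
  intro x
  exact (Bundle.contMDiffAt_totalSpace).2 ⟨contMDiffAt_id, h Z (contMDiffOn_univ.2 hZ) x⟩

end SmoothOneFormOn

/-- This allows pointwise identities between tensors to be tested on globally smooth fields. -/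
theorem exists_smoothVFOn_eq [T2Space M] {x : M} (v : Tan E x) :
    ∃ Z : ∀ x : M, Tan E x, SmoothVFOn Z Set.univ ∧ Z x = v := by
  obtain ⟨t, ht, h⟩ := exists_contMDiff_section (E := E) E
    (V₁ := fun x : M => TangentSpace 𝓘(ℝ, E) x) v
  exact ⟨t, contMDiffOn_univ.2 ht, h⟩

theorem SmoothOneFormOn.lieDeriv [T2Space M] {X : ∀ x : M, Tan E x} {β : ∀ x : M, Cotan E x}
    (hX : SmoothVFOn X Set.univ) (hβ : SmoothOneFormOn β Set.univ) :
    SmoothOneFormOn (lieDeriv X β) Set.univ := by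
  refine SmoothOneFormOn.of_forall fun Z hZ => ?_
  simp only [lieDeriv_apply X hβ hZ]
  exact (hX.mvfderiv_apply (hβ.apply hZ)).sub (hβ.apply (hX.mlieBracket hZ))

theorem SmoothBilin.apply {b : ∀ x : M, Tan E x →L[ℝ] Tan E x →L[ℝ] ℝ} (hb : SmoothBilin b)
    {X : ∀ x : M, Tan E x} (hX : SmoothVFOn X Set.univ) :
    SmoothOneFormOn (fun x => b x (X x)) Set.univ :=
  contMDiffOn_univ.2 (ContMDiff.clm_bundle_apply (IB := 𝓘(ℝ, E)) (F₁ := E) (F₂ := E →L[ℝ] ℝ)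
    (E₁ := fun x : M => TangentSpace 𝓘(ℝ, E) x)
    (E₂ := fun x : M => TangentSpace 𝓘(ℝ, E) x →L[ℝ] ℝ)
    (b := fun y => y) (ϕ := b) (v := X) hb hX.contMDiff)

/-- The Lie bracket is the commutator of derivations. -/
theorem mvfderiv_mlieBracket [T2Space M] {X Y : ∀ x : M, Tan E x} (hX : SmoothVFOn X Set.univ)
    (hY : SmoothVFOn Y Set.univ) {f : M → ℝ} (hf : ContMDiff 𝓘(ℝ, E) 𝓘(ℝ, ℝ) ∞ f) (x : M) :
    mvfderiv 𝓘(ℝ, E) f x (VectorField.mlieBracket 𝓘(ℝ, E) X Y x) =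
      mvfderiv 𝓘(ℝ, E) (fun y => mvfderiv 𝓘(ℝ, E) f y (Y y)) x (X x) -
        mvfderiv 𝓘(ℝ, E) (fun y => mvfderiv 𝓘(ℝ, E) f y (X y)) x (Y x) := by
  -- The scalar identity is read off as the coefficient of a nonzero vector `Z x`; in a zero tangent
  -- space both sides vanish.
  by_cases h0 : ∀ v : Tan E x, v = 0
  · rw [h0 (VectorField.mlieBracket 𝓘(ℝ, E) X Y x), h0 (X x), h0 (Y x)]
    simp
  push Not at h0
  obtain ⟨v, hv⟩ := h0
  obtain ⟨Z, hZ, rfl⟩ := exists_smoothVFOn_eq v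
  have hfx : ∀ y, MDifferentiableAt 𝓘(ℝ, E) 𝓘(ℝ, ℝ) f y := fun y => hf.mdifferentiableAt (by simp)
  have e : ∀ W : ∀ x : M, Tan E x, ∀ V : ∀ x : M, Tan E x, SmoothVFOn V Set.univ →
      VectorField.mlieBracket 𝓘(ℝ, E) W (f • V) =
      (fun y => mvfderiv 𝓘(ℝ, E) f y (W y)) • V + f • VectorField.mlieBracket 𝓘(ℝ, E) W V := by
    intro W V hV
    ext y
    rw [VectorField.mlieBracket_smul_right (hfx y) (hV.mdifferentiableAt y)]
    rfl
  have key : ∀ V W : ∀ x : M, Tan E x, SmoothVFOn V Set.univ → SmoothVFOn W Set.univ →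
      VectorField.mlieBracket 𝓘(ℝ, E) V (VectorField.mlieBracket 𝓘(ℝ, E) W (f • Z)) x =
      mvfderiv 𝓘(ℝ, E) (fun y => mvfderiv 𝓘(ℝ, E) f y (W y)) x (V x) • Z x
      + mvfderiv 𝓘(ℝ, E) f x (W x) • VectorField.mlieBracket 𝓘(ℝ, E) V Z x
      + mvfderiv 𝓘(ℝ, E) f x (V x) • VectorField.mlieBracket 𝓘(ℝ, E) W Z x
      + f x • VectorField.mlieBracket 𝓘(ℝ, E) V (VectorField.mlieBracket 𝓘(ℝ, E) W Z) x := by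
    intro V W hV hW
    have hg := hW.mvfderiv_apply hf
    rw [e W Z hZ, VectorField.mlieBracket_add_right
      (W := (fun y => mvfderiv 𝓘(ℝ, E) f y (W y)) • Z)
      (W₁ := f • VectorField.mlieBracket 𝓘(ℝ, E) W Z)
      ((SmoothVFOn.smul hg hZ).mdifferentiableAt x)
      ((SmoothVFOn.smul hf (hW.mlieBracket hZ)).mdifferentiableAt x),
      VectorField.mlieBracket_smul_right (hg.mdifferentiableAt (by simp))
        (hZ.mdifferentiableAt x),
      VectorField.mlieBracket_smul_right (hfx x) ((hW.mlieBracket hZ).mdifferentiableAt x)]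
    module
  have le2 : minSmoothness ℝ 2 ≤ (∞ : WithTop ℕ∞) := minSmoothness_natCast_le_infty 2
  have : IsManifold 𝓘(ℝ, E) (minSmoothness ℝ 3) M :=
    IsManifold.of_le (n := ∞) (minSmoothness_natCast_le_infty 3)
  have hfZ : SmoothVFOn (f • Z) Set.univ := SmoothVFOn.smul hf hZ
  -- The Jacobi identity for `X`, `Y`, `f Z` minus `f` times the one for `X`, `Y`, `Z` leaves the
  -- difference of the two sides of the claim times `Z x`: the mixed first-order terms are symmetric
  -- in `X` and `Y`.
  have j1 := VectorField.leibniz_identity_mlieBracket_apply (x := x) ((hX.contMDiff x).of_le le2)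
    ((hY.contMDiff x).of_le le2) ((hfZ.contMDiff x).of_le le2)
  have j2 := VectorField.leibniz_identity_mlieBracket_apply (x := x) ((hX.contMDiff x).of_le le2)
    ((hY.contMDiff x).of_le le2) ((hZ.contMDiff x).of_le le2)
  rw [key X Y hX hY, key Y X hY hX, e _ Z hZ, j2] at j1
  have j3 : (mvfderiv 𝓘(ℝ, E) f x (VectorField.mlieBracket 𝓘(ℝ, E) X Y x) -
      (mvfderiv 𝓘(ℝ, E) (fun y => mvfderiv 𝓘(ℝ, E) f y (Y y)) x (X x) -
        mvfderiv 𝓘(ℝ, E) (fun y => mvfderiv 𝓘(ℝ, E) f y (X y)) x (Y x))) • Z x = 0 := by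
    simp only [Pi.add_apply, Pi.smul_apply'] at j1
    rw [← sub_eq_zero] at j1
    rw [← neg_eq_zero, ← j1]
    module
  exact sub_eq_zero.1 ((smul_eq_zero.1 j3).resolve_right hv)

end RealCalculus

/-! ### Complexified linear and bilinear maps -/

namespace Cplx

variable {V W : Type*} [AddCommGroup V] [Module ℝ V] [AddCommGroup W] [Module ℝ W]

/-- The complexification of a linear map. -/
def map (f : V →ₗ[ℝ] W) : Cplx V →ₗ[ℂ] Cplx W where
  toFun v := ⟨f v.re, f v.im⟩
  map_add' u v := by ext <;> simp
  map_smul' c v := by ext <;> simp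

@[simp] theorem map_re (f : V →ₗ[ℝ] W) (v : Cplx V) : (map f v).re = f v.re := rfl
@[simp] theorem map_im (f : V →ₗ[ℝ] W) (v : Cplx V) : (map f v).im = f v.im := rfl

/-- The complex bilinear extension of a real bilinear form. -/
def bilin (b : V →ₗ[ℝ] W →ₗ[ℝ] ℝ) : Cplx V →ₗ[ℂ] Cplx W →ₗ[ℂ] ℂ :=
  LinearMap.mk₂ ℂ
    (fun u v => ⟨b u.re v.re - b u.im v.im, b u.re v.im + b u.im v.re⟩)
    (by intros; apply Complex.ext <;> simp <;> ring)
    (by intros; apply Complex.ext <;> simp <;> ring)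
    (by intros; apply Complex.ext <;> simp <;> ring)
    (by intros; apply Complex.ext <;> simp <;> ring)

theorem bilin_re (b : V →ₗ[ℝ] W →ₗ[ℝ] ℝ) (u : Cplx V) (v : Cplx W) :
    (bilin b u v).re = b u.re v.re - b u.im v.im := rfl
theorem bilin_im (b : V →ₗ[ℝ] W →ₗ[ℝ] ℝ) (u : Cplx V) (v : Cplx W) :
    (bilin b u v).im = b u.re v.im + b u.im v.re := rfl

variable [TopologicalSpace V]

/-- The evaluation of complex covectors on complex vectors. -/
def ev : Cplx (V →L[ℝ] ℝ) →ₗ[ℂ] Cplx V →ₗ[ℂ] ℂ :=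
  bilin (ContinuousLinearMap.coeLM ℝ)

@[simp] theorem ev_re (α : Cplx (V →L[ℝ] ℝ)) (v : Cplx V) :
    (ev α v).re = α.re v.re - α.im v.im := rfl
@[simp] theorem ev_im (α : Cplx (V →L[ℝ] ℝ)) (v : Cplx V) :
    (ev α v).im = α.re v.im + α.im v.re := rfl

theorem ev_ext {α β : Cplx (V →L[ℝ] ℝ)} (h : ∀ v : V, ev α ⟨v, 0⟩ = ev β ⟨v, 0⟩) : α = β := by
  ext v
  · simpa using congrArg Complex.re (h v)
  · simpa using congrArg Complex.im (h v)

end Cplx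

/-! ### Calculus of complex functions, vector fields and one-forms -/

section ComplexCalculus

variable {E : Type*} [NormedAddCommGroup E] [NormedSpace ℝ E] [FiniteDimensional ℝ E]
  {M : Type*} [TopologicalSpace M] [ChartedSpace E M] [IsManifold 𝓘(ℝ, E) ∞ M]

/-- `f` is a smooth complex function. -/
abbrev SmoothCFun (f : M → ℂ) : Prop := ContMDiff 𝓘(ℝ, E) 𝓘(ℝ, ℂ) ∞ f

/-- `α` is a smooth complex one-form. -/
def SmoothCForm (α : ∀ x : M, Cplx (Cotan E x)) : Prop :=
  SmoothOneFormOn (fun x => (α x).re) Set.univ ∧ SmoothOneFormOn (fun x => (α x).im) Set.univ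

variable {f g : M → ℂ} {X Y Z : ∀ x : M, CTan E x} {α β : ∀ x : M, Cplx (Cotan E x)}

theorem SmoothCFun.re (hf : SmoothCFun (E := E) f) :
    ContMDiff 𝓘(ℝ, E) 𝓘(ℝ, ℝ) ∞ (fun x => (f x).re) :=
  Complex.reCLM.contMDiff.comp hf

theorem SmoothCFun.im (hf : SmoothCFun (E := E) f) :
    ContMDiff 𝓘(ℝ, E) 𝓘(ℝ, ℝ) ∞ (fun x => (f x).im) :=
  Complex.imCLM.contMDiff.comp hf

theorem SmoothCFun.mk (hr : ContMDiff 𝓘(ℝ, E) 𝓘(ℝ, ℝ) ∞ (fun x => (f x).re))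
    (hi : ContMDiff 𝓘(ℝ, E) 𝓘(ℝ, ℝ) ∞ (fun x => (f x).im)) : SmoothCFun (E := E) f := by
  exact (Complex.equivRealProdCLM.symm : ℝ × ℝ →L[ℝ] ℂ).contMDiff.comp (hr.prodMk_space hi)

theorem SmoothCFun.mul (hf : SmoothCFun (E := E) f) (hg : SmoothCFun (E := E) g) :
    SmoothCFun (E := E) (fun x => f x * g x) :=
  SmoothCFun.mk ((hf.re.mul hg.re).sub (hf.im.mul hg.im)) ((hf.re.mul hg.im).add (hf.im.mul hg.re))

theorem SmoothCFun.add (hf : SmoothCFun (E := E) f) (hg : SmoothCFun (E := E) g) :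
    SmoothCFun (E := E) (fun x => f x + g x) :=
  ContMDiff.add hf hg

theorem SmoothCFun.sub (hf : SmoothCFun (E := E) f) (hg : SmoothCFun (E := E) g) :
    SmoothCFun (E := E) (fun x => f x - g x) :=
  ContMDiff.sub hf hg

theorem SmoothCFun.mdifferentiableAt (hf : SmoothCFun (E := E) f) (x : M) :
    MDifferentiableAt 𝓘(ℝ, E) 𝓘(ℝ, ℂ) f x :=
  ContMDiff.mdifferentiableAt hf (by simp)

theorem mvfderiv_clm_comp {F G : Type*} [NormedAddCommGroup F] [NormedSpace ℝ F]
    [NormedAddCommGroup G] [NormedSpace ℝ G] (T : F →L[ℝ] G) {h : M → F} {x : M}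
    (hh : MDifferentiableAt 𝓘(ℝ, E) 𝓘(ℝ, F) h x) (v : Tan E x) :
    mvfderiv 𝓘(ℝ, E) (fun y => T (h y)) x v = T (mvfderiv 𝓘(ℝ, E) h x v) := by
  have h1 := mfderiv_comp_apply (I := 𝓘(ℝ, E)) (I' := 𝓘(ℝ, F)) (I'' := 𝓘(ℝ, G)) (g := T) (f := h)
    x T.mdifferentiableAt hh v
  refine (congrArg (NormedSpace.fromTangentSpace (T (h x))) h1).trans ?_
  rw [ContinuousLinearMap.mfderiv_eq]
  rfl

theorem SmoothCFun.mvfderiv_re (hf : SmoothCFun (E := E) f) (x : M) (v : Tan E x) :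
    (mvfderiv 𝓘(ℝ, E) f x v).re = mvfderiv 𝓘(ℝ, E) (fun y => (f y).re) x v :=
  (mvfderiv_clm_comp Complex.reCLM (hf.mdifferentiableAt x) v).symm

theorem SmoothCFun.mvfderiv_im (hf : SmoothCFun (E := E) f) (x : M) (v : Tan E x) :
    (mvfderiv 𝓘(ℝ, E) f x v).im = mvfderiv 𝓘(ℝ, E) (fun y => (f y).im) x v :=
  (mvfderiv_clm_comp Complex.imCLM (hf.mdifferentiableAt x) v).symm

theorem SmoothCFun.cDeriv_re (hf : SmoothCFun (E := E) f) (x : M) :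
    (cDeriv X f x).re = mvfderiv 𝓘(ℝ, E) (fun y => (f y).re) x (X x).re -
      mvfderiv 𝓘(ℝ, E) (fun y => (f y).im) x (X x).im := by
  simp [cDeriv, hf.mvfderiv_re, hf.mvfderiv_im, sub_eq_add_neg]

theorem SmoothCFun.cDeriv_im (hf : SmoothCFun (E := E) f) (x : M) :
    (cDeriv X f x).im = mvfderiv 𝓘(ℝ, E) (fun y => (f y).im) x (X x).re +
      mvfderiv 𝓘(ℝ, E) (fun y => (f y).re) x (X x).im := by
  simp [cDeriv, hf.mvfderiv_re, hf.mvfderiv_im]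

theorem cDeriv_add (hf : SmoothCFun (E := E) f) (hg : SmoothCFun (E := E) g) (x : M) :
    cDeriv X (fun y => f y + g y) x = cDeriv X f x + cDeriv X g x := by
  simp only [cDeriv, mvfderiv_fun_add (hf.mdifferentiableAt x) (hg.mdifferentiableAt x),
    add_apply]
  ring

theorem cDeriv_sub (hf : SmoothCFun (E := E) f) (hg : SmoothCFun (E := E) g) (x : M) :
    cDeriv X (fun y => f y - g y) x = cDeriv X f x - cDeriv X g x := by
  simp only [cDeriv, mvfderiv_fun_sub (hf.mdifferentiableAt x) (hg.mdifferentiableAt x),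
    sub_apply]
  ring

theorem cDeriv_neg (x : M) : cDeriv X (fun y => -f y) x = -cDeriv X f x := by
  simp only [cDeriv, mvfderiv_fun_neg, neg_apply]
  ring

theorem cDeriv_const (c : ℂ) (x : M) : cDeriv X (fun _ => c) x = 0 := by
  simp [cDeriv, mvfderiv_const]

theorem mvfderiv_complex_mul (hf : SmoothCFun (E := E) f) (hg : SmoothCFun (E := E) g) (x : M)
    (v : Tan E x) : mvfderiv 𝓘(ℝ, E) (fun y => f y * g y) x v =
      f x * mvfderiv 𝓘(ℝ, E) g x v + g x * mvfderiv 𝓘(ℝ, E) f x v := by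
  have h : SmoothCFun (E := E) (fun y => f y * g y) := hf.mul hg
  have dr := fun x => hf.re.mdifferentiableAt (x := x) (by simp)
  have di := fun x => hf.im.mdifferentiableAt (x := x) (by simp)
  have er := fun x => hg.re.mdifferentiableAt (x := x) (by simp)
  have ei := fun x => hg.im.mdifferentiableAt (x := x) (by simp)
  apply Complex.ext
  · rw [h.mvfderiv_re]
    simp only [Complex.mul_re, Complex.add_re, hf.mvfderiv_re, hf.mvfderiv_im, hg.mvfderiv_re,
      hg.mvfderiv_im]
    rw [mvfderiv_fun_sub (g := fun y => (f y).re * (g y).re) (g' := fun y => (f y).im * (g y).im)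
      ((dr x).mul (er x)) ((di x).mul (ei x)), mvfderiv_fun_mul (dr x) (er x),
      mvfderiv_fun_mul (di x) (ei x)]
    simp
    ring
  · rw [h.mvfderiv_im]
    simp only [Complex.mul_im, Complex.add_im, hf.mvfderiv_re, hf.mvfderiv_im, hg.mvfderiv_re,
      hg.mvfderiv_im]
    rw [mvfderiv_fun_add (g := fun y => (f y).re * (g y).im) (g' := fun y => (f y).im * (g y).re)
      ((dr x).mul (ei x)) ((di x).mul (er x)), mvfderiv_fun_mul (dr x) (ei x),
      mvfderiv_fun_mul (di x) (er x)]
    simp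
    ring

theorem cDeriv_mul (hf : SmoothCFun (E := E) f) (hg : SmoothCFun (E := E) g) (x : M) :
    cDeriv X (fun y => f y * g y) x = f x * cDeriv X g x + g x * cDeriv X f x := by
  simp only [cDeriv, mvfderiv_complex_mul hf hg]
  ring

theorem cDeriv_const_mul (c : ℂ) (hf : SmoothCFun (E := E) f) (x : M) :
    cDeriv X (fun y => c * f y) x = c * cDeriv X f x := by
  rw [cDeriv_mul contMDiff_const hf, cDeriv_const]
  ring

theorem cDeriv_smul_left (x : M) : cDeriv (fun y => g y • X y) f x = g x * cDeriv X f x := by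
  simp only [cDeriv, Cplx.smul_re, Cplx.smul_im, map_sub, map_add, map_smul]
  apply Complex.ext <;> simp <;> ring

theorem cDeriv_add_left (x : M) :
    cDeriv (fun y => X y + Y y) f x = cDeriv X f x + cDeriv Y f x := by
  simp only [cDeriv, Cplx.add_re, Cplx.add_im, map_add]
  ring

theorem SmoothCVF.add (hX : SmoothCVF X) (hY : SmoothCVF Y) : SmoothCVF (fun x => X x + Y x) :=
  ⟨hX.1.add hY.1, hX.2.add hY.2⟩

theorem SmoothCVF.sub (hX : SmoothCVF X) (hY : SmoothCVF Y) : SmoothCVF (fun x => X x - Y x) :=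
  ⟨hX.1.sub hY.1, hX.2.sub hY.2⟩

theorem SmoothCVF.smul (hf : SmoothCFun (E := E) f) (hX : SmoothCVF X) :
    SmoothCVF (fun x => f x • X x) :=
  ⟨(SmoothVFOn.smul hf.re hX.1).sub (SmoothVFOn.smul hf.im hX.2),
    (SmoothVFOn.smul hf.re hX.2).add (SmoothVFOn.smul hf.im hX.1)⟩

theorem SmoothCVF.cLieBracket (hX : SmoothCVF X) (hY : SmoothCVF Y) :
    SmoothCVF (cLieBracket X Y) :=
  ⟨(hX.1.mlieBracket hY.1).sub (hX.2.mlieBracket hY.2),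
    (hX.1.mlieBracket hY.2).add (hX.2.mlieBracket hY.1)⟩

theorem SmoothCForm.add (hα : SmoothCForm α) (hβ : SmoothCForm β) :
    SmoothCForm (fun x => α x + β x) :=
  ⟨hα.1.add hβ.1, hα.2.add hβ.2⟩

theorem SmoothCForm.smul (hf : SmoothCFun (E := E) f) (hα : SmoothCForm α) :
    SmoothCForm (fun x => f x • α x) :=
  ⟨(SmoothOneFormOn.smul hf.re hα.1).sub (SmoothOneFormOn.smul hf.im hα.2),
    (SmoothOneFormOn.smul hf.re hα.2).add (SmoothOneFormOn.smul hf.im hα.1)⟩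

theorem SmoothCForm.ev (hα : SmoothCForm α) (hX : SmoothCVF X) :
    SmoothCFun (E := E) (fun x => Cplx.ev (α x) (X x)) :=
  SmoothCFun.mk ((hα.1.apply hX.1).sub (hα.2.apply hX.2))
    ((hα.1.apply hX.2).add (hα.2.apply hX.1))

theorem SmoothCVF.cDeriv (hX : SmoothCVF X) (hf : SmoothCFun (E := E) f) :
    SmoothCFun (E := E) (cDeriv X f) := by
  refine ContMDiff.add (hX.1.mvfderiv_apply hf) (SmoothCFun.mul contMDiff_const
    (hX.2.mvfderiv_apply hf))

theorem mlieBracket_fun_add_right {X Y Z : ∀ x : M, Tan E x} (hY : SmoothVFOn Y Set.univ)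
    (hZ : SmoothVFOn Z Set.univ) (x : M) :
    VectorField.mlieBracket 𝓘(ℝ, E) X (fun y => Y y + Z y) x =
      VectorField.mlieBracket 𝓘(ℝ, E) X Y x + VectorField.mlieBracket 𝓘(ℝ, E) X Z x :=
  VectorField.mlieBracket_add_right (hY.mdifferentiableAt x) (hZ.mdifferentiableAt x)

theorem mlieBracket_fun_sub_right {X Y Z : ∀ x : M, Tan E x} (hY : SmoothVFOn Y Set.univ)
    (hZ : SmoothVFOn Z Set.univ) (x : M) :
    VectorField.mlieBracket 𝓘(ℝ, E) X (fun y => Y y - Z y) x =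
      VectorField.mlieBracket 𝓘(ℝ, E) X Y x - VectorField.mlieBracket 𝓘(ℝ, E) X Z x := by
  rw [eq_sub_iff_add_eq, ← mlieBracket_fun_add_right (hY.sub hZ) hZ]
  simp

theorem mlieBracket_fun_smul_right {X Y : ∀ x : M, Tan E x} {f : M → ℝ}
    (hf : ContMDiff 𝓘(ℝ, E) 𝓘(ℝ, ℝ) ∞ f) (hY : SmoothVFOn Y Set.univ) (x : M) :
    VectorField.mlieBracket 𝓘(ℝ, E) X (fun y => f y • Y y) x =
      mvfderiv 𝓘(ℝ, E) f x (X x) • Y x + f x • VectorField.mlieBracket 𝓘(ℝ, E) X Y x :=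
  VectorField.mlieBracket_smul_right (hf.mdifferentiableAt (by simp)) (hY.mdifferentiableAt x)

theorem cLieBracket_swap (X Y : ∀ x : M, CTan E x) : cLieBracket X Y = -cLieBracket Y X := by
  ext x
  · simp only [cLieBracket, cplxBracket, Pi.neg_apply, Cplx.neg_re]
    rw [VectorField.mlieBracket_swap_apply, VectorField.mlieBracket_swap_apply (V := fun y => (X y).im)]
    abel
  · simp only [cLieBracket, cplxBracket, Pi.neg_apply, Cplx.neg_im]
    rw [VectorField.mlieBracket_swap_apply, VectorField.mlieBracket_swap_apply (V := fun y => (X y).im)]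
    abel

theorem cLieBracket_add_right (hY : SmoothCVF Y) (hZ : SmoothCVF Z) (x : M) :
    cLieBracket X (fun y => Y y + Z y) x = cLieBracket X Y x + cLieBracket X Z x := by
  ext1
  · simp only [cLieBracket, cplxBracket, Cplx.add_re, Cplx.add_im]
    rw [mlieBracket_fun_add_right hY.1 hZ.1, mlieBracket_fun_add_right hY.2 hZ.2]
    abel
  · simp only [cLieBracket, cplxBracket, Cplx.add_re, Cplx.add_im]
    rw [mlieBracket_fun_add_right hY.1 hZ.1, mlieBracket_fun_add_right hY.2 hZ.2]
    abel

theorem cLieBracket_smul_right (hf : SmoothCFun (E := E) f) (hY : SmoothCVF Y) (x : M) :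
    cLieBracket X (fun y => f y • Y y) x = f x • cLieBracket X Y x + cDeriv X f x • Y x := by
  have a1 := SmoothVFOn.smul hf.re hY.1
  have a2 := SmoothVFOn.smul hf.im hY.2
  have a3 := SmoothVFOn.smul hf.re hY.2
  have a4 := SmoothVFOn.smul hf.im hY.1
  ext1
  · simp only [cLieBracket, cplxBracket, Cplx.smul_re, Cplx.smul_im, Cplx.add_re, hf.cDeriv_re,
      hf.cDeriv_im]
    rw [mlieBracket_fun_sub_right a1 a2, mlieBracket_fun_add_right a3 a4,
      mlieBracket_fun_smul_right hf.re hY.1, mlieBracket_fun_smul_right hf.im hY.2,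
      mlieBracket_fun_smul_right hf.re hY.2, mlieBracket_fun_smul_right hf.im hY.1]
    module
  · simp only [cLieBracket, cplxBracket, Cplx.smul_re, Cplx.smul_im, Cplx.add_im, hf.cDeriv_re,
      hf.cDeriv_im]
    rw [mlieBracket_fun_sub_right a1 a2, mlieBracket_fun_add_right a3 a4,
      mlieBracket_fun_smul_right hf.re hY.1, mlieBracket_fun_smul_right hf.im hY.2,
      mlieBracket_fun_smul_right hf.re hY.2, mlieBracket_fun_smul_right hf.im hY.1]
    module

theorem mlieBracket_jacobi {X Y Z : ∀ x : M, Tan E x} (hX : SmoothVFOn X Set.univ)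
    (hY : SmoothVFOn Y Set.univ) (hZ : SmoothVFOn Z Set.univ) (x : M) :
    VectorField.mlieBracket 𝓘(ℝ, E) X (VectorField.mlieBracket 𝓘(ℝ, E) Y Z) x
      + VectorField.mlieBracket 𝓘(ℝ, E) Y (VectorField.mlieBracket 𝓘(ℝ, E) Z X) x
      + VectorField.mlieBracket 𝓘(ℝ, E) Z (VectorField.mlieBracket 𝓘(ℝ, E) X Y) x = 0 := by
  have le2 : minSmoothness ℝ 2 ≤ (∞ : WithTop ℕ∞) := minSmoothness_natCast_le_infty 2
  have : IsManifold 𝓘(ℝ, E) (minSmoothness ℝ 3) M :=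
    IsManifold.of_le (n := ∞) (minSmoothness_natCast_le_infty 3)
  rw [VectorField.leibniz_identity_mlieBracket_apply (x := x) ((hX.contMDiff x).of_le le2)
    ((hY.contMDiff x).of_le le2) ((hZ.contMDiff x).of_le le2),
    VectorField.mlieBracket_swap (V := Z) (W := X),
    VectorField.mlieBracket_swap_apply (V := VectorField.mlieBracket 𝓘(ℝ, E) X Y)]
  -- The scalar `-1` carries the sign produced by the swap out of the inner bracket.
  have h := VectorField.mlieBracket_const_smul_right (c := (-1 : ℝ)) (V := Y) (x := x)
    ((hX.mlieBracket hZ).mdifferentiableAt x)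
  simp only [neg_smul, one_smul] at h
  rw [h]
  abel

theorem cLieBracket_jacobi (hX : SmoothCVF X) (hY : SmoothCVF Y) (hZ : SmoothCVF Z) (x : M) :
    cLieBracket X (cLieBracket Y Z) x + cLieBracket Y (cLieBracket Z X) x
      + cLieBracket Z (cLieBracket X Y) x = 0 := by
  obtain ⟨x1, x2⟩ := hX
  obtain ⟨y1, y2⟩ := hY
  obtain ⟨z1, z2⟩ := hZ
  ext1
  · simp only [cLieBracket, cplxBracket, Cplx.add_re, Cplx.zero_re]
    rw [mlieBracket_fun_sub_right (y1.mlieBracket z1) (y2.mlieBracket z2),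
      mlieBracket_fun_add_right (y1.mlieBracket z2) (y2.mlieBracket z1),
      mlieBracket_fun_sub_right (z1.mlieBracket x1) (z2.mlieBracket x2),
      mlieBracket_fun_add_right (z1.mlieBracket x2) (z2.mlieBracket x1),
      mlieBracket_fun_sub_right (x1.mlieBracket y1) (x2.mlieBracket y2),
      mlieBracket_fun_add_right (x1.mlieBracket y2) (x2.mlieBracket y1)]
    -- The real part uses the real identities with an even number of imaginary fields, a pair
    -- contributing `i² = -1`. The imaginary part uses those with an odd number.
    linear_combination (norm := abel) mlieBracket_jacobi x1 y1 z1 x - mlieBracket_jacobi x1 y2 z2 x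
      - mlieBracket_jacobi x2 y1 z2 x - mlieBracket_jacobi x2 y2 z1 x
  · simp only [cLieBracket, cplxBracket, Cplx.add_im, Cplx.zero_im]
    rw [mlieBracket_fun_sub_right (y1.mlieBracket z1) (y2.mlieBracket z2),
      mlieBracket_fun_add_right (y1.mlieBracket z2) (y2.mlieBracket z1),
      mlieBracket_fun_sub_right (z1.mlieBracket x1) (z2.mlieBracket x2),
      mlieBracket_fun_add_right (z1.mlieBracket x2) (z2.mlieBracket x1),
      mlieBracket_fun_sub_right (x1.mlieBracket y1) (x2.mlieBracket y2),
      mlieBracket_fun_add_right (x1.mlieBracket y2) (x2.mlieBracket y1)]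
    linear_combination (norm := abel) mlieBracket_jacobi x1 y1 z2 x + mlieBracket_jacobi x1 y2 z1 x
      + mlieBracket_jacobi x2 y1 z1 x - mlieBracket_jacobi x2 y2 z2 x

/-- It serves for the Jacobi identity in the `η`-component of graph sections, and for commuting Lie
derivatives in the bialgebroid condition. -/
theorem cDeriv_cLieBracket [T2Space M] (hX : SmoothCVF X) (hY : SmoothCVF Y)
    (hf : SmoothCFun (E := E) f) (x : M) :
    cDeriv (cLieBracket X Y) f x = cDeriv X (cDeriv Y f) x - cDeriv Y (cDeriv X f) x := by
  obtain ⟨x1, x2⟩ := hX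
  obtain ⟨y1, y2⟩ := hY
  have d := fun {W : ∀ x : M, Tan E x} {g : M → ℝ} (hW : SmoothVFOn W Set.univ)
    (hg : ContMDiff 𝓘(ℝ, E) 𝓘(ℝ, ℝ) ∞ g) =>
    (hW.mvfderiv_apply hg).mdifferentiableAt (x := x) (by simp)
  have r := hf.re
  have i := hf.im
  apply Complex.ext
  · rw [hf.cDeriv_re, Complex.sub_re, (SmoothCVF.cDeriv ⟨y1, y2⟩ hf).cDeriv_re,
      (SmoothCVF.cDeriv ⟨x1, x2⟩ hf).cDeriv_re]
    simp only [hf.cDeriv_re, hf.cDeriv_im, cLieBracket, cplxBracket, map_sub, map_add]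
    rw [mvfderiv_fun_sub (d y1 r) (d y2 i), mvfderiv_fun_add (d y1 i) (d y2 r),
      mvfderiv_fun_sub (d x1 r) (d x2 i), mvfderiv_fun_add (d x1 i) (d x2 r)]
    simp only [add_apply, sub_apply]
    rw [mvfderiv_mlieBracket x1 y1 r, mvfderiv_mlieBracket x2 y2 r, mvfderiv_mlieBracket x1 y2 i,
      mvfderiv_mlieBracket x2 y1 i]
    ring
  · rw [hf.cDeriv_im, Complex.sub_im, (SmoothCVF.cDeriv ⟨y1, y2⟩ hf).cDeriv_im,
      (SmoothCVF.cDeriv ⟨x1, x2⟩ hf).cDeriv_im]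
    simp only [hf.cDeriv_re, hf.cDeriv_im, cLieBracket, cplxBracket, map_sub, map_add]
    rw [mvfderiv_fun_sub (d y1 r) (d y2 i), mvfderiv_fun_add (d y1 i) (d y2 r),
      mvfderiv_fun_sub (d x1 r) (d x2 i), mvfderiv_fun_add (d x1 i) (d x2 r)]
    simp only [add_apply, sub_apply]
    rw [mvfderiv_mlieBracket x1 y1 i, mvfderiv_mlieBracket x2 y2 i, mvfderiv_mlieBracket x1 y2 r,
      mvfderiv_mlieBracket x2 y1 r]
    ring

end ComplexCalculus

/-! ### Closedness and the Courant bracket over the complex numbers -/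

section ComplexCourant

variable {E : Type*} [NormedAddCommGroup E] [NormedSpace ℝ E] [FiniteDimensional ℝ E]
  {M : Type*} [TopologicalSpace M] [ChartedSpace E M] [IsManifold 𝓘(ℝ, E) ∞ M]

/-- The complex linear extension of `X ↦ ι_X θ`. -/
def cContract (θ : ∀ x : M, Tan E x →L[ℝ] Tan E x →L[ℝ] ℝ) (x : M) :
    CTan E x →ₗ[ℂ] Cplx (Cotan E x) :=
  Cplx.map (θ x : Tan E x →ₗ[ℝ] Cotan E x)

/-- A real one-form as a complex one. -/
def ofRealForm (η : ∀ x : M, Cotan E x) (x : M) : Cplx (Cotan E x) := ⟨η x, 0⟩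

@[simp] theorem cContract_re (θ : ∀ x : M, Tan E x →L[ℝ] Tan E x →L[ℝ] ℝ) {x : M} (v : CTan E x) :
    (cContract θ x v).re = θ x v.re := rfl
@[simp] theorem cContract_im (θ : ∀ x : M, Tan E x →L[ℝ] Tan E x →L[ℝ] ℝ) {x : M} (v : CTan E x) :
    (cContract θ x v).im = θ x v.im := rfl
@[simp] theorem ofRealForm_re (η : ∀ x : M, Cotan E x) (x : M) : (ofRealForm η x).re = η x := rfl
@[simp] theorem ofRealForm_im (η : ∀ x : M, Cotan E x) (x : M) : (ofRealForm η x).im = 0 := rfl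

/-- The projection `(TM ⊕ T^*M)_ℂ → (T^*M)_ℂ`. -/
def formPart (x : M) : CGTan E x →ₗ[ℂ] Cplx (Cotan E x) where
  toFun v := ⟨v.re.2, v.im.2⟩
  map_add' _ _ := rfl
  map_smul' _ _ := rfl

/-- The element `X + α` of `(TM ⊕ T^*M)_ℂ`. -/
def ofParts {x : M} (v : CTan E x) (α : Cplx (Cotan E x)) : CGTan E x := ⟨(v.re, α.re), (v.im, α.im)⟩

@[simp] theorem anchor_re {x : M} (w : CGTan E x) : (anchor x w).re = w.re.1 := rfl
@[simp] theorem anchor_im {x : M} (w : CGTan E x) : (anchor x w).im = w.im.1 := rfl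
@[simp] theorem formPart_re {x : M} (w : CGTan E x) : (formPart x w).re = w.re.2 := rfl
@[simp] theorem formPart_im {x : M} (w : CGTan E x) : (formPart x w).im = w.im.2 := rfl
@[simp] theorem anchor_ofParts {x : M} (v : CTan E x) (α : Cplx (Cotan E x)) :
    anchor x (ofParts v α) = v := rfl
@[simp] theorem formPart_ofParts {x : M} (v : CTan E x) (α : Cplx (Cotan E x)) :
    formPart x (ofParts v α) = α := rfl

theorem ext_parts {x : M} {w w' : CGTan E x} (h : anchor x w = anchor x w')
    (h' : formPart x w = formPart x w') : w = w' := by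
  have h1 := congrArg Cplx.re h
  have h2 := congrArg Cplx.im h
  have h3 := congrArg Cplx.re h'
  have h4 := congrArg Cplx.im h'
  exact Cplx.ext (Prod.ext h1 h3) (Prod.ext h2 h4)

theorem cPairing_eq {x : M} (u v : CGTan E x) : cPairing u v =
    (1 / 2) * (Cplx.ev (formPart x v) (anchor x u) + Cplx.ev (formPart x u) (anchor x v)) := by
  apply Complex.ext <;> simp [cPairing, pairing] <;> ring

theorem smoothCSectionOn_univ_iff {s : ∀ x : M, CGTan E x} : SmoothCSectionOn s Set.univ ↔
    SmoothCVF (fun x => anchor x (s x)) ∧ SmoothCForm (fun x => formPart x (s x)) := by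
  simp only [SmoothCSectionOn, SmoothCVF, SmoothCForm, anchor_re, anchor_im, formPart_re,
    formPart_im]
  tauto

variable {X Y Z : ∀ x : M, CTan E x} {η : ∀ x : M, Cotan E x}
  {θ : ∀ x : M, Tan E x →L[ℝ] Tan E x →L[ℝ] ℝ}

theorem SmoothBilin.cContract (hθ : SmoothBilin θ) (hX : SmoothCVF X) :
    SmoothCForm (fun x => cContract θ x (X x)) :=
  ⟨hθ.apply hX.1, hθ.apply hX.2⟩

theorem SmoothOneFormOn.ofRealForm (hη : SmoothOneFormOn η Set.univ) :
    SmoothCForm (ofRealForm η) :=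
  ⟨hη, SmoothOneFormOn.zero⟩

/-- The equation `dη = 0` is solved for `η([X, Y])`, so that it can be used to rewrite brackets as
derivatives. -/
theorem ClosedOne.complex (h : ClosedOne η) (hη : SmoothOneFormOn η Set.univ) (hX : SmoothCVF X)
    (hY : SmoothCVF Y) (x : M) :
    Cplx.ev (ofRealForm η x) (cLieBracket X Y x) =
      cDeriv X (fun y => Cplx.ev (ofRealForm η y) (Y y)) x
      - cDeriv Y (fun y => Cplx.ev (ofRealForm η y) (X y)) x := by
  have sX := hη.ofRealForm.ev hX
  have sY := hη.ofRealForm.ev hY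
  obtain ⟨x1, x2⟩ := hX
  obtain ⟨y1, y2⟩ := hY
  have k := fun {A B : ∀ x : M, Tan E x} (hA : SmoothVFOn A Set.univ) (hB : SmoothVFOn B Set.univ) =>
    h Set.univ A B isOpen_univ hA hB x trivial
  have k1 := k x1 y1
  have k2 := k x2 y2
  have k3 := k x1 y2
  have k4 := k x2 y1
  simp only [extDerivOne] at k1 k2 k3 k4
  apply Complex.ext
  · rw [Complex.sub_re, sX.cDeriv_re, sY.cDeriv_re]
    simp only [Cplx.ev_re, Cplx.ev_im, ofRealForm_re, ofRealForm_im, cLieBracket, cplxBracket,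
      zero_apply, sub_zero, add_zero, map_sub]
    linear_combination k2 - k1
  · rw [Complex.sub_im, sX.cDeriv_im, sY.cDeriv_im]
    simp only [Cplx.ev_re, Cplx.ev_im, ofRealForm_re, ofRealForm_im, cLieBracket, cplxBracket,
      zero_apply, sub_zero, add_zero, map_add]
    linear_combination -k3 - k4

theorem ClosedTwo.complex (h : ClosedTwo θ) (hθ : SmoothBilin θ) (hX : SmoothCVF X)
    (hY : SmoothCVF Y) (hZ : SmoothCVF Z) (x : M) :
    cDeriv X (fun y => Cplx.ev (cContract θ y (Y y)) (Z y)) x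
      - cDeriv Y (fun y => Cplx.ev (cContract θ y (X y)) (Z y)) x
      + cDeriv Z (fun y => Cplx.ev (cContract θ y (X y)) (Y y)) x
      - Cplx.ev (cContract θ x (cLieBracket X Y x)) (Z x)
      + Cplx.ev (cContract θ x (cLieBracket X Z x)) (Y x)
      - Cplx.ev (cContract θ x (cLieBracket Y Z x)) (X x) = 0 := by
  have s1 := (hθ.cContract hY).ev hZ
  have s2 := (hθ.cContract hX).ev hZ
  have s3 := (hθ.cContract hX).ev hY
  obtain ⟨x1, x2⟩ := hX
  obtain ⟨y1, y2⟩ := hY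
  obtain ⟨z1, z2⟩ := hZ
  have d := fun {A B : ∀ x : M, Tan E x} (hA : SmoothVFOn A Set.univ)
    (hB : SmoothVFOn B Set.univ) =>
    ((hθ.apply hA).apply hB).mdifferentiableAt (x := x) (by simp)
  have k := fun {A B C : ∀ x : M, Tan E x} (hA : SmoothVFOn A Set.univ)
    (hB : SmoothVFOn B Set.univ) (hC : SmoothVFOn C Set.univ) =>
    h Set.univ A B C isOpen_univ hA hB hC x trivial
  simp only [extDerivTwo] at k
  apply Complex.ext
  · simp only [Complex.sub_re, Complex.add_re, Complex.zero_re, s1.cDeriv_re, s2.cDeriv_re,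
      s3.cDeriv_re]
    simp only [Cplx.ev_re, Cplx.ev_im, cContract_re, cContract_im, cLieBracket, cplxBracket]
    rw [mvfderiv_fun_sub (d y1 z1) (d y2 z2), mvfderiv_fun_add (d y1 z2) (d y2 z1),
      mvfderiv_fun_sub (d x1 z1) (d x2 z2), mvfderiv_fun_add (d x1 z2) (d x2 z1),
      mvfderiv_fun_sub (d x1 y1) (d x2 y2), mvfderiv_fun_add (d x1 y2) (d x2 y1)]
    simp only [add_apply, sub_apply, map_add, map_sub]
    linear_combination k x1 y1 z1 - k x1 y2 z2 - k x2 y1 z2 - k x2 y2 z1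
  · simp only [Complex.sub_im, Complex.add_im, Complex.zero_im, s1.cDeriv_im, s2.cDeriv_im,
      s3.cDeriv_im]
    simp only [Cplx.ev_re, Cplx.ev_im, cContract_re, cContract_im, cLieBracket, cplxBracket]
    rw [mvfderiv_fun_sub (d y1 z1) (d y2 z2), mvfderiv_fun_add (d y1 z2) (d y2 z1),
      mvfderiv_fun_sub (d x1 z1) (d x2 z2), mvfderiv_fun_add (d x1 z2) (d x2 z1),
      mvfderiv_fun_sub (d x1 y1) (d x2 y2), mvfderiv_fun_add (d x1 y2) (d x2 y1)]
    simp only [add_apply, sub_apply, map_add, map_sub]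
    linear_combination k x1 y1 z2 + k x1 y2 z1 + k x2 y1 z1 - k x2 y2 z2

theorem courant_snd_apply {X Y Z : ∀ x : M, Tan E x} {α β : ∀ x : M, Cotan E x}
    (hX : SmoothVFOn X Set.univ) (hY : SmoothVFOn Y Set.univ) (hZ : SmoothVFOn Z Set.univ)
    (hα : SmoothOneFormOn α Set.univ) (hβ : SmoothOneFormOn β Set.univ) (x : M) :
    (courant (fun y => (X y, α y)) (fun y => (Y y, β y)) x).2 (Z x) =
      mvfderiv 𝓘(ℝ, E) (fun y => β y (Z y)) x (X x)
      - β x (VectorField.mlieBracket 𝓘(ℝ, E) X Z x)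
      - mvfderiv 𝓘(ℝ, E) (fun y => α y (Z y)) x (Y x)
      + α x (VectorField.mlieBracket 𝓘(ℝ, E) Y Z x)
      - (1 / 2) * (mvfderiv 𝓘(ℝ, E) (fun y => β y (X y)) x (Z x)
        - mvfderiv 𝓘(ℝ, E) (fun y => α y (Y y)) x (Z x)) := by
  simp only [courant]
  rw [mvfderiv_fun_sub ((hβ.apply hX).mdifferentiableAt (by simp))
    ((hα.apply hY).mdifferentiableAt (by simp))]
  simp only [sub_apply, smul_apply, smul_eq_mul, lieDeriv_apply X hβ hZ,
    lieDeriv_apply Y hα hZ]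
  ring

theorem anchor_cCourant (s t : ∀ x : M, CGTan E x) (x : M) : anchor x (cCourant s t x) =
    cLieBracket (fun y => anchor y (s y)) (fun y => anchor y (t y)) x :=
  rfl

/-- Testing the form part on a field `Z` removes the Lie derivatives of forms. Only derivatives of
functions and Lie brackets of fields remain, and to these the closedness of `η` and `θ` applies
directly. -/
theorem ev_formPart_cCourant {s t : ∀ x : M, CGTan E x} (hs : SmoothCSectionOn s Set.univ)
    (ht : SmoothCSectionOn t Set.univ) (hZ : SmoothCVF Z) (x : M) :
    Cplx.ev (formPart x (cCourant s t x)) (Z x) =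
      cDeriv (fun y => anchor y (s y)) (fun y => Cplx.ev (formPart y (t y)) (Z y)) x
      - Cplx.ev (formPart x (t x)) (cLieBracket (fun y => anchor y (s y)) Z x)
      - cDeriv (fun y => anchor y (t y)) (fun y => Cplx.ev (formPart y (s y)) (Z y)) x
      + Cplx.ev (formPart x (s x)) (cLieBracket (fun y => anchor y (t y)) Z x)
      - (1 / 2) * (cDeriv Z (fun y => Cplx.ev (formPart y (t y)) (anchor y (s y))) x
        - cDeriv Z (fun y => Cplx.ev (formPart y (s y)) (anchor y (t y))) x) := by
  obtain ⟨hX, hα⟩ := smoothCSectionOn_univ_iff.1 hs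
  obtain ⟨hY, hβ⟩ := smoothCSectionOn_univ_iff.1 ht
  have s1 := hβ.ev hZ
  have s2 := hα.ev hZ
  have s3 := hβ.ev hX
  have s4 := hα.ev hY
  obtain ⟨x1, a1, x2, a2⟩ := hs
  obtain ⟨y1, b1, y2, b2⟩ := ht
  obtain ⟨z1, z2⟩ := hZ
  have d := fun {A : ∀ x : M, Cotan E x} {B : ∀ x : M, Tan E x} (hA : SmoothOneFormOn A Set.univ)
    (hB : SmoothVFOn B Set.univ) => (hA.apply hB).mdifferentiableAt (x := x) (by simp)
  have half_re : ∀ z : ℂ, ((1 / 2) * z).re = (1 / 2) * z.re := fun z => by simp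
  have half_im : ∀ z : ℂ, ((1 / 2) * z).im = (1 / 2) * z.im := fun z => by simp
  -- The digits record whether `s`, `t` and `Z` enter with their real part (`1`) or their imaginary
  -- part (`2`).
  have k111 := courant_snd_apply x1 y1 z1 a1 b1 x
  have k221 := courant_snd_apply x2 y2 z1 a2 b2 x
  have k122 := courant_snd_apply x1 y2 z2 a1 b2 x
  have k212 := courant_snd_apply x2 y1 z2 a2 b1 x
  have k112 := courant_snd_apply x1 y1 z2 a1 b1 x
  have k222 := courant_snd_apply x2 y2 z2 a2 b2 x
  have k121 := courant_snd_apply x1 y2 z1 a1 b2 x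
  have k211 := courant_snd_apply x2 y1 z1 a2 b1 x
  apply Complex.ext
  · simp only [Complex.sub_re, Complex.add_re, half_re, s1.cDeriv_re, s2.cDeriv_re, s3.cDeriv_re,
      s4.cDeriv_re]
    simp only [Cplx.ev_re, Cplx.ev_im, formPart_re, formPart_im, anchor_re, anchor_im, cLieBracket,
      cplxBracket, cCourant, Prod.snd_add, Prod.snd_sub]
    rw [mvfderiv_fun_sub (d b1 z1) (d b2 z2), mvfderiv_fun_add (d b1 z2) (d b2 z1),
      mvfderiv_fun_sub (d a1 z1) (d a2 z2), mvfderiv_fun_add (d a1 z2) (d a2 z1),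
      mvfderiv_fun_sub (d b1 x1) (d b2 x2), mvfderiv_fun_add (d b1 x2) (d b2 x1),
      mvfderiv_fun_sub (d a1 y1) (d a2 y2), mvfderiv_fun_add (d a1 y2) (d a2 y1)]
    simp only [add_apply, sub_apply, map_add, map_sub]
    linear_combination k111 - k221 - k122 - k212
  · simp only [Complex.sub_im, Complex.add_im, half_im, s1.cDeriv_im, s2.cDeriv_im, s3.cDeriv_im,
      s4.cDeriv_im]
    simp only [Cplx.ev_re, Cplx.ev_im, formPart_re, formPart_im, anchor_re, anchor_im, cLieBracket,
      cplxBracket, cCourant, Prod.snd_add, Prod.snd_sub]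
    rw [mvfderiv_fun_sub (d b1 z1) (d b2 z2), mvfderiv_fun_add (d b1 z2) (d b2 z1),
      mvfderiv_fun_sub (d a1 z1) (d a2 z2), mvfderiv_fun_add (d a1 z2) (d a2 z1),
      mvfderiv_fun_sub (d b1 x1) (d b2 x2), mvfderiv_fun_add (d b1 x2) (d b2 x1),
      mvfderiv_fun_sub (d a1 y1) (d a2 y2), mvfderiv_fun_add (d a1 y2) (d a2 y1)]
    simp only [add_apply, sub_apply, map_add, map_sub]
    linear_combination k112 - k222 + k121 + k211

end ComplexCourant

/-! ### Graph bundles and their Lie algebroid structure -/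

section ReebGraph

variable {E : Type*} [NormedAddCommGroup E] [NormedSpace ℝ E] [FiniteDimensional ℝ E]
  {M : Type*} [TopologicalSpace M] [ChartedSpace E M] [IsManifold 𝓘(ℝ, E) ∞ M]

/-- A cosymplectic structure given with its Reeb vector field `F` and a map `P` from one-forms to
vector fields, inverse to `-ι θ` on `ker η`. -/
structure IsReebData (η : ∀ x : M, Cotan E x) (θ : ∀ x : M, Tan E x →L[ℝ] Tan E x →L[ℝ] ℝ)
    (F : ∀ x : M, Tan E x) (P : ∀ x : M, Cotan E x →ₗ[ℝ] Tan E x) : Prop where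
  smooth_η : SmoothOneFormOn η Set.univ
  smooth_θ : SmoothBilin θ
  smooth_F : SmoothVFOn F Set.univ
  smooth_P : ∀ α : ∀ x : M, Cotan E x, SmoothOneFormOn α Set.univ →
    SmoothVFOn (fun x => P x (α x)) Set.univ
  alternating : ∀ x v, θ x v v = 0
  closed_η : ClosedOne η
  closed_θ : ClosedTwo θ
  η_F : ∀ x, η x (F x) = 1
  θ_F : ∀ x, θ x (F x) = 0
  η_P : ∀ x α, η x (P x α) = 0
  θ_P : ∀ x α, θ x (P x α) = -α + α (F x) • η x
  eq_zero : ∀ x v, η x v = 0 → θ x v = 0 → v = 0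

/-- A real vector field as a complex one. -/
def ofRealField (F : ∀ x : M, Tan E x) (x : M) : CTan E x := ⟨F x, 0⟩

@[simp] theorem ofRealField_re (F : ∀ x : M, Tan E x) (x : M) : (ofRealField F x).re = F x := rfl
@[simp] theorem ofRealField_im (F : ∀ x : M, Tan E x) (x : M) : (ofRealField F x).im = 0 := rfl

theorem SmoothVFOn.ofRealField {F : ∀ x : M, Tan E x} (hF : SmoothVFOn F Set.univ) :
    SmoothCVF (ofRealField F) :=
  ⟨hF, SmoothVFOn.zero⟩

/-- The element `v + κ ι_v θ + c η`. -/
def graphElt (η : ∀ x : M, Cotan E x) (θ : ∀ x : M, Tan E x →L[ℝ] Tan E x →L[ℝ] ℝ) (κ : ℂ) (x : M)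
    (v : CTan E x) (c : ℂ) : CGTan E x :=
  ofParts v (κ • cContract θ x v + c • ofRealForm η x)

/-- The elements `v + κ ι_v θ + c η`, where `η(v) = 0` if `p` holds and `c = 0` if `q` holds. -/
def graphBundle (η : ∀ x : M, Cotan E x) (θ : ∀ x : M, Tan E x →L[ℝ] Tan E x →L[ℝ] ℝ) (κ : ℂ)
    (p q : Prop) (x : M) : Submodule ℂ (CGTan E x) where
  carrier := {w | ∃ v c, (p → Cplx.ev (ofRealForm η x) v = 0) ∧ (q → c = 0) ∧
    w = graphElt η θ κ x v c}
  zero_mem' := ⟨0, 0, fun _ => map_zero _, fun _ => rfl,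
    ext_parts (by simp [graphElt]) (by simp [graphElt]; module)⟩
  add_mem' := by
    rintro _ _ ⟨v, c, hv, hc, rfl⟩ ⟨v', c', hv', hc', rfl⟩
    refine ⟨v + v', c + c', fun h => ?_, fun h => ?_, ext_parts ?_ ?_⟩
    · rw [map_add, hv h, hv' h, add_zero]
    · rw [hc h, hc' h, add_zero]
    · simp [graphElt]
    · simp only [graphElt, map_add, formPart_ofParts]; module
  smul_mem' := by
    rintro a _ ⟨v, c, hv, hc, rfl⟩
    refine ⟨a • v, a * c, fun h => ?_, fun h => ?_, ext_parts ?_ ?_⟩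
    · rw [map_smul, hv h, smul_zero]
    · rw [hc h, mul_zero]
    · simp [graphElt]
    · simp only [graphElt, map_smul, formPart_ofParts]; module

variable {X Y Z : ∀ x : M, CTan E x} {a b f : M → ℂ} {η : ∀ x : M, Cotan E x}
  {θ : ∀ x : M, Tan E x →L[ℝ] Tan E x →L[ℝ] ℝ} {F : ∀ x : M, Tan E x}
  {P : ∀ x : M, Cotan E x →ₗ[ℝ] Tan E x} {κ : ℂ} {p q : Prop}

@[simp] theorem anchor_graphElt {x : M} (v : CTan E x) (c : ℂ) :
    anchor x (graphElt η θ κ x v c) = v := rfl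

@[simp] theorem formPart_graphElt {x : M} (v : CTan E x) (c : ℂ) :
    formPart x (graphElt η θ κ x v c) = κ • cContract θ x v + c • ofRealForm η x := rfl

theorem graphElt_add {x : M} (v v' : CTan E x) (c c' : ℂ) : graphElt η θ κ x v c +
    graphElt η θ κ x v' c' = graphElt η θ κ x (v + v') (c + c') :=
  ext_parts (by simp) (by simp; module)

theorem graphElt_smul {x : M} (k : ℂ) (v : CTan E x) (c : ℂ) :
    k • graphElt η θ κ x v c = graphElt η θ κ x (k • v) (k * c) :=
  ext_parts (by simp) (by simp; module)

theorem graphElt_neg {x : M} (v : CTan E x) (c : ℂ) :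
    -graphElt η θ κ x v c = graphElt η θ κ x (-v) (-c) :=
  ext_parts (by simp) (by simp; module)

theorem graphElt_zero {x : M} : graphElt η θ κ x (0 : CTan E x) 0 = 0 :=
  ext_parts (by simp) (by simp; module)

namespace IsReebData

theorem skew (h : IsReebData η θ F P) {x : M} (u v : Tan E x) : θ x u v = -θ x v u := by
  have h1 := h.alternating x (u + v)
  simp only [map_add, add_apply, h.alternating] at h1
  linarith

theorem cSkew (h : IsReebData η θ F P) {x : M} (u v : CTan E x) :
    Cplx.ev (cContract θ x u) v = -Cplx.ev (cContract θ x v) u := by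
  apply Complex.ext
  · simp only [Cplx.ev_re, cContract_re, cContract_im, Complex.neg_re, h.skew u.re, h.skew u.im]
    ring
  · simp only [Cplx.ev_im, cContract_re, cContract_im, Complex.neg_im, h.skew u.re, h.skew u.im]
    ring

theorem smooth_graph (h : IsReebData η θ F P) (hX : SmoothCVF X) (ha : SmoothCFun (E := E) a) :
    SmoothCSectionOn (fun x => graphElt η θ κ x (X x) (a x)) Set.univ :=
  smoothCSectionOn_univ_iff.2 ⟨hX, (SmoothCForm.smul (f := fun _ => κ) contMDiff_const
    (h.smooth_θ.cContract hX)).add (h.smooth_η.ofRealForm.smul ha)⟩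

theorem graph_mem (h : IsReebData η θ F P) (hX : SmoothCVF X) (ha : SmoothCFun (E := E) a)
    (hp : p → ∀ x, Cplx.ev (ofRealForm η x) (X x) = 0) (hq : q → ∀ x, a x = 0) :
    (fun x => graphElt η θ κ x (X x) (a x)) ∈ Sections (graphBundle η θ κ p q) :=
  ⟨h.smooth_graph hX ha, fun x => ⟨X x, a x, fun hp' => hp hp' x, fun hq' => hq hq' x, rfl⟩⟩

/-- The coordinates of a section are smooth: `v` is its anchor, and `c` is the value of its form
part on `F`, because `θ(v, F) = 0` and `η(F) = 1`. -/
theorem exists_eq_graph (h : IsReebData η θ F P) {s : ∀ x : M, CGTan E x}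
    (hs : s ∈ Sections (graphBundle η θ κ p q)) :
    ∃ (X : ∀ x : M, CTan E x) (a : M → ℂ), SmoothCVF X ∧ SmoothCFun (E := E) a ∧
      (p → ∀ x, Cplx.ev (ofRealForm η x) (X x) = 0) ∧ (q → ∀ x, a x = 0) ∧
      s = fun x => graphElt η θ κ x (X x) (a x) := by
  obtain ⟨hX, hα⟩ := smoothCSectionOn_univ_iff.1 hs.1
  choose v c hp hq he using hs.2
  have hv : ∀ x, anchor x (s x) = v x := fun x => by rw [he x, anchor_graphElt]
  have hc : ∀ x, Cplx.ev (formPart x (s x)) (ofRealField F x) = c x := fun x => by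
    rw [he x, formPart_graphElt, map_add, map_smul, map_smul, LinearMap.add_apply,
      LinearMap.smul_apply, h.cSkew]
    apply Complex.ext <;> simp [h.η_F, h.θ_F]
  simp only [hv] at hX
  have hc' := hα.ev h.smooth_F.ofRealField
  simp only [hc] at hc'
  exact ⟨v, c, hX, hc', fun hp' x => hp x hp', fun hq' x => hq x hq', funext he⟩

variable [T2Space M]

/-- The `θ`-terms combine to `κ ι_{[X,Y]} θ` because `dθ = 0`. As `dη = 0`, the `η`-terms give `(X b
- Y a) η` plus the error `(1/2)(b d(η(X)) - η(X) db) - (1/2)(a d(η(Y)) - η(Y) da)`, which vanishes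
in either case of `hpq`. -/
theorem cCourant_graph (h : IsReebData η θ F P) (hX : SmoothCVF X) (hY : SmoothCVF Y)
    (ha : SmoothCFun (E := E) a) (hb : SmoothCFun (E := E) b)
    (hpq : ((∀ x, Cplx.ev (ofRealForm η x) (X x) = 0) ∧ ∀ x, Cplx.ev (ofRealForm η x) (Y x) = 0) ∨
      ((∀ x, a x = 0) ∧ ∀ x, b x = 0)) :
    cCourant (fun x => graphElt η θ κ x (X x) (a x)) (fun x => graphElt η θ κ x (Y x) (b x)) =
      fun x => graphElt η θ κ x (cLieBracket X Y x) (cDeriv X b x - cDeriv Y a x) := by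
  funext x
  refine ext_parts rfl (Cplx.ev_ext fun v => ?_)
  obtain ⟨Z, hZ, rfl⟩ := exists_smoothVFOn_eq v
  have hZ := hZ.ofRealField
  -- The real test vector becomes the value of a complex field, so that the complex bracket formula
  -- applies.
  change Cplx.ev _ (ofRealField Z x) = Cplx.ev _ (ofRealField Z x)
  generalize ofRealField Z = Z at hZ
  rw [ev_formPart_cCourant (h.smooth_graph hX ha) (h.smooth_graph hY hb) hZ]
  simp only [formPart_graphElt, anchor_graphElt, map_add, map_smul, LinearMap.add_apply,
    LinearMap.smul_apply, smul_eq_mul]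
  have eη := h.smooth_η.ofRealForm
  have tXZ := (h.smooth_θ.cContract hX).ev hZ
  have tYZ := (h.smooth_θ.cContract hY).ev hZ
  have tXY := (h.smooth_θ.cContract hX).ev hY
  have tYX := (h.smooth_θ.cContract hY).ev hX
  have c0 : SmoothCFun (E := E) (fun _ : M => κ) := contMDiff_const
  rw [cDeriv_add (c0.mul tYZ) (hb.mul (eη.ev hZ)), cDeriv_add (c0.mul tXZ) (ha.mul (eη.ev hZ)),
    cDeriv_add (c0.mul tYX) (hb.mul (eη.ev hX)), cDeriv_add (c0.mul tXY) (ha.mul (eη.ev hY)),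
    cDeriv_const_mul κ tYZ, cDeriv_const_mul κ tXZ, cDeriv_const_mul κ tYX,
    cDeriv_const_mul κ tXY, cDeriv_mul hb (eη.ev hZ), cDeriv_mul ha (eη.ev hZ),
    cDeriv_mul hb (eη.ev hX), cDeriv_mul ha (eη.ev hY),
    h.closed_η.complex h.smooth_η hX hZ, h.closed_η.complex h.smooth_η hY hZ]
  have k := h.closed_θ.complex h.smooth_θ hX hY hZ x
  simp only [h.cSkew (Y _) (X _), cDeriv_neg]
  rw [h.cSkew _ (Y x), h.cSkew (cLieBracket Y Z x) (X x)] at k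
  rcases hpq with ⟨h1, h2⟩ | ⟨h1, h2⟩
  · simp only [h1, h2, cDeriv_const]
    linear_combination κ * k
  · obtain rfl : a = fun _ => 0 := funext h1
    obtain rfl : b = fun _ => 0 := funext h2
    simp only [cDeriv_const]
    linear_combination κ * k

theorem ev_η_cLieBracket (h : IsReebData η θ F P) (hX : SmoothCVF X) (hY : SmoothCVF Y)
    (h1 : ∀ x, Cplx.ev (ofRealForm η x) (X x) = 0) (h2 : ∀ x, Cplx.ev (ofRealForm η x) (Y x) = 0)
    (x : M) : Cplx.ev (ofRealForm η x) (cLieBracket X Y x) = 0 := by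
  rw [h.closed_η.complex h.smooth_η hX hY]
  simp only [h1, h2, cDeriv_const, sub_zero]

/-- In the coordinates `(X, a)` the bracket is that of the semidirect product of vector fields with
functions, so each axiom splits into one for `[X, Y]` and one for `X b - Y a`. The hypothesis `p ∨
q` secures the alternative needed in `cCourant_graph`, and both constraints pass to brackets. -/
theorem isLieAlgebroid (h : IsReebData η θ F P) (hpq : p ∨ q)
    (hsub : IsSubbundle (graphBundle η θ κ p q)) :
    IsLieAlgebroid anchor cCourant (graphBundle η θ κ p q) := by
  have dich : ∀ {X Y : ∀ x : M, CTan E x} {a b : M → ℂ},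
      (p → ∀ x, Cplx.ev (ofRealForm η x) (X x) = 0) → (p → ∀ x, Cplx.ev (ofRealForm η x) (Y x) = 0) →
      (q → ∀ x, a x = 0) → (q → ∀ x, b x = 0) →
      (((∀ x, Cplx.ev (ofRealForm η x) (X x) = 0) ∧ ∀ x, Cplx.ev (ofRealForm η x) (Y x) = 0) ∨
      ((∀ x, a x = 0) ∧ ∀ x, b x = 0)) := fun h1 h2 h3 h4 =>
    hpq.imp (fun hp => ⟨h1 hp, h2 hp⟩) fun hq => ⟨h3 hq, h4 hq⟩
  have pbr : ∀ {X Y : ∀ x : M, CTan E x}, SmoothCVF X → SmoothCVF Y →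
      (p → ∀ x, Cplx.ev (ofRealForm η x) (X x) = 0) → (p → ∀ x, Cplx.ev (ofRealForm η x) (Y x) = 0) →
      p → ∀ x, Cplx.ev (ofRealForm η x) (cLieBracket X Y x) = 0 := fun hX hY h1 h2 hp =>
    h.ev_η_cLieBracket hX hY (h1 hp) (h2 hp)
  have qbr : ∀ {X Y : ∀ x : M, CTan E x} {a b : M → ℂ}, (q → ∀ x, a x = 0) → (q → ∀ x, b x = 0) →
      q → ∀ x, cDeriv X b x - cDeriv Y a x = 0 := fun {X Y a b} ha hb hq x => by
    obtain rfl : a = fun _ => 0 := funext (ha hq)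
    obtain rfl : b = fun _ => 0 := funext (hb hq)
    simp [cDeriv_const]
  refine ⟨hsub, fun s hs => (smoothCSectionOn_univ_iff.1 hs.1).1, ?_, ?_, ?_, ?_, ?_,
    fun _ _ _ _ _ => rfl⟩
  · intro s hs t ht
    obtain ⟨X, a, hX, ha, hp, hq, rfl⟩ := h.exists_eq_graph hs
    obtain ⟨Y, b, hY, hb, hp', hq', rfl⟩ := h.exists_eq_graph ht
    rw [h.cCourant_graph hX hY ha hb (dich hp hp' hq hq')]
    exact h.graph_mem (hX.cLieBracket hY) ((hX.cDeriv hb).sub (hY.cDeriv ha))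
      (pbr hX hY hp hp') (qbr hq hq')
  · intro s hs t ht
    obtain ⟨X, a, hX, ha, hp, hq, rfl⟩ := h.exists_eq_graph hs
    obtain ⟨Y, b, hY, hb, hp', hq', rfl⟩ := h.exists_eq_graph ht
    rw [h.cCourant_graph hX hY ha hb (dich hp hp' hq hq'),
      h.cCourant_graph hY hX hb ha (dich hp' hp hq' hq), cLieBracket_swap]
    funext x
    change graphElt η θ κ x (-cLieBracket Y X x) _ = -graphElt η θ κ x _ _
    rw [graphElt_neg, neg_sub]
  · intro s hs t ht u hu
    obtain ⟨X, a, hX, ha, hp, hq, rfl⟩ := h.exists_eq_graph hs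
    obtain ⟨Y, b, hY, hb, hp', hq', rfl⟩ := h.exists_eq_graph ht
    obtain ⟨Z, c, hZ, hc, hp'', hq'', rfl⟩ := h.exists_eq_graph hu
    have e : ((fun x => graphElt η θ κ x (Y x) (b x)) + fun x => graphElt η θ κ x (Z x) (c x)) =
        fun x => graphElt η θ κ x (Y x + Z x) (b x + c x) := funext fun x => graphElt_add _ _ _ _
    rw [e, h.cCourant_graph hX hY ha hb (dich hp hp' hq hq'),
      h.cCourant_graph hX hZ ha hc (dich hp hp'' hq hq''),
      h.cCourant_graph hX (hY.add hZ) ha (hb.add hc) (dich hp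
        (fun hp x => by rw [map_add, hp' hp, hp'' hp, add_zero]) hq
        (fun hq x => by rw [hq' hq, hq'' hq, add_zero]))]
    funext x
    rw [Pi.add_apply, graphElt_add, cLieBracket_add_right hY hZ, cDeriv_add hb hc, cDeriv_add_left]
    congr 1
    ring
  · intro s hs t ht u hu
    obtain ⟨X, a, hX, ha, hp, hq, rfl⟩ := h.exists_eq_graph hs
    obtain ⟨Y, b, hY, hb, hp', hq', rfl⟩ := h.exists_eq_graph ht
    obtain ⟨Z, c, hZ, hc, hp'', hq'', rfl⟩ := h.exists_eq_graph hu
    have bXa := hX.cDeriv ha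
    have bXb := hX.cDeriv hb
    have bXc := hX.cDeriv hc
    have bYa := hY.cDeriv ha
    have bYb := hY.cDeriv hb
    have bYc := hY.cDeriv hc
    have bZa := hZ.cDeriv ha
    have bZb := hZ.cDeriv hb
    have bZc := hZ.cDeriv hc
    rw [h.cCourant_graph hX hY ha hb (dich hp hp' hq hq'),
      h.cCourant_graph hY hZ hb hc (dich hp' hp'' hq' hq''),
      h.cCourant_graph hZ hX hc ha (dich hp'' hp hq'' hq),
      h.cCourant_graph (hX.cLieBracket hY) hZ (bXb.sub bYa) hc
        (dich (pbr hX hY hp hp') hp'' (qbr hq hq') hq''),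
      h.cCourant_graph (hY.cLieBracket hZ) hX (bYc.sub bZb) ha
        (dich (pbr hY hZ hp' hp'') hp (qbr hq' hq'') hq),
      h.cCourant_graph (hZ.cLieBracket hX) hY (bZa.sub bXc) hb
        (dich (pbr hZ hX hp'' hp) hp' (qbr hq'' hq) hq')]
    funext x
    simp only [Pi.add_apply, graphElt_add, Pi.zero_apply]
    rw [cLieBracket_swap (cLieBracket X Y) Z, cLieBracket_swap (cLieBracket Y Z) X,
      cLieBracket_swap (cLieBracket Z X) Y,
      cDeriv_cLieBracket hX hY hc, cDeriv_cLieBracket hY hZ ha, cDeriv_cLieBracket hZ hX hb,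
      cDeriv_sub bXb bYa, cDeriv_sub bYc bZb, cDeriv_sub bZa bXc, ← graphElt_zero]
    -- The vector component is the Jacobi identity for fields. In the function component the second
    -- derivatives of `a`, `b` and `c` cancel.
    congr 1
    · have j := cLieBracket_jacobi hX hY hZ x
      simp only [Pi.neg_apply]
      rw [← neg_eq_zero, ← j]
      abel
    · ring
  · intro s hs t ht f hf x
    obtain ⟨X, a, hX, ha, hp, hq, rfl⟩ := h.exists_eq_graph hs
    obtain ⟨Y, b, hY, hb, hp', hq', rfl⟩ := h.exists_eq_graph ht
    have hf : SmoothCFun (E := E) f := hf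
    simp only [graphElt_smul]
    rw [h.cCourant_graph hX hY ha hb (dich hp hp' hq hq'),
      h.cCourant_graph hX (hY.smul hf) ha (hf.mul hb) (dich hp
        (fun hp x => by rw [map_smul, hp' hp, smul_zero]) hq
        (fun hq x => by rw [hq' hq, mul_zero]))]
    simp only [anchor_graphElt, graphElt_smul, graphElt_add]
    rw [cLieBracket_smul_right hf hY, cDeriv_mul hf hb, cDeriv_smul_left]
    congr 1
    ring

end IsReebData

end ReebGraph

/-! ### Local frames and duality of the graph bundles -/

section Subbundle

/-- A real basis of `V` generates the complexification over `ℂ`. -/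
instance Cplx.instModuleFinite {V : Type*} [AddCommGroup V] [Module ℝ V] [Module.Finite ℝ V] :
    Module.Finite ℂ (Cplx V) := by
  let b := Module.finBasis ℝ V
  refine Module.Finite.of_surjective
    (Fintype.linearCombination ℂ (fun i => (⟨b i, 0⟩ : Cplx V))) fun v => ?_
  refine ⟨fun i => ⟨b.repr v.re i, b.repr v.im i⟩, ?_⟩
  rw [Fintype.linearCombination_apply]
  let reₗ : Cplx V →+ V := ⟨⟨Cplx.re, rfl⟩, fun _ _ => rfl⟩
  let imₗ : Cplx V →+ V := ⟨⟨Cplx.im, rfl⟩, fun _ _ => rfl⟩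
  ext1
  · refine (map_sum reₗ _ _).trans ((Finset.sum_congr rfl fun i _ => ?_).trans (b.sum_repr v.re))
    change b.repr v.re i • b i - b.repr v.im i • (0 : V) = _
    simp
  · refine (map_sum imₗ _ _).trans ((Finset.sum_congr rfl fun i _ => ?_).trans (b.sum_repr v.im))
    change b.repr v.re i • (0 : V) + b.repr v.im i • b i = _
    simp

variable {E : Type*} [NormedAddCommGroup E] [NormedSpace ℝ E] [FiniteDimensional ℝ E]
  {M : Type*} [TopologicalSpace M] [ChartedSpace E M] [IsManifold 𝓘(ℝ, E) ∞ M]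

instance instModuleFiniteTan (x : M) : Module.Finite ℝ (Tan E x) :=
  inferInstanceAs (Module.Finite ℝ E)

instance instT2SpaceTan (x : M) : T2Space (Tan E x) :=
  inferInstanceAs (T2Space E)

instance instModuleFiniteCotan (x : M) : Module.Finite ℝ (Cotan E x) :=
  inferInstanceAs (Module.Finite ℝ (E →L[ℝ] ℝ))

/-- The complex pairing as a bilinear form. -/
def cPairingₗ (x : M) : CGTan E x →ₗ[ℂ] CGTan E x →ₗ[ℂ] ℂ :=
  LinearMap.mk₂ ℂ cPairing
    (by intros; simp only [cPairing_eq, map_add, LinearMap.add_apply]; ring)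
    (by intros; simp only [cPairing_eq, map_smul, LinearMap.smul_apply, smul_eq_mul]; ring)
    (by intros; simp only [cPairing_eq, map_add, LinearMap.add_apply]; ring)
    (by intros; simp only [cPairing_eq, map_smul, LinearMap.smul_apply, smul_eq_mul]; ring)

@[simp] theorem cPairingₗ_apply {x : M} (u v : CGTan E x) : cPairingₗ x u v = cPairing u v := rfl

theorem cPairing_comm {x : M} (u v : CGTan E x) : cPairing u v = cPairing v u := by
  rw [cPairing_eq, cPairing_eq, add_comm]

theorem SmoothCSectionOn.cPairing {s t : ∀ x : M, CGTan E x} (hs : SmoothCSectionOn s Set.univ)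
    (ht : SmoothCSectionOn t Set.univ) : SmoothCFun (E := E) (fun x => cPairing (s x) (t x)) := by
  obtain ⟨hX, hα⟩ := smoothCSectionOn_univ_iff.1 hs
  obtain ⟨hY, hβ⟩ := smoothCSectionOn_univ_iff.1 ht
  simp only [cPairing_eq]
  exact SmoothCFun.mul contMDiff_const ((hβ.ev hX).add (hα.ev hY))

/-- A basis of `A x₀` extends to sections `e i` of `A`, and a dual family in `B x₀` to sections `g
j` of `B`. Their Gram matrix is the identity at `x₀`, hence invertible nearby. This keeps the `e i`
independent, and constant rank makes them span. -/
theorem isSubbundle_of_nondegenerate {A B : ∀ x : M, Submodule ℂ (CGTan E x)}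
    (hA : ∀ x, ∀ w ∈ A x, ∃ s ∈ Sections A, s x = w)
    (hB : ∀ x, ∀ w ∈ B x, ∃ s ∈ Sections B, s x = w)
    (hAB : ∀ x, ∀ a ∈ A x, (∀ b ∈ B x, cPairing a b = 0) → a = 0)
    (hrank : ∀ x y, Module.finrank ℂ (A x) = Module.finrank ℂ (A y)) : IsSubbundle A := by
  intro x₀
  let r := Module.finrank ℂ (A x₀)
  let b := Module.finBasis ℂ (A x₀)
  let T : A x₀ →ₗ[ℂ] B x₀ →ₗ[ℂ] ℂ := (cPairingₗ x₀).domRestrict₁₂ (A x₀) (B x₀)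
  -- Nondegeneracy on the side of `A` is injectivity of `T`. In finite dimension it means that every
  -- functional on `A x₀`, in particular each coordinate of `b`, is the pairing with an element of
  -- `B x₀`.
  have hT : Function.Surjective T.flip := by
    rw [LinearMap.flip_surjective_iff₁]
    rw [injective_iff_map_eq_zero]
    intro a ha
    exact Subtype.ext (hAB x₀ a a.2 fun w hw => LinearMap.congr_fun ha ⟨w, hw⟩)
  choose e he heq using fun i => hA x₀ (b i) (b i).2
  choose w hw using fun i => hT (b.coord i)
  choose g hg hgeq using fun i => hB x₀ (w i) (w i).2
  have hsm : ∀ i j, SmoothCFun (E := E) (fun x => cPairing (e i x) (g j x)) := fun i j =>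
    (he i).1.cPairing (hg j).1
  let G : M → Matrix (Fin r) (Fin r) ℂ := fun x i j => cPairing (e i x) (g j x)
  have hcont : Continuous (fun x => (G x).det) :=
    Continuous.matrix_det (continuous_matrix fun i j => (hsm i j).continuous)
  have hG : G x₀ = 1 := by
    ext i j
    have h1 := LinearMap.congr_fun (hw j) (b i)
    simp only [G, heq, hgeq]
    refine h1.trans ?_
    rw [Module.Basis.coord_apply, b.repr_self, Matrix.one_apply, Finsupp.single_apply]
  refine ⟨{x | (G x).det ≠ 0}, isOpen_ne.preimage hcont, by simp [hG], r, e, fun i => ?_, ?_⟩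
  · have h := (he i).1
    exact ⟨h.1.mono (Set.subset_univ _), h.2.1.mono (Set.subset_univ _),
      h.2.2.1.mono (Set.subset_univ _), h.2.2.2.mono (Set.subset_univ _)⟩
  · intro x hx
    have hli : LinearIndependent ℂ (fun i => e i x) := by
      rw [Fintype.linearIndependent_iff]
      intro c hc
      -- A linear relation among the `e i x`, paired with each `g j x`, is a left null vector of the
      -- Gram matrix.
      have : Matrix.vecMul c (G x) = 0 := by
        ext j
        have h1 := congrArg (fun u => cPairingₗ x u (g j x)) hc
        simpa [Matrix.vecMul, dotProduct, G] using h1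
      exact congrFun (Matrix.eq_zero_of_vecMul_eq_zero hx this)
    refine ⟨hli, Submodule.eq_of_le_of_finrank_eq (Submodule.span_le.2 ?_) ?_⟩
    · rintro _ ⟨i, rfl⟩
      exact (he i).2 x
    · rw [finrank_span_eq_card hli, Fintype.card_fin]
      exact hrank x₀ x

namespace IsReebData

variable {X Y Z : ∀ x : M, CTan E x} {a b f : M → ℂ} {η : ∀ x : M, Cotan E x}
  {θ : ∀ x : M, Tan E x →L[ℝ] Tan E x →L[ℝ] ℝ} {F : ∀ x : M, Tan E x}
  {P : ∀ x : M, Cotan E x →ₗ[ℝ] Tan E x} {κ : ℂ} {p q : Prop}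

theorem ev_η_F (h : IsReebData η θ F P) (x : M) :
    Cplx.ev (ofRealForm η x) (ofRealField F x) = 1 := by
  apply Complex.ext <;> simp [h.η_F]

theorem cContract_F (h : IsReebData η θ F P) (x : M) : cContract θ x (ofRealField F x) = 0 := by
  ext1 <;> simp [h.θ_F]

theorem cEq_zero (h : IsReebData η θ F P) {x : M} {v : CTan E x}
    (h1 : Cplx.ev (ofRealForm η x) v = 0) (h2 : cContract θ x v = 0) : v = 0 := by
  have r1 := congrArg Complex.re h1
  have i1 := congrArg Complex.im h1
  have r2 := congrArg Cplx.re h2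
  have i2 := congrArg Cplx.im h2
  simp at r1 i1
  exact Cplx.ext (h.eq_zero x _ r1 r2) (h.eq_zero x _ i1 i2)

/-- Since `ι_F θ = 0` and `TM` splits as `ker η` plus the line of `F`, the form `θ` need only be
tested on `ker η`. -/
theorem cEq_zero_of_forall (h : IsReebData η θ F P) {x : M} {v : CTan E x}
    (h1 : Cplx.ev (ofRealForm η x) v = 0)
    (h2 : ∀ u, Cplx.ev (ofRealForm η x) u = 0 → Cplx.ev (cContract θ x v) u = 0) : v = 0 := by
  refine h.cEq_zero h1 (Cplx.ev_ext fun u => ?_)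
  have h3 := h2 (⟨u, 0⟩ - Cplx.ev (ofRealForm η x) ⟨u, 0⟩ • ofRealField F x) (by
    rw [map_sub, map_smul, h.ev_η_F, smul_eq_mul, mul_one, sub_self])
  rw [map_sub, map_smul, h.cSkew v, h.cSkew v, h.cContract_F] at h3
  rw [h.cSkew v]
  simpa using h3

/-- With opposite values of `κ` the two `θ`-terms add up, whereas with equal values they would
cancel by skewness. This is why the bundles for `-i` and `i` are dual to each other. -/
theorem cPairing_graph (h : IsReebData η θ F P) {x : M} (u v : CTan E x) (c : ℂ) :
    cPairing (graphElt η θ (-Complex.I) x u 0) (graphElt η θ Complex.I x v c) =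
      Complex.I * Cplx.ev (cContract θ x v) u + (1 / 2) * c * Cplx.ev (ofRealForm η x) u := by
  simp only [cPairing_eq, anchor_graphElt, formPart_graphElt, map_add, map_smul,
    LinearMap.add_apply, LinearMap.smul_apply, smul_eq_mul, h.cSkew u v]
  ring

theorem nondeg_left (h : IsReebData η θ F P) {x : M} {w : CGTan E x}
    (hw : w ∈ graphBundle η θ (-Complex.I) p True x)
    (h0 : ∀ b ∈ graphBundle η θ Complex.I True p x, cPairing w b = 0) : w = 0 := by
  obtain ⟨u, c, hu, hc, rfl⟩ := hw
  obtain rfl := hc trivial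
  have h1 : ∀ v c, Cplx.ev (ofRealForm η x) v = 0 → (p → c = 0) →
      Complex.I * Cplx.ev (cContract θ x v) u + (1 / 2) * c * Cplx.ev (ofRealForm η x) u = 0 :=
    fun v c hv hc => by
      rw [← h.cPairing_graph]
      exact h0 _ ⟨v, c, fun _ => hv, hc, rfl⟩
  -- If `p` fails, then `c` is free in the dual bundle, and pairing with `2η` gives `η(u)`.
  have hηu : Cplx.ev (ofRealForm η x) u = 0 := by
    by_cases hp : p
    · exact hu hp
    · simpa using h1 0 2 (map_zero _) fun hp' => absurd hp' hp
  rw [h.cEq_zero_of_forall hηu fun v hv => ?_, graphElt_zero]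
  rw [h.cSkew, neg_eq_zero]
  simpa using h1 v 0 hv fun _ => rfl

theorem nondeg_right (h : IsReebData η θ F P) {x : M} {w : CGTan E x}
    (hw : w ∈ graphBundle η θ Complex.I True p x)
    (h0 : ∀ a ∈ graphBundle η θ (-Complex.I) p True x, cPairing a w = 0) : w = 0 := by
  obtain ⟨v, c, hv, hc, rfl⟩ := hw
  have hv := hv trivial
  have h1 : ∀ u, (p → Cplx.ev (ofRealForm η x) u = 0) →
      Complex.I * Cplx.ev (cContract θ x v) u + (1 / 2) * c * Cplx.ev (ofRealForm η x) u = 0 :=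
    fun u hu => by
      rw [← h.cPairing_graph]
      exact h0 _ ⟨u, 0, hu, fun _ => rfl, rfl⟩
  -- If `p` fails, then `F` lies in the dual bundle, and pairing with it gives `c / 2`.
  have hc0 : c = 0 := by
    by_cases hp : p
    · exact hc hp
    · have h2 := h1 (ofRealField F x) fun hp' => absurd hp' hp
      rw [h.cSkew, h.cContract_F, h.ev_η_F] at h2
      simpa using h2
  subst hc0
  rw [h.cEq_zero_of_forall hv fun u hu => ?_, graphElt_zero]
  simpa using h1 u fun _ => hu

theorem exists_section_eq [T2Space M] (h : IsReebData η θ F P) {x : M} {w : CGTan E x}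
    (hw : w ∈ graphBundle η θ κ p q x) : ∃ s ∈ Sections (graphBundle η θ κ p q), s x = w := by
  obtain ⟨v, c, hv, hc, rfl⟩ := hw
  obtain ⟨R, hR, hRx⟩ := exists_smoothVFOn_eq v.re
  obtain ⟨J, hJ, hJx⟩ := exists_smoothVFOn_eq v.im
  have hX : SmoothCVF (fun y => (⟨R y, J y⟩ : CTan E y)) := ⟨hR, hJ⟩
  have hXx : (⟨R x, J x⟩ : CTan E x) = v := Cplx.ext hRx hJx
  by_cases hp : p
  -- Subtracting `η(X) F` projects the extended field to `ker η` without changing its value at `x`.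
  -- The coefficient `c` extends as a constant.
  · refine ⟨_, h.graph_mem (a := fun _ => c) (hX.sub (SmoothCVF.smul
      (h.smooth_η.ofRealForm.ev hX) h.smooth_F.ofRealField)) contMDiff_const (fun _ y => ?_)
      (fun hq _ => hc hq), ?_⟩
    · rw [map_sub, map_smul, h.ev_η_F, smul_eq_mul, mul_one, sub_self]
    · simp only [hXx, hv hp, zero_smul, sub_zero]
  · refine ⟨_, h.graph_mem (a := fun _ => c) hX contMDiff_const (fun hp' => absurd hp' hp)
      (fun hq _ => hc hq), ?_⟩
    simp only [hXx]

-- The fibre is the injective image of the kernel of the constraint map `Λ x` on pairs `(v, c)`. As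
-- `η(F) = 1` at every point, the range of `Λ x` does not depend on `x`, so the rank is constant by
-- rank-nullity.
open Classical in
theorem finrank_graphBundle (h : IsReebData η θ F P) (x y : M) :
    Module.finrank ℂ (graphBundle η θ κ p q x) = Module.finrank ℂ (graphBundle η θ κ p q y) := by
  let Λ : ∀ x : M, (CTan E x × ℂ) →ₗ[ℂ] ℂ × ℂ := fun x =>
    ((if p then Cplx.ev (ofRealForm η x) else 0).comp (LinearMap.fst ℂ _ _)).prod
      ((if q then LinearMap.id else 0).comp (LinearMap.snd ℂ _ _))
  have hΛ : ∀ x v c, Λ x (v, c) =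
      (if p then Cplx.ev (ofRealForm η x) v else 0, if q then c else 0) := fun x v c => by
    by_cases hp : p <;> by_cases hq : q <;> simp [Λ, hp, hq]
  have hrange : ∀ x y, LinearMap.range (Λ x) ≤ LinearMap.range (Λ y) := by
    rintro x y _ ⟨⟨v, c⟩, rfl⟩
    -- A multiple of `F y` reproduces at `y` the value that `η` takes on `v` at `x`.
    refine ⟨(Cplx.ev (ofRealForm η x) v • ofRealField F y, c), ?_⟩
    rw [hΛ, hΛ, map_smul, h.ev_η_F, smul_eq_mul, mul_one]
  let Γ : ∀ x : M, (CTan E x × ℂ) →ₗ[ℂ] CGTan E x := fun x =>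
    { toFun := fun w => graphElt η θ κ x w.1 w.2
      map_add' := fun _ _ => (graphElt_add _ _ _ _).symm
      map_smul' := fun _ _ => (graphElt_smul _ _ _).symm }
  have hΓ : ∀ x, Function.Injective (Γ x) := fun x => by
    rw [injective_iff_map_eq_zero]
    rintro ⟨v, c⟩ hw
    have h1 : v = 0 := congrArg (anchor x) hw
    have h2 := congrArg (fun w => Cplx.ev (formPart x w) (ofRealField F x)) hw
    subst h1
    simp only [Γ, LinearMap.coe_mk, AddHom.coe_mk, formPart_graphElt, map_zero] at h2
    rw [map_add, map_smul, map_smul, LinearMap.add_apply, LinearMap.smul_apply,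
      LinearMap.smul_apply, map_zero, LinearMap.zero_apply, h.ev_η_F] at h2
    have h3 : c = 0 := by simpa using h2
    rw [h3]
    rfl
  have hker : ∀ x, graphBundle η θ κ p q x = (LinearMap.ker (Λ x)).map (Γ x) := fun x => by
    ext w
    constructor
    · rintro ⟨v, c, hv, hc, rfl⟩
      refine ⟨(v, c), ?_, rfl⟩
      simp only [SetLike.mem_coe, LinearMap.mem_ker, hΛ]
      ext1
      · simpa using hv
      · simpa using hc
    · rintro ⟨⟨v, c⟩, hw, rfl⟩
      simp only [SetLike.mem_coe, LinearMap.mem_ker, hΛ, Prod.mk_eq_zero] at hw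
      exact ⟨v, c, by simpa using hw.1, by simpa using hw.2, rfl⟩
  have key : ∀ x, Module.finrank ℂ (LinearMap.range (Λ x)) +
      Module.finrank ℂ (graphBundle η θ κ p q x) = Module.finrank ℂ (Cplx E × ℂ) := fun x => by
    rw [hker, ← LinearEquiv.finrank_eq (Submodule.equivMapOfInjective (Γ x) (hΓ x) _)]
    exact LinearMap.finrank_range_add_finrank_ker (Λ x)
  have h1 := key x
  have h2 := key y
  rw [le_antisymm (hrange x y) (hrange y x)] at h1
  omega

theorem isSubbundle_left [T2Space M] (h : IsReebData η θ F P) :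
    IsSubbundle (graphBundle η θ (-Complex.I) p True) :=
  isSubbundle_of_nondegenerate (fun _ _ => h.exists_section_eq) (fun _ _ => h.exists_section_eq)
    (fun _ _ => h.nondeg_left (p := p)) h.finrank_graphBundle

theorem isSubbundle_right [T2Space M] (h : IsReebData η θ F P) :
    IsSubbundle (graphBundle η θ Complex.I True p) :=
  isSubbundle_of_nondegenerate (fun _ _ => h.exists_section_eq) (fun _ _ => h.exists_section_eq)
    (fun _ _ hb h0 => h.nondeg_right (p := p) hb fun a ha => by rw [cPairing_comm, h0 a ha])
    h.finrank_graphBundle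

end IsReebData

end Subbundle

/-! ### Lie derivatives on the dual and the bialgebroid condition -/

section Compatibility

variable {E : Type*} [NormedAddCommGroup E] [NormedSpace ℝ E] [FiniteDimensional ℝ E]
  {M : Type*} [TopologicalSpace M] [ChartedSpace E M] [IsManifold 𝓘(ℝ, E) ∞ M] [T2Space M]

/-- The complex bilinear extension of the Lie derivative of one-forms. -/
def cLieDeriv (X : ∀ x : M, CTan E x) (α : ∀ x : M, Cplx (Cotan E x)) (x : M) : Cplx (Cotan E x) :=
  ⟨lieDeriv (fun y => (X y).re) (fun y => (α y).re) x - lieDeriv (fun y => (X y).im)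
      (fun y => (α y).im) x,
    lieDeriv (fun y => (X y).re) (fun y => (α y).im) x + lieDeriv (fun y => (X y).im)
      (fun y => (α y).re) x⟩

variable {X Y Z : ∀ x : M, CTan E x} {α : ∀ x : M, Cplx (Cotan E x)}

theorem SmoothCForm.cLieDeriv (hX : SmoothCVF X) (hα : SmoothCForm α) :
    SmoothCForm (cLieDeriv X α) :=
  ⟨(hα.1.lieDeriv hX.1).sub (hα.2.lieDeriv hX.2), (hα.2.lieDeriv hX.1).add (hα.1.lieDeriv hX.2)⟩

theorem ev_cLieDeriv (hX : SmoothCVF X) (hα : SmoothCForm α) (hZ : SmoothCVF Z) (x : M) :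
    Cplx.ev (cLieDeriv X α x) (Z x) =
      cDeriv X (fun y => Cplx.ev (α y) (Z y)) x - Cplx.ev (α x) (cLieBracket X Z x) := by
  have s := hα.ev hZ
  obtain ⟨x1, x2⟩ := hX
  obtain ⟨a1, a2⟩ := hα
  obtain ⟨z1, z2⟩ := hZ
  have d := fun {A : ∀ x : M, Cotan E x} {B : ∀ x : M, Tan E x} (hA : SmoothOneFormOn A Set.univ)
    (hB : SmoothVFOn B Set.univ) => (hA.apply hB).mdifferentiableAt (x := x) (by simp)
  have k := fun {A : ∀ x : M, Cotan E x} (W : ∀ x : M, Tan E x) {B : ∀ x : M, Tan E x}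
    (hA : SmoothOneFormOn A Set.univ) (hB : SmoothVFOn B Set.univ) => lieDeriv_apply W hA hB x
  apply Complex.ext
  · rw [Complex.sub_re, s.cDeriv_re]
    simp only [Cplx.ev_re, Cplx.ev_im, cLieDeriv, cLieBracket, cplxBracket]
    rw [mvfderiv_fun_sub (d a1 z1) (d a2 z2), mvfderiv_fun_add (d a1 z2) (d a2 z1)]
    simp only [add_apply, sub_apply, map_add, map_sub, k _ a1 z1, k _ a1 z2, k _ a2 z1, k _ a2 z2]
    ring
  · rw [Complex.sub_im, s.cDeriv_im]
    simp only [Cplx.ev_re, Cplx.ev_im, cLieDeriv, cLieBracket, cplxBracket]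
    rw [mvfderiv_fun_sub (d a1 z1) (d a2 z2), mvfderiv_fun_add (d a1 z2) (d a2 z1)]
    simp only [add_apply, sub_apply, map_add, map_sub, k _ a1 z1, k _ a1 z2, k _ a2 z1, k _ a2 z2]
    ring

variable {A B : ∀ x : M, Submodule ℂ (CGTan E x)}
  {D : (∀ x : M, CGTan E x) → (∀ x : M, CGTan E x) → ∀ x : M, CGTan E x}

theorem cPairing_add_right {x : M} (u v w : CGTan E x) :
    cPairing u (v + w) = cPairing u v + cPairing u w :=
  (cPairingₗ x u).map_add v w

theorem cPairing_neg_right {x : M} (u v : CGTan E x) : cPairing u (-v) = -cPairing u v :=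
  (cPairingₗ x u).map_neg v

theorem cPairing_zero_right {x : M} (u : CGTan E x) : cPairing u 0 = 0 :=
  (cPairingₗ x u).map_zero

theorem IsLieAlgebroid.neg_right (hA : IsLieAlgebroid anchor cCourant A) {s t : ∀ x : M, CGTan E x}
    (hs : s ∈ Sections A) (ht : t ∈ Sections A) : cCourant s (-t) = -cCourant s t := by
  funext x
  -- The sign enters as a constant function, so the derivative term of the Leibniz rule is zero.
  have h := hA.leibniz s hs t ht (fun _ => -1) contMDiff_const x
  rw [cDeriv_const] at h
  have e : (fun y => (-1 : ℂ) • t y) = -t := funext fun y => neg_one_smul ℂ (t y)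
  rw [e] at h
  rw [h, Pi.neg_apply]
  module

/-- The Lie derivatives along sections of `A` represent the bracket of `A`. -/
theorem IsDualLieDeriv.cPairing_bracket (hA : IsLieAlgebroid anchor cCourant A)
    (hD : IsDualLieDeriv anchor cCourant A B D) {a b ξ Y : ∀ x : M, CGTan E x}
    (ha : a ∈ Sections A) (hb : b ∈ Sections A) (hξ : ξ ∈ Sections B) (hY : Y ∈ Sections A)
    (x : M) : cPairing (D (cCourant a b) ξ x) (Y x) =
      cPairing (D a (D b ξ) x) (Y x) - cPairing (D b (D a ξ) x) (Y x) := by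
  have ca := (smoothCSectionOn_univ_iff.1 ha.1).1
  have cb := (smoothCSectionOn_univ_iff.1 hb.1).1
  have haY := hA.closed a ha Y hY
  have hbY := hA.closed b hb Y hY
  have s1 := hξ.1.cPairing hY.1
  have s2 := hξ.1.cPairing haY.1
  have s3 := hξ.1.cPairing hbY.1
  rw [(hD _ (hA.closed a ha b hb) ξ hξ).2 Y hY, (hD a ha _ (hD b hb ξ hξ).1).2 Y hY,
    (hD b hb _ (hD a ha ξ hξ).1).2 Y hY, (hD b hb ξ hξ).2 _ haY, (hD a ha ξ hξ).2 _ hbY]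
  simp only [(hD b hb ξ hξ).2 Y hY, (hD a ha ξ hξ).2 Y hY]
  rw [cDeriv_sub (cb.cDeriv s1) s3, cDeriv_sub (ca.cDeriv s1) s2]
  have e : (fun y => anchor y (cCourant a b y)) =
      cLieBracket (fun y => anchor y (a y)) (fun y => anchor y (b y)) :=
    funext fun y => anchor_cCourant a b y
  rw [e, cDeriv_cLieBracket ca cb s1]
  -- The derivatives of `⟨ξ, Y⟩` agree by the commutator formula. What remains is `ξ` paired with
  -- the Jacobi identity for `a`, `b`, `Y`, brought to the form with nested right brackets.
  have j := congrFun (hA.jacobi a ha b hb Y hY) x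
  have hYa := hA.closed Y hY a ha
  have k : cCourant (cCourant Y a) b = cCourant b (cCourant a Y) := by
    rw [hA.skew _ hYa b hb, hA.skew Y hY a ha, hA.neg_right hb haY, neg_neg]
  rw [k, hA.skew _ hbY a ha] at j
  have j' := congrArg (cPairing (ξ x)) j
  simp only [Pi.add_apply, Pi.neg_apply, Pi.zero_apply, cPairing_add_right,
    cPairing_neg_right, cPairing_zero_right] at j'
  linear_combination -j'

/-- If the differential of `B` on sections of `A` is the Schouten bracket with a fixed skew form
`⟨ξ₁, j ξ₂⟩`, then it is a derivation of the bracket of `A`. -/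
theorem IsLieAlgebroid.compatible_of_potential (hA : IsLieAlgebroid anchor cCourant A)
    (hD : IsDualLieDeriv anchor cCourant A B D)
    {j : (∀ x : M, CGTan E x) → ∀ x : M, CGTan E x} (hj : ∀ ξ ∈ Sections B, j ξ ∈ Sections A)
    (hskew : ∀ ξ ∈ Sections B, ∀ ζ ∈ Sections B, ∀ x,
      cPairing (ξ x) (j ζ x) = -cPairing (ζ x) (j ξ x))
    (hd : ∀ a ∈ Sections A, ∀ ξ ∈ Sections B, ∀ ζ ∈ Sections B, ∀ x,
      algebroidDiff anchor cCourant a ξ ζ x =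
        schouten anchor D a (fun ξ ζ x => cPairing (ξ x) (j ζ x)) ξ ζ x)
    {a b ξ ζ : ∀ x : M, CGTan E x} (ha : a ∈ Sections A) (hb : b ∈ Sections A)
    (hξ : ξ ∈ Sections B) (hζ : ζ ∈ Sections B) (x : M) :
    algebroidDiff anchor cCourant (cCourant a b) ξ ζ x =
      -schouten anchor D b (algebroidDiff anchor cCourant a) ξ ζ x
        + schouten anchor D a (algebroidDiff anchor cCourant b) ξ ζ x := by
  have ca := (smoothCSectionOn_univ_iff.1 ha.1).1
  have cb := (smoothCSectionOn_univ_iff.1 hb.1).1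
  have haξ := (hD a ha ξ hξ).1
  have hbξ := (hD b hb ξ hξ).1
  have haζ := (hD a ha ζ hζ).1
  have hbζ := (hD b hb ζ hζ).1
  have s0 := hξ.1.cPairing (hj _ hζ).1
  have s1 := haξ.1.cPairing (hj _ hζ).1
  have s2 := hbξ.1.cPairing (hj _ hζ).1
  have s3 := hξ.1.cPairing (hj _ haζ).1
  have s4 := hξ.1.cPairing (hj _ hbζ).1
  have ea := funext (hd a ha ξ hξ ζ hζ)
  have eb := funext (hd b hb ξ hξ ζ hζ)
  have hab := hA.closed a ha b hb
  -- With `Ω = ⟨·, j ·⟩`, the hypothesis `hd` turns the claim into `L_{[a,b]} Ω = L_a L_b Ω - L_b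
  -- L_a Ω`.
  rw [hd _ hab ξ hξ ζ hζ]
  simp only [schouten]
  rw [ea, eb, hd a ha _ hbξ _ hζ, hd a ha _ hξ _ hbζ, hd b hb _ haξ _ hζ, hd b hb _ hξ _ haζ]
  simp only [schouten]
  have exp : ∀ {W : ∀ x : M, CTan E x} {f g k : M → ℂ}, SmoothCFun (E := E) f →
      SmoothCFun (E := E) g → SmoothCFun (E := E) k →
      cDeriv W (fun y => f y - g y - k y) x = cDeriv W f x - cDeriv W g x - cDeriv W k x :=
    fun hf hg hk => by rw [cDeriv_sub (hf.sub hg) hk, cDeriv_sub hf hg]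
  -- No linearity of `j` is assumed. Skewness moves the Lie derivatives out from under `j`, and then
  -- `cPairing_bracket` applies in both slots.
  rw [hskew ξ hξ _ (hD _ hab _ hζ).1, hskew ξ hξ _ (hD b hb _ haζ).1,
    hskew ξ hξ _ (hD a ha _ hbζ).1, hD.cPairing_bracket hA ha hb hξ (hj _ hζ),
    hD.cPairing_bracket hA ha hb hζ (hj _ hξ)]
  rw [show schouten anchor D a (fun ξ ζ x => cPairing (ξ x) (j ζ x)) ξ ζ =
      fun y => cDeriv (fun y => anchor y (a y)) (fun x => cPairing (ξ x) (j ζ x)) y -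
        cPairing (D a ξ y) (j ζ y) - cPairing (ξ y) (j (D a ζ) y) from rfl,
    show schouten anchor D b (fun ξ ζ x => cPairing (ξ x) (j ζ x)) ξ ζ =
      fun y => cDeriv (fun y => anchor y (b y)) (fun x => cPairing (ξ x) (j ζ x)) y -
        cPairing (D b ξ y) (j ζ y) - cPairing (ξ y) (j (D b ζ) y) from rfl,
    exp (ca.cDeriv s0) s1 s3, exp (cb.cDeriv s0) s2 s4]
  have e : (fun y => anchor y (cCourant a b y)) =
      cLieBracket (fun y => anchor y (a y)) (fun y => anchor y (b y)) :=
    funext fun y => anchor_cCourant a b y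
  rw [e, cDeriv_cLieBracket ca cb s0]
  ring

namespace IsReebData

variable {a b f : M → ℂ} {η : ∀ x : M, Cotan E x}
  {θ : ∀ x : M, Tan E x →L[ℝ] Tan E x →L[ℝ] ℝ} {F : ∀ x : M, Tan E x}
  {P : ∀ x : M, Cotan E x →ₗ[ℝ] Tan E x} {p : Prop}

theorem cη_P (h : IsReebData η θ F P) {x : M} (γ : Cplx (Cotan E x)) :
    Cplx.ev (ofRealForm η x) (Cplx.map (P x) γ) = 0 := by
  apply Complex.ext <;> simp [h.η_P]

theorem cContract_P (h : IsReebData η θ F P) {x : M} (γ : Cplx (Cotan E x)) :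
    cContract θ x (Cplx.map (P x) γ) = -γ + Cplx.ev γ (ofRealField F x) • ofRealForm η x := by
  ext1
  · simp [h.θ_P]
  · simp [h.θ_P]

open Classical in
/-- The Lie derivative, along sections of `{v - i ι_v θ}`, of sections of
`{v + i ι_v θ + c η | η(v) = 0}`. -/
def dualLieDeriv (η : ∀ x : M, Cotan E x) (θ : ∀ x : M, Tan E x →L[ℝ] Tan E x →L[ℝ] ℝ)
    (F : ∀ x : M, Tan E x) (P : ∀ x : M, Cotan E x →ₗ[ℝ] Tan E x) (p : Prop)
    (s ξ : ∀ x : M, CGTan E x) (x : M) : CGTan E x :=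
  graphElt η θ Complex.I x
    (Complex.I • Cplx.map (P x) (cLieDeriv (fun y => anchor y (s y)) (fun y =>
      Complex.I • cContract θ y (anchor y (ξ y)) +
        ((1 / 2) * Cplx.ev (formPart y (ξ y)) (ofRealField F y)) • ofRealForm η y) x))
    (if p then 0 else 2 * Cplx.ev (cLieDeriv (fun y => anchor y (s y)) (fun y =>
      Complex.I • cContract θ y (anchor y (ξ y)) +
        ((1 / 2) * Cplx.ev (formPart y (ξ y)) (ofRealField F y)) • ofRealForm η y) x)
      (ofRealField F x))

-- Under the pairing, `ξ = V + i ι_V θ + c η` acts on `Y - i ι_Y θ` as `α(Y)` with `α = i ι_V θ +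
-- (1/2) c η`, so the element representing `γ = L_X α` is wanted. As `θ(Pγ) = -γ + γ(F) η`, the form
-- `γ` has this shape for the vector `i Pγ` and the coefficient `2 γ(F)`. If `p` holds, then `η(Y) =
-- 0`, the coefficient is invisible, and it has to be `0`.
open Classical in
theorem isDualLieDeriv (h : IsReebData η θ F P) :
    IsDualLieDeriv anchor cCourant (graphBundle η θ (-Complex.I) p True)
      (graphBundle η θ Complex.I True p) (dualLieDeriv η θ F P p) := by
  intro s hs ξ hξ
  obtain ⟨X, a, hX, ha, hp, hq, rfl⟩ := h.exists_eq_graph hs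
  obtain ⟨V, c, hV, hc, hp', hq', rfl⟩ := h.exists_eq_graph hξ
  have hp' := hp' trivial
  obtain rfl : a = fun _ => 0 := funext (hq trivial)
  have hF : ∀ y, Cplx.ev (formPart y (graphElt η θ Complex.I y (V y) (c y))) (ofRealField F y) =
      c y := fun y => by
    rw [formPart_graphElt, map_add, map_smul, map_smul, LinearMap.add_apply, LinearMap.smul_apply,
      LinearMap.smul_apply, h.cSkew, h.cContract_F, h.ev_η_F, map_zero, LinearMap.zero_apply]
    simp
  set α : ∀ y : M, Cplx (Cotan E y) := fun y =>
    Complex.I • cContract θ y (V y) + ((1 / 2) * c y) • ofRealForm η y with hα_def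
  have eD : dualLieDeriv η θ F P p (fun x => graphElt η θ (-Complex.I) x (X x) 0)
      (fun x => graphElt η θ Complex.I x (V x) (c x)) =
      fun x => graphElt η θ Complex.I x (Complex.I • Cplx.map (P x) (cLieDeriv X α x))
        (if p then 0 else 2 * Cplx.ev (cLieDeriv X α x) (ofRealField F x)) := by
    funext x
    simp only [dualLieDeriv, hF, anchor_graphElt, hα_def]
  rw [eD]
  have hα : SmoothCForm α := (SmoothCForm.smul (f := fun _ => Complex.I) contMDiff_const
    (h.smooth_θ.cContract hV)).add (h.smooth_η.ofRealForm.smul (SmoothCFun.mul contMDiff_const hc))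
  have hγ := hα.cLieDeriv hX
  have hPγ : SmoothCVF (fun y => Complex.I • Cplx.map (P y) (cLieDeriv X α y)) :=
    SmoothCVF.smul (f := fun _ => Complex.I) contMDiff_const
      ⟨h.smooth_P _ hγ.1, h.smooth_P _ hγ.2⟩
  constructor
  · refine h.graph_mem hPγ ?_ (fun _ y => ?_) (fun hp y => if_pos hp)
    · by_cases hp : p
      · simp only [hp, if_true]
        exact contMDiff_const
      · simp only [hp, if_false]
        exact SmoothCFun.mul contMDiff_const (hγ.ev h.smooth_F.ofRealField)
    · rw [map_smul, h.cη_P, smul_zero]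
  · intro Y hY x
    obtain ⟨Y, b, hY', hb, hpY, hqY, rfl⟩ := h.exists_eq_graph hY
    obtain rfl : b = fun _ => 0 := funext (hqY trivial)
    have e : ∀ y, cPairing (graphElt η θ Complex.I y (V y) (c y))
        (graphElt η θ (-Complex.I) y (Y y) 0) = Cplx.ev (α y) (Y y) := fun y => by
      rw [cPairing_comm, h.cPairing_graph, hα_def, map_add, map_smul, map_smul,
        LinearMap.add_apply, LinearMap.smul_apply, LinearMap.smul_apply, smul_eq_mul, smul_eq_mul]
    have hbr := h.cCourant_graph (κ := -Complex.I) hX hY' ha hb (Or.inr ⟨fun _ => rfl, fun _ => rfl⟩)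
    have e' : cPairing (graphElt η θ Complex.I x (V x) (c x))
        (graphElt η θ (-Complex.I) x (cLieBracket X Y x) 0) = Cplx.ev (α x) (cLieBracket X Y x) := by
      rw [cPairing_comm, h.cPairing_graph, hα_def, map_add, map_smul, map_smul,
        LinearMap.add_apply, LinearMap.smul_apply, LinearMap.smul_apply, smul_eq_mul, smul_eq_mul]
    simp only [e, anchor_graphElt]
    rw [hbr]
    simp only [cDeriv_const, sub_zero]
    rw [e', ← ev_cLieDeriv hX hα hY', cPairing_comm, h.cPairing_graph, map_smul, h.cContract_P,
      LinearMap.map_smul, LinearMap.smul_apply, map_add, map_neg, map_smul, LinearMap.add_apply,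
      LinearMap.neg_apply, LinearMap.smul_apply, smul_eq_mul, smul_eq_mul]
    by_cases hp : p
    · rw [hpY hp x]
      linear_combination (-Cplx.ev (cLieDeriv X α x) (Y x)) * Complex.I_mul_I
    · rw [if_neg hp]
      linear_combination (-Cplx.ev (cLieDeriv X α x) (Y x) + Cplx.ev (cLieDeriv X α x)
        (ofRealField F x) * Cplx.ev (ofRealForm η x) (Y x)) * Complex.I_mul_I

/-- The potential is `Ω(ξ, ζ) = ⟨ξ, jζ⟩`, where `j` keeps the vector part and replaces `i` by `-i`,
dropping `c η`; it equals `i θ` on vector parts. False `p` yields the pair `(L, L^*)`, true `p` the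
pair `(E^{(1,0)}, E^{(0,1)})`. -/
theorem isLieBialgebroid (h : IsReebData η θ F P) :
    IsLieBialgebroid anchor cCourant (graphBundle η θ (-Complex.I) p True)
      (graphBundle η θ Complex.I True p) := by
  have hA := h.isLieAlgebroid (Or.inr trivial) (h.isSubbundle_left (p := p))
  have hB := h.isLieAlgebroid (Or.inl trivial) (h.isSubbundle_right (p := p))
  refine ⟨hA, hB, fun _ _ => h.nondeg_left, fun _ _ => h.nondeg_right, _, h.isDualLieDeriv,
    fun X hX Y hY ξ hξ ζ hζ x => ?_⟩
  have hj : ∀ ξ ∈ Sections (graphBundle η θ Complex.I True p),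
      (fun y => graphElt η θ (-Complex.I) y (anchor y (ξ y)) 0) ∈
        Sections (graphBundle η θ (-Complex.I) p True) := by
    intro ξ hξ
    obtain ⟨V, c, hV, hc, hp', hq', rfl⟩ := h.exists_eq_graph hξ
    exact h.graph_mem hV contMDiff_const (fun _ => hp' trivial) fun _ _ => rfl
  have hskew : ∀ ξ ∈ Sections (graphBundle η θ Complex.I True p),
      ∀ ζ ∈ Sections (graphBundle η θ Complex.I True p), ∀ x,
      cPairing (ξ x) (graphElt η θ (-Complex.I) x (anchor x (ζ x)) 0) =
        -cPairing (ζ x) (graphElt η θ (-Complex.I) x (anchor x (ξ x)) 0) := by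
    intro ξ hξ ζ hζ x
    obtain ⟨V, c, hV, hc, hp', hq', rfl⟩ := h.exists_eq_graph hξ
    obtain ⟨W, d, hW, hd, hp'', hq'', rfl⟩ := h.exists_eq_graph hζ
    simp only [anchor_graphElt]
    rw [cPairing_comm, h.cPairing_graph, cPairing_comm, h.cPairing_graph, hp' trivial,
      hp'' trivial, h.cSkew]
    ring
  refine hA.compatible_of_potential h.isDualLieDeriv hj hskew ?_ hX hY hξ hζ x
  intro s hs ξ hξ ζ hζ x
  have hD := h.isDualLieDeriv (p := p) s hs
  simp only [schouten]
  -- Once skewness has freed `L_X ζ` from `j`, the defining property of the Lie derivative suffices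
  -- and its explicit formula is not needed.
  rw [(hD ξ hξ).2 _ (hj ζ hζ), hskew ξ hξ _ (hD ζ hζ).1, (hD ζ hζ).2 _ (hj ξ hξ)]
  simp only [algebroidDiff]
  obtain ⟨X, a, hX, ha, hp, hq, rfl⟩ := h.exists_eq_graph hs
  obtain rfl : a = fun _ => 0 := funext (hq trivial)
  obtain ⟨V, c, hV, hc, hp', hq', rfl⟩ := h.exists_eq_graph hξ
  obtain ⟨W, d, hW, hd, hp'', hq'', rfl⟩ := h.exists_eq_graph hζ
  have hp' := hp' trivial
  have hp'' := hp'' trivial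
  simp only [anchor_graphElt]
  rw [h.cCourant_graph hX hW ha contMDiff_const (Or.inr ⟨fun _ => rfl, fun _ => rfl⟩),
    h.cCourant_graph hX hV ha contMDiff_const (Or.inr ⟨fun _ => rfl, fun _ => rfl⟩),
    h.cCourant_graph hV hW hc hd (Or.inl ⟨hp', hp''⟩)]
  have comm : ∀ (y : M) (u v : CTan E y) (c : ℂ), cPairing (graphElt η θ Complex.I y v c)
      (graphElt η θ (-Complex.I) y u 0) =
      Complex.I * Cplx.ev (cContract θ y v) u + (1 / 2) * c * Cplx.ev (ofRealForm η y) u :=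
    fun y u v c => by rw [cPairing_comm, h.cPairing_graph]
  simp only [cDeriv_const, sub_zero]
  simp only [h.cPairing_graph, comm, hp', hp'', mul_zero, add_zero]
  have eη := h.smooth_η.ofRealForm
  have tWX := (h.smooth_θ.cContract hW).ev hX
  have tVX := (h.smooth_θ.cContract hV).ev hX
  have tVW := (h.smooth_θ.cContract hV).ev hW
  have tWV := (h.smooth_θ.cContract hW).ev hV
  have cI : SmoothCFun (E := E) (fun _ : M => Complex.I) := contMDiff_const
  have ch : SmoothCFun (E := E) (fun _ : M => (1 / 2 : ℂ)) := contMDiff_const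
  rw [cDeriv_add (cI.mul tWX) ((ch.mul hd).mul (eη.ev hX)),
    cDeriv_add (cI.mul tVX) ((ch.mul hc).mul (eη.ev hX)), cDeriv_const_mul _ tWX,
    cDeriv_const_mul _ tVX, cDeriv_const_mul _ tVW, cDeriv_const_mul _ tWV,
    cDeriv_mul (ch.mul hd) (eη.ev hX), cDeriv_mul (ch.mul hc) (eη.ev hX), cDeriv_const_mul _ hd,
    cDeriv_const_mul _ hc, h.closed_η.complex h.smooth_η hX hW,
    h.closed_η.complex h.smooth_η hX hV]
  simp only [hp', hp'', cDeriv_const]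
  -- The `η`-terms match by `dη = 0` and `η(V) = η(W) = 0`. The remaining terms are `i dθ(V, W, X)`.
  have k := h.closed_θ.complex h.smooth_θ hV hW hX x
  rw [cLieBracket_swap V X, cLieBracket_swap W X] at k
  simp only [Pi.neg_apply, map_neg, LinearMap.neg_apply] at k
  rw [h.cSkew (cLieBracket X V x), h.cSkew (cLieBracket X W x)] at k
  simp only [h.cSkew (W _) (V _), cDeriv_neg]
  linear_combination Complex.I * k

end IsReebData

end Compatibility

/-! ### Linear algebra of `η ∧ θ^n` in odd dimension -/

section LinearAlgebra

variable {V : Type*} [AddCommGroup V] [Module ℝ V]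

/-- The monomial `η(v₀) θ(v₁, v₂) ⋯ θ(v_{2n-1}, v_{2n})` as a multilinear form. -/
def wedgeMonomial (n : ℕ) (η : V →ₗ[ℝ] ℝ) (θ : V →ₗ[ℝ] V →ₗ[ℝ] ℝ) :
    MultilinearMap ℝ (fun _ : Fin (2 * n + 1) => V) ℝ :=
  have key : ∀ (v : Fin (2 * n + 1) → V) (k : Fin (2 * n + 1)), ∃ L : V →ₗ[ℝ] ℝ,
      ∀ x, η (Function.update v k x ⟨0, by omega⟩) *
        ∏ i : Fin n, θ (Function.update v k x ⟨2 * i + 1, by omega⟩)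
          (Function.update v k x ⟨2 * i + 2, by omega⟩) = L x := by
    intro v k
    have ne : ∀ (j : ℕ) (hj : j < 2 * n + 1), j ≠ k → ∀ x : V,
        Function.update v k x ⟨j, hj⟩ = v ⟨j, hj⟩ := fun j hj hjk x =>
      Function.update_of_ne (fun h => hjk (congrArg Fin.val h)) _ _
    have eq : ∀ (j : ℕ) (hj : j < 2 * n + 1), j = k → ∀ x : V,
        Function.update v k x ⟨j, hj⟩ = x := fun j hj hjk x => by
      rw [show (⟨j, hj⟩ : Fin (2 * n + 1)) = k from Fin.ext hjk, Function.update_self]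
    -- Each slot occurs in exactly one factor: slot `0` in `η`, and slot `k > 0` in the `θ` of index
    -- `(k - 1) / 2`, as first argument for odd `k` and second for even `k`.
    by_cases h0 : (k : ℕ) = 0
    · refine ⟨(∏ i : Fin n, θ (v ⟨2 * i + 1, by omega⟩) (v ⟨2 * i + 2, by omega⟩)) • η,
        fun x => ?_⟩
      rw [eq 0 _ h0.symm, LinearMap.smul_apply, smul_eq_mul, mul_comm]
      congr 1
      exact Finset.prod_congr rfl fun i _ => by rw [ne _ _ (by omega), ne _ _ (by omega)]
    · have hk := k.2
      let i₀ : Fin n := ⟨((k : ℕ) - 1) / 2, by omega⟩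
      have hrest : ∀ x, ∏ i ∈ Finset.univ.erase i₀,
          θ (Function.update v k x ⟨2 * i + 1, by omega⟩)
            (Function.update v k x ⟨2 * i + 2, by omega⟩) =
          ∏ i ∈ Finset.univ.erase i₀, θ (v ⟨2 * i + 1, by omega⟩) (v ⟨2 * i + 2, by omega⟩) :=
        fun x => Finset.prod_congr rfl fun i hi => by
          have hi' : (i : ℕ) ≠ ((k : ℕ) - 1) / 2 := fun h =>
            (Finset.mem_erase.1 hi).1 (Fin.ext h)
          rw [ne _ _ (by omega), ne _ _ (by omega)]
      have h00 : ∀ x, Function.update v k x ⟨0, by omega⟩ = v ⟨0, by omega⟩ :=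
        ne 0 _ (fun h => h0 h.symm)
      rcases Nat.even_or_odd (k : ℕ) with he | ho
      · obtain ⟨m, hm⟩ := he
        refine ⟨(η (v ⟨0, by omega⟩) * ∏ i ∈ Finset.univ.erase i₀,
          θ (v ⟨2 * i + 1, by omega⟩) (v ⟨2 * i + 2, by omega⟩)) •
            θ (v ⟨2 * i₀ + 1, by omega⟩), fun x => ?_⟩
        rw [← Finset.mul_prod_erase _ _ (Finset.mem_univ i₀), hrest, h00,
          eq (2 * i₀ + 2) _ (by simp only [i₀]; omega),
          ne (2 * i₀ + 1) _ (by simp only [i₀]; omega), LinearMap.smul_apply, smul_eq_mul]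
        ring
      · obtain ⟨m, hm⟩ := ho
        refine ⟨(η (v ⟨0, by omega⟩) * ∏ i ∈ Finset.univ.erase i₀,
          θ (v ⟨2 * i + 1, by omega⟩) (v ⟨2 * i + 2, by omega⟩)) •
            θ.flip (v ⟨2 * i₀ + 2, by omega⟩), fun x => ?_⟩
        rw [← Finset.mul_prod_erase _ _ (Finset.mem_univ i₀), hrest, h00,
          eq (2 * i₀ + 1) _ (by simp only [i₀]; omega),
          ne (2 * i₀ + 2) _ (by simp only [i₀]; omega), LinearMap.smul_apply, smul_eq_mul,
          LinearMap.flip_apply]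
        ring
  MultilinearMap.mk'
    (fun v => η (v ⟨0, by omega⟩) *
      ∏ i : Fin n, θ (v ⟨2 * i + 1, by omega⟩) (v ⟨2 * i + 2, by omega⟩))
    (fun v k x y => by
      obtain ⟨L, hL⟩ := key v k
      rw [hL, hL, hL, map_add])
    (fun v k c x => by
      obtain ⟨L, hL⟩ := key v k
      rw [hL, hL, map_smul])

theorem wedgeMonomial_apply (n : ℕ) (η : V →ₗ[ℝ] ℝ) (θ : V →ₗ[ℝ] V →ₗ[ℝ] ℝ)
    (v : Fin (2 * n + 1) → V) : wedgeMonomial n η θ v = η (v ⟨0, by omega⟩) *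
      ∏ i : Fin n, θ (v ⟨2 * i + 1, by omega⟩) (v ⟨2 * i + 2, by omega⟩) := rfl

/-- As an alternating map, the wedge product vanishes on linearly dependent families. -/
theorem wedgePow_eq_alternatization (n : ℕ) (η : V →ₗ[ℝ] ℝ) (θ : V →ₗ[ℝ] V →ₗ[ℝ] ℝ)
    (v : Fin (2 * n + 1) → V) : wedgePow n (fun a => η a) (fun a b => θ a b) v =
      (1 / 2 ^ n) * MultilinearMap.alternatization (wedgeMonomial n η θ) v := by
  rw [MultilinearMap.alternatization_apply, wedgePow]
  congr 1
  refine Finset.sum_congr rfl fun σ _ => ?_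
  rw [MultilinearMap.domDomCongr_apply, wedgeMonomial_apply, Units.smul_def, zsmul_eq_mul]

/-- A vector in `ker η ∩ ker θ` vanishes if `η ∧ θ^n` is a volume form. -/
theorem eq_zero_of_wedgePow_ne_zero {n : ℕ} (hV : Module.finrank ℝ V = 2 * n + 1)
    {η : V →ₗ[ℝ] ℝ} {θ : V →ₗ[ℝ] V →ₗ[ℝ] ℝ} (hθ : ∀ v, θ v v = 0)
    (hne : ∃ v : Fin (2 * n + 1) → V, wedgePow n (fun a => η a) (fun a b => θ a b) v ≠ 0)
    {X : V} (h1 : η X = 0) (h2 : θ X = 0) : X = 0 := by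
  have : Module.Finite ℝ V := Module.finite_of_finrank_pos (by omega)
  by_contra hX
  obtain ⟨f, hf⟩ : ∃ f : Module.Dual ℝ V, f X ≠ 0 := by
    by_contra! h
    exact hX ((Module.forall_dual_apply_eq_zero_iff ℝ X).1 h)
  obtain ⟨v, hv⟩ := hne
  -- Moving the vectors along `X` into the hyperplane `ker f` leaves the wedge product unchanged,
  -- since `X` lies in the kernels of `η` and `θ`. But `2n + 1` vectors of a hyperplane are
  -- dependent.
  let w : Fin (2 * n + 1) → V := fun i => v i - (f (v i) / f X) • X
  have hskew : ∀ u, θ u X = 0 := fun u => by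
    have := hθ (u + X)
    simp only [map_add, LinearMap.add_apply, hθ, h2, LinearMap.zero_apply] at this
    simpa using this
  have hw : wedgePow n (fun a => η a) (fun a b => θ a b) v =
      wedgePow n (fun a => η a) (fun a b => θ a b) w := by
    simp only [wedgePow, w, map_sub, map_smul, h1, h2, hskew, smul_zero,
      sub_zero]
  rw [hw, wedgePow_eq_alternatization, AlternatingMap.map_linearDependent, mul_zero] at hv
  · exact hv rfl
  · intro hli
    have htop := hli.span_eq_top_of_card_eq_finrank' (by rw [Fintype.card_fin, hV])
    have hle : Submodule.span ℝ (Set.range w) ≤ LinearMap.ker f := by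
      rw [Submodule.span_le]
      rintro _ ⟨i, rfl⟩
      simp only [w, SetLike.mem_coe, LinearMap.mem_ker, map_sub, map_smul, smul_eq_mul,
        div_mul_cancel₀ _ hf, sub_self]
    rw [htop] at hle
    exact hf (hle trivial)

/-- A skew form on an odd-dimensional space is degenerate. -/
theorem exists_ne_zero_of_odd_finrank {n : ℕ} (hV : Module.finrank ℝ V = 2 * n + 1)
    {θ : V →ₗ[ℝ] V →ₗ[ℝ] ℝ} (hθ : ∀ v, θ v v = 0) : ∃ X ≠ 0, θ X = 0 := by
  have : Module.Finite ℝ V := Module.finite_of_finrank_pos (by omega)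
  have hskew : ∀ u v, θ u v = -θ v u := fun u v => by
    have := hθ (u + v)
    simp only [map_add, LinearMap.add_apply, hθ] at this
    linarith
  let b := Module.finBasisOfFinrankEq ℝ V hV
  -- With this order of indices, `A c` has the entries `θ(∑ c_j b_j, b_i)`, so a null vector of `A`
  -- gives a vector in the kernel of `θ`.
  let A : Matrix (Fin (2 * n + 1)) (Fin (2 * n + 1)) ℝ := fun i j => θ (b j) (b i)
  have hA : A.transpose = -A := by
    ext i j
    exact hskew _ _
  -- Skewness and odd size give `det A = (-1)^(2n+1) det A`.
  have hdet : A.det = 0 := by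
    have h := A.det_transpose
    rw [hA, Matrix.det_neg, Fintype.card_fin, pow_succ, pow_mul] at h
    norm_num at h
    linarith
  obtain ⟨c, hc, hAc⟩ := Matrix.exists_mulVec_eq_zero_iff.2 hdet
  refine ⟨∑ j, c j • b j, fun h => hc (funext (Fintype.linearIndependent_iff.1
    b.linearIndependent c h)), b.ext fun i => ?_⟩
  have := congrFun hAc i
  simp only [Matrix.mulVec, dotProduct, A, Pi.zero_apply] at this
  rw [map_sum, LinearMap.sum_apply, LinearMap.zero_apply, ← this]
  exact Finset.sum_congr rfl fun j _ => by
    rw [map_smul, LinearMap.smul_apply, smul_eq_mul, mul_comm]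

end LinearAlgebra

/-! ### The generalized almost contact pair of a cosymplectic structure -/

section Cosymplectic

variable {E : Type*} [NormedAddCommGroup E] [NormedSpace ℝ E] [FiniteDimensional ℝ E]
  {M : Type*} [TopologicalSpace M] [ChartedSpace E M] [IsManifold 𝓘(ℝ, E) ∞ M]

theorem contMDiff_prod_section_iff {s : ∀ x : M, GTan E x} :
    ContMDiff 𝓘(ℝ, E) (𝓘(ℝ, E).prod 𝓘(ℝ, E × (E →L[ℝ] ℝ))) ∞
      (fun x => TotalSpace.mk' (E × (E →L[ℝ] ℝ))
        (E := (fun y : M => TangentSpace 𝓘(ℝ, E) y) ×ᵇ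
          (fun y : M => TangentSpace 𝓘(ℝ, E) y →L[ℝ] ℝ)) x (s x)) ↔
      SmoothVFOn (fun x => (s x).1) Set.univ ∧ SmoothOneFormOn (fun x => (s x).2) Set.univ := by
  rw [SmoothVFOn, SmoothOneFormOn, contMDiffOn_univ, contMDiffOn_univ]
  simp only [ContMDiff, ← forall_and]
  refine forall_congr' fun x₀ => ?_
  rw [Bundle.contMDiffAt_section, Bundle.contMDiffAt_section, Bundle.contMDiffAt_section,
    contMDiffAt_prod_module_iff]
  rfl

variable {n : ℕ} {η : ∀ x : M, Cotan E x} {θ : ∀ x : M, Tan E x →L[ℝ] Tan E x →L[ℝ] ℝ}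

/-- The linear form underlying a covector. -/
def cotanₗ {x : M} (α : Cotan E x) : Tan E x →ₗ[ℝ] ℝ := α

theorem flat_apply (x : M) (X : Tan E x) : flat η θ x X = θ x X - η x X • η x := rfl

theorem flat_apply_apply (x : M) (X Y : Tan E x) :
    flat η θ x X Y = θ x X Y - η x X * η x Y := rfl

/-- The bilinear map underlying `θ`. -/
def bilinₗ (θ : ∀ x : M, Tan E x →L[ℝ] Tan E x →L[ℝ] ℝ) (x : M) :
    Tan E x →ₗ[ℝ] Tan E x →ₗ[ℝ] ℝ :=
  LinearMap.mk₂ ℝ (fun u v => θ x u v) (by intros; simp) (by intros; simp) (by intros; simp)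
    (by intros; simp)

/-- The Reeb vector field. -/
def reeb (η : ∀ x : M, Cotan E x) (θ : ∀ x : M, Tan E x →L[ℝ] Tan E x →L[ℝ] ℝ)
    (x : M) : Tan E x :=
  -(flat η θ x).inverse (η x)

/-- The bivector as a map from covectors to vectors. -/
def sharp (η : ∀ x : M, Cotan E x)
    (θ : ∀ x : M, Tan E x →L[ℝ] Tan E x →L[ℝ] ℝ) (x : M) : Cotan E x →L[ℝ] Tan E x :=
  -(flat η θ x).inverse -
    LinearMap.toContinuousLinearMap
      { toFun α := α (reeb η θ x) • reeb η θ x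
        map_add' α β := by rw [add_apply, add_smul]
        map_smul' c α := by rw [smul_apply, smul_assoc, RingHom.id_apply] }

theorem sharp_apply (x : M) (α : Cotan E x) : sharp η θ x α =
    -(flat η θ x).inverse α - α (reeb η θ x) • reeb η θ x := rfl

namespace IsCosymplectic

theorem skew (h : IsCosymplectic n η θ) {x : M} (u v : Tan E x) : θ x u v = -θ x v u := by
  have := h.alternating x (u + v)
  simp only [map_add, add_apply, h.alternating] at this
  linarith

theorem eq_zero (h : IsCosymplectic n η θ) (hdim : Module.finrank ℝ E = 2 * n + 1) {x : M}
    {v : Tan E x} (h1 : η x v = 0) (h2 : θ x v = 0) : v = 0 :=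
  eq_zero_of_wedgePow_ne_zero (V := Tan E x) hdim (η := cotanₗ (η x)) (θ := bilinₗ θ x)
    (h.alternating x) (h.wedge_ne_zero x) h1 (by ext w; exact congrArg (fun f : Cotan E x => f w) h2)

theorem flat_injective (h : IsCosymplectic n η θ) (hdim : Module.finrank ℝ E = 2 * n + 1)
    (x : M) : Function.Injective (flat η θ x) := by
  refine (injective_iff_map_eq_zero _).2 fun X hX => ?_
  -- Evaluated on `X` itself, `♭(X)` is `-η(X)²`.
  have h1 : η x X = 0 := by
    have := congrArg (fun f : Cotan E x => f X) hX
    rw [flat_apply_apply, h.alternating] at this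
    simpa using this
  refine h.eq_zero hdim h1 ?_
  rw [flat_apply, h1] at hX
  simpa using hX

theorem flat_isInvertible (h : IsCosymplectic n η θ) (hdim : Module.finrank ℝ E = 2 * n + 1)
    (x : M) : (flat η θ x).IsInvertible := by
  have hfin : Module.finrank ℝ (Tan E x) = Module.finrank ℝ (Cotan E x) := by
    have e : (Tan E x →ₗ[ℝ] ℝ) ≃ₗ[ℝ] Cotan E x := LinearMap.toContinuousLinearMap
    rw [← e.finrank_eq]
    exact Subspace.dual_finrank_eq.symm
  let e := LinearEquiv.ofInjectiveOfFinrankEq (flat η θ x : Tan E x →ₗ[ℝ] Cotan E x)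
    (h.flat_injective hdim x) hfin
  exact ⟨e.toContinuousLinearEquiv, rfl⟩

theorem inverse_flat (h : IsCosymplectic n η θ) (hdim : Module.finrank ℝ E = 2 * n + 1) (x : M)
    (X : Tan E x) : (flat η θ x).inverse (flat η θ x X) = X := by
  obtain ⟨e, he⟩ := h.flat_isInvertible hdim x
  rw [← he, ContinuousLinearMap.inverse_equiv]
  exact e.symm_apply_apply X

theorem flat_inverse (h : IsCosymplectic n η θ) (hdim : Module.finrank ℝ E = 2 * n + 1) (x : M)
    (α : Cotan E x) : flat η θ x ((flat η θ x).inverse α) = α := by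
  obtain ⟨e, he⟩ := h.flat_isInvertible hdim x
  rw [← he, ContinuousLinearMap.inverse_equiv]
  exact e.apply_symm_apply α

/-- Odd dimension provides `K ≠ 0` with `ι_K θ = 0`, and `η(K) ≠ 0` by nondegeneracy. The vector `K
/ η(K)` is mapped by `♭` to `-η`, hence it is the Reeb vector. -/
theorem η_reeb_and_θ_reeb (h : IsCosymplectic n η θ) (hdim : Module.finrank ℝ E = 2 * n + 1)
    (x : M) : η x (reeb η θ x) = 1 ∧ θ x (reeb η θ x) = 0 := by
  obtain ⟨K, hK, hθK⟩ := exists_ne_zero_of_odd_finrank (V := Tan E x) hdim (θ := bilinₗ θ x)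
    (h.alternating x)
  have hθK' : θ x K = 0 := ContinuousLinearMap.ext fun w => LinearMap.congr_fun hθK w
  have hηK : η x K ≠ 0 := fun h0 => hK (h.eq_zero hdim h0 hθK')
  have e : reeb η θ x = (η x K)⁻¹ • K := by
    have : η x = flat η θ x (-((η x K)⁻¹ • K)) := by
      rw [map_neg, map_smul, flat_apply, hθK', zero_sub, smul_neg, neg_neg, smul_smul,
        inv_mul_cancel₀ hηK, one_smul]
    rw [reeb]
    conv_lhs => rw [show (flat η θ x).inverse (η x) = -((η x K)⁻¹ • K) from
      (congrArg _ this).trans (h.inverse_flat hdim x _)]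
    rw [neg_neg]
  rw [e, map_smul, map_smul, hθK', smul_eq_mul, inv_mul_cancel₀ hηK]
  exact ⟨rfl, smul_zero _⟩

/-- Evaluating `♭(♭⁻¹ α) = α` on the Reeb vector kills the `θ`-term. -/
theorem η_inverse (h : IsCosymplectic n η θ) (hdim : Module.finrank ℝ E = 2 * n + 1) {x : M}
    (α : Cotan E x) : η x ((flat η θ x).inverse α) = -α (reeb η θ x) := by
  obtain ⟨h1, h2⟩ := h.η_reeb_and_θ_reeb hdim x
  have := congrArg (fun f : Cotan E x => f (reeb η θ x)) (h.flat_inverse hdim x α)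
  rw [flat_apply_apply, h.skew, h2, h1] at this
  simp at this
  linarith

/-- Evaluating `♭(♭⁻¹ β) = β` on `♭⁻¹ α` expresses `θ(♭⁻¹ β, ♭⁻¹ α)` through `β(♭⁻¹ α)` and `α(F)
β(F)`. This identifies `π^♯` with the map `sharp`. -/
theorem bivector_eq (h : IsCosymplectic n η θ) (hdim : Module.finrank ℝ E = 2 * n + 1) {x : M}
    (α β : Cotan E x) : bivector η θ x α β =
      β (-(flat η θ x).inverse α - α (reeb η θ x) • reeb η θ x) := by
  have := congrArg (fun f : Cotan E x => f ((flat η θ x).inverse α)) (h.flat_inverse hdim x β)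
  rw [flat_apply_apply, h.η_inverse hdim, h.η_inverse hdim] at this
  rw [bivector, h.skew, map_sub, map_neg, map_smul, ← this, smul_eq_mul]
  ring

/-- Together with `sharp_θ` this gives the two components of the formula for `Φ²`. -/
theorem θ_sharp (h : IsCosymplectic n η θ) (hdim : Module.finrank ℝ E = 2 * n + 1) {x : M}
    (α : Cotan E x) : θ x (sharp η θ x α) = -α + α (reeb η θ x) • η x := by
  obtain ⟨h1, h2⟩ := h.η_reeb_and_θ_reeb hdim x
  have := h.flat_inverse hdim x α
  rw [flat_apply, h.η_inverse hdim] at this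
  rw [sharp_apply, map_sub, map_neg, map_smul, h2, sub_eq_iff_eq_add.1 this, smul_zero]
  module

theorem sharp_θ (h : IsCosymplectic n η θ) (hdim : Module.finrank ℝ E = 2 * n + 1) {x : M}
    (X : Tan E x) : sharp η θ x (θ x X) = -X + η x X • reeb η θ x := by
  obtain ⟨h1, h2⟩ := h.η_reeb_and_θ_reeb hdim x
  have e : θ x X = flat η θ x X + η x X • η x := by rw [flat_apply, sub_add_cancel]
  have e' : θ x X (reeb η θ x) = 0 := by rw [h.skew, h2]; simp
  rw [sharp_apply, e', e, map_add, h.inverse_flat hdim, map_smul, reeb]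
  module

theorem sharp_η (h : IsCosymplectic n η θ) (hdim : Module.finrank ℝ E = 2 * n + 1) (x : M) :
    sharp η θ x (η x) = 0 := by
  rw [sharp_apply, (h.η_reeb_and_θ_reeb hdim x).1, one_smul, reeb, sub_self]

variable [T2Space M]

theorem smooth_inverse (h : IsCosymplectic n η θ) (hdim : Module.finrank ℝ E = 2 * n + 1)
    {α : ∀ x : M, Cotan E x} (hα : SmoothOneFormOn α Set.univ) :
    SmoothVFOn (fun x => (flat η θ x).inverse (α x)) Set.univ := by
  refine contMDiffOn_univ.2 (contMDiff_inverse_apply (F₁ := E) (F₂ := E →L[ℝ] ℝ)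
    (V₁ := fun x : M => TangentSpace 𝓘(ℝ, E) x)
    (V₂ := fun x : M => TangentSpace 𝓘(ℝ, E) x →L[ℝ] ℝ) (ϕ := flat η θ) ?_
    (h.flat_isInvertible hdim) (contMDiffOn_univ.1 hα))
  refine contMDiff_hom_of_forall (F₁ := E) (F₂ := E →L[ℝ] ℝ)
    (V₁ := fun x : M => TangentSpace 𝓘(ℝ, E) x)
    (V₂ := fun x : M => TangentSpace 𝓘(ℝ, E) x →L[ℝ] ℝ) (flat η θ) fun X hX => ?_
  have hX' : SmoothVFOn X Set.univ := contMDiffOn_univ.2 hX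
  exact contMDiffOn_univ.1
    ((h.smooth_θ.apply hX').sub (h.smooth_η.smul (h.smooth_η.apply hX')))

theorem smooth_reeb (h : IsCosymplectic n η θ) (hdim : Module.finrank ℝ E = 2 * n + 1) :
    SmoothVFOn (reeb η θ) Set.univ :=
  (h.smooth_inverse hdim h.smooth_η).neg

theorem smooth_sharp (h : IsCosymplectic n η θ) (hdim : Module.finrank ℝ E = 2 * n + 1)
    {α : ∀ x : M, Cotan E x} (hα : SmoothOneFormOn α Set.univ) :
    SmoothVFOn (fun x => sharp η θ x (α x)) Set.univ :=
  (h.smooth_inverse hdim hα).neg.sub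
    ((h.smooth_reeb hdim).smul (hα.apply (h.smooth_reeb hdim)))

theorem isReebData (h : IsCosymplectic n η θ) (hdim : Module.finrank ℝ E = 2 * n + 1) :
    IsReebData η θ (reeb η θ) (fun x => (sharp η θ x : Cotan E x →ₗ[ℝ] Tan E x)) where
  smooth_η := h.smooth_η
  smooth_θ := h.smooth_θ
  smooth_F := h.smooth_reeb hdim
  smooth_P _ hα := h.smooth_sharp hdim hα
  alternating := h.alternating
  closed_η := h.closed_η
  closed_θ := h.closed_θ
  η_F x := (h.η_reeb_and_θ_reeb hdim x).1
  θ_F x := (h.η_reeb_and_θ_reeb hdim x).2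
  η_P x α := by
    change η x (sharp η θ x α) = 0
    rw [sharp_apply, map_sub, map_neg, map_smul, h.η_inverse hdim,
      (h.η_reeb_and_θ_reeb hdim x).1, smul_eq_mul]
    ring
  θ_P x α := h.θ_sharp hdim α
  eq_zero _ _ := h.eq_zero hdim

/-- The generalized almost contact pair of a cosymplectic structure. -/
def toGACPair (h : IsCosymplectic n η θ) (hdim : Module.finrank ℝ E = 2 * n + 1) :
    GACPair E M where
  Φ x := ((sharp η θ x).comp (ContinuousLinearMap.snd ℝ (Tan E x) (Cotan E x))).prod
    ((θ x).comp (ContinuousLinearMap.fst ℝ (Tan E x) (Cotan E x)))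
  F := reeb η θ
  η := η
  smooth_Φ := by
    refine contMDiff_hom_of_forall (F₁ := E × (E →L[ℝ] ℝ)) (F₂ := E × (E →L[ℝ] ℝ))
      (V₁ := (fun y : M => TangentSpace 𝓘(ℝ, E) y) ×ᵇ
        (fun y : M => TangentSpace 𝓘(ℝ, E) y →L[ℝ] ℝ))
      (V₂ := (fun y : M => TangentSpace 𝓘(ℝ, E) y) ×ᵇ
        (fun y : M => TangentSpace 𝓘(ℝ, E) y →L[ℝ] ℝ)) _ fun s hs => ?_
    obtain ⟨h1, h2⟩ := contMDiff_prod_section_iff.1 hs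
    exact contMDiff_prod_section_iff.2 ⟨h.smooth_sharp hdim h2, h.smooth_θ.apply h1⟩
  smooth_F := h.smooth_reeb hdim
  smooth_η := h.smooth_η
  skew x u v := by
    have e := h.bivector_eq hdim u.2 v.2
    have e' := h.bivector_eq hdim v.2 u.2
    rw [← sharp_apply] at e e'
    have k : bivector η θ x u.2 v.2 = -bivector η θ x v.2 u.2 := h.skew _ _
    have k' := h.skew u.1 v.1
    change 1 / 2 * (v.2 (sharp η θ x u.2) + θ x u.1 v.1) +
      1 / 2 * (θ x v.1 u.1 + u.2 (sharp η θ x v.2)) = 0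
    rw [← e, ← e', k, k']
    ring
  η_F x := (h.η_reeb_and_θ_reeb hdim x).1
  Φ_F x := Prod.ext (map_zero (sharp η θ x)) (h.η_reeb_and_θ_reeb hdim x).2
  Φ_η x := Prod.ext (h.sharp_η hdim x) (map_zero (θ x))
  Φ_Φ x u := Prod.ext (h.sharp_θ hdim u.1) (h.θ_sharp hdim u.2)

theorem isAssociated_toGACPair (h : IsCosymplectic n η θ)
    (hdim : Module.finrank ℝ E = 2 * n + 1) : (h.toGACPair hdim).IsAssociated η θ where
  η_eq := rfl
  θ_F x := (h.η_reeb_and_θ_reeb hdim x).2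
  Φ_fst _ u β := (h.bivector_eq hdim u.2 β).symm
  Φ_snd _ _ := rfl

/-- Covectors separate vectors, so the bivector determines the vector part of `Φ`. Two candidates
for `F` differ by an element of `ker η ∩ ker θ`, which is zero. -/
theorem eq_toGACPair (h : IsCosymplectic n η θ) (hdim : Module.finrank ℝ E = 2 * n + 1)
    {J : GACPair E M} (hJ : J.IsAssociated η θ) : J = h.toGACPair hdim := by
  refine GACPair.ext (funext fun x => ContinuousLinearMap.ext fun u => Prod.ext ?_ ?_)
    (funext fun x => ?_) hJ.η_eq
  · change (J.Φ x u).1 = sharp η θ x u.2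
    rw [← sub_eq_zero, ← Module.forall_dual_apply_eq_zero_iff ℝ]
    intro f
    have k := (hJ.Φ_fst x u (LinearMap.toContinuousLinearMap f)).trans
      (h.bivector_eq hdim u.2 (LinearMap.toContinuousLinearMap f))
    rw [map_sub, sub_eq_zero]
    exact k
  · exact hJ.Φ_snd x u
  · obtain ⟨h1, h2⟩ := h.η_reeb_and_θ_reeb hdim x
    change J.F x = reeb η θ x
    rw [← sub_eq_zero]
    refine h.eq_zero hdim ?_ ?_
    · rw [map_sub, h1, sub_eq_zero, ← J.η_F x, hJ.η_eq]
    · rw [map_sub, h2, hJ.θ_F, sub_zero]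

end IsCosymplectic

end Cosymplectic

/-! ### Independence of the representative and identification with graph bundles -/

section Bundles

variable {E : Type*} [NormedAddCommGroup E] [NormedSpace ℝ E] [FiniteDimensional ℝ E]
  {M : Type*} [TopologicalSpace M] [ChartedSpace E M] [IsManifold 𝓘(ℝ, E) ∞ M]

namespace GACPair

variable {J J' : GACPair E M}

/-- Rescaling `F` and `η` by nonzero factors preserves their kernels, just as it preserves the lines
that they span. Therefore all the bundles depend only on the equivalence class. -/
theorem Equivalent.inKer_iff (h : J.Equivalent J') {x : M} (e : GTan E x) :
    J'.InKer e ↔ J.InKer e := by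
  obtain ⟨f, -, h0, -, h2, h3⟩ := h
  rw [InKer, InKer, h2, h3, smul_apply, map_smul, smul_eq_mul, smul_eq_mul,
    mul_eq_zero_iff_left (h0 x), mul_eq_zero_iff_left (one_div_ne_zero (h0 x))]

theorem Equivalent.bundleE10_eq (h : J.Equivalent J') : J'.bundleE10 = J.bundleE10 := by
  funext x
  ext w
  refine exists_congr fun e => and_congr (h.inKer_iff e) ?_
  obtain ⟨f, -, -, h1, -, -⟩ := h
  rw [h1]

theorem Equivalent.bundleE01_eq (h : J.Equivalent J') : J'.bundleE01 = J.bundleE01 := by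
  funext x
  ext w
  refine exists_congr fun e => and_congr (h.inKer_iff e) ?_
  obtain ⟨f, -, -, h1, -, -⟩ := h
  rw [h1]

theorem span_ofReal_smul {x : M} {c : ℝ} (hc : c ≠ 0) (e : GTan E x) :
    Submodule.span ℂ {(⟨c • e, 0⟩ : CGTan E x)} = Submodule.span ℂ {(⟨e, 0⟩ : CGTan E x)} := by
  have k : (⟨c • e, 0⟩ : CGTan E x) = (c : ℂ) • (⟨e, 0⟩ : CGTan E x) := by
    ext1
    · simp only [Cplx.smul_re, Complex.ofReal_re, Complex.ofReal_im]; module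
    · simp only [Cplx.smul_im, Complex.ofReal_re, Complex.ofReal_im]; module
  rw [k]
  exact Submodule.span_singleton_smul_eq
    (IsUnit.mk0 (c : ℂ) (Complex.ofReal_ne_zero.2 hc)) _

theorem Equivalent.bundleL_eq (h : J.Equivalent J') : J'.bundleL = J.bundleL := by
  funext x
  rw [bundleL, bundleL, h.bundleE10_eq, bundleLF, bundleLF]
  obtain ⟨f, -, h0, -, -, h3⟩ := h
  rw [← span_ofReal_smul (one_div_ne_zero (h0 x)) (J.F x, 0), Prod.smul_mk, smul_zero, h3]

theorem Equivalent.bundleLstar_eq (h : J.Equivalent J') : J'.bundleLstar = J.bundleLstar := by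
  funext x
  rw [bundleLstar, bundleLstar, h.bundleE01_eq, bundleLη, bundleLη]
  obtain ⟨f, -, h0, -, h2, -⟩ := h
  rw [← span_ofReal_smul (h0 x) (0, J.η x), Prod.smul_mk, smul_zero, h2]

end GACPair

namespace IsCosymplectic

variable [T2Space M] {n : ℕ} {η : ∀ x : M, Cotan E x}
  {θ : ∀ x : M, Tan E x →L[ℝ] Tan E x →L[ℝ] ℝ}

/-- For `e = X + α` in `ker η ⊕ ker F`, the vector part of `e - iΦ(e)` is `v = X - i π^♯ α`. Since
`θ(π^♯ α) = -α`, its form part `α - i ι_X θ` is `-i ι_v θ`. -/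
theorem bundleE10_eq (h : IsCosymplectic n η θ) (hdim : Module.finrank ℝ E = 2 * n + 1) :
    (h.toGACPair hdim).bundleE10 = graphBundle η θ (-Complex.I) True True := by
  funext x
  obtain ⟨h1, h2⟩ := h.η_reeb_and_θ_reeb hdim x
  apply le_antisymm
  · rintro _ ⟨e, ⟨he1, he2⟩, rfl⟩
    change η x e.1 = 0 at he1
    change e.2 (reeb η θ x) = 0 at he2
    have hs : η x (sharp η θ x e.2) = 0 := (h.isReebData hdim).η_P x e.2
    have ht := h.θ_sharp hdim e.2
    rw [he2] at ht
    refine ⟨⟨e.1, -sharp η θ x e.2⟩, 0, fun _ => ?_, fun _ => rfl, ext_parts ?_ ?_⟩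
    · apply Complex.ext <;> simp [he1, hs]
    · ext1 <;> simp [graphElt, toGACPair]
    · ext1 <;> simp [graphElt, toGACPair, ht]
  · rintro _ ⟨v, c, hv, hc, rfl⟩
    obtain rfl := hc trivial
    have hv := hv trivial
    have a1 := congrArg Complex.re hv
    have a2 := congrArg Complex.im hv
    simp at a1 a2
    have hs := h.sharp_θ hdim v.im
    rw [a2] at hs
    have hk : θ x v.im (reeb η θ x) = 0 := by rw [h.skew, h2]; simp
    -- The real part of `v - i ι_v θ` is the required `e`. Its image under `-Φ` is the imaginary
    -- part because `π^♯ ι_u θ = -u` for `u` in `ker η`.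
    refine ⟨(v.re, θ x v.im), ⟨a1, hk⟩, ext_parts ?_ ?_⟩
    · ext1 <;> simp [graphElt, toGACPair, hs]
    · ext1 <;> simp [graphElt, toGACPair]

theorem bundleE01_eq (h : IsCosymplectic n η θ) (hdim : Module.finrank ℝ E = 2 * n + 1) :
    (h.toGACPair hdim).bundleE01 = graphBundle η θ Complex.I True True := by
  funext x
  obtain ⟨h1, h2⟩ := h.η_reeb_and_θ_reeb hdim x
  apply le_antisymm
  · rintro _ ⟨e, ⟨he1, he2⟩, rfl⟩
    change η x e.1 = 0 at he1
    change e.2 (reeb η θ x) = 0 at he2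
    have hs : η x (sharp η θ x e.2) = 0 := (h.isReebData hdim).η_P x e.2
    have ht := h.θ_sharp hdim e.2
    rw [he2] at ht
    refine ⟨⟨e.1, sharp η θ x e.2⟩, 0, fun _ => ?_, fun _ => rfl, ext_parts ?_ ?_⟩
    · apply Complex.ext <;> simp [he1, hs]
    · ext1 <;> simp [graphElt, toGACPair]
    · ext1 <;> simp [graphElt, toGACPair, ht]
  · rintro _ ⟨v, c, hv, hc, rfl⟩
    obtain rfl := hc trivial
    have hv := hv trivial
    have a1 := congrArg Complex.re hv
    have a2 := congrArg Complex.im hv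
    simp at a1 a2
    have hs := h.sharp_θ hdim v.im
    rw [a2] at hs
    have hk : θ x v.im (reeb η θ x) = 0 := by rw [h.skew, h2]; simp
    refine ⟨(v.re, -θ x v.im), ⟨a1, by simp [toGACPair, hk]⟩, ext_parts ?_ ?_⟩
    · ext1 <;> simp [graphElt, toGACPair, hs]
    · ext1 <;> simp [graphElt, toGACPair]

/-- As `ι_F θ = 0`, the vector `F` is its own graph element. Splitting off `η(v) F` from `v` shows
that adding it removes exactly the condition `η(v) = 0`. -/
theorem bundleL_eq (h : IsCosymplectic n η θ) (hdim : Module.finrank ℝ E = 2 * n + 1) :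
    (h.toGACPair hdim).bundleL = graphBundle η θ (-Complex.I) False True := by
  funext x
  have hR := h.isReebData hdim
  rw [GACPair.bundleL, h.bundleE10_eq hdim]
  have eF : (⟨(reeb η θ x, 0), 0⟩ : CGTan E x) =
      graphElt η θ (-Complex.I) x (ofRealField (reeb η θ) x) 0 := by
    refine ext_parts ?_ ?_
    · ext1 <;> simp [graphElt]
    · rw [graphElt, formPart_ofParts, hR.cContract_F]
      ext1 <;> simp
  apply le_antisymm
  · refine sup_le ?_ ?_
    · rw [GACPair.bundleLF, Submodule.span_singleton_le_iff_mem]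
      exact ⟨_, 0, False.elim, fun _ => rfl, eF⟩
    · rintro _ ⟨v, c, hv, hc, rfl⟩
      exact ⟨v, c, False.elim, hc, rfl⟩
  · rintro _ ⟨v, c, hv, hc, rfl⟩
    obtain rfl := hc trivial
    refine Submodule.mem_sup.2 ⟨Cplx.ev (ofRealForm η x) v • ⟨(reeb η θ x, 0), 0⟩,
      Submodule.smul_mem _ _ (Submodule.mem_span_singleton_self _),
      graphElt η θ (-Complex.I) x
        (v - Cplx.ev (ofRealForm η x) v • ofRealField (reeb η θ) x) 0,
      ⟨_, 0, fun _ => ?_, fun _ => rfl, rfl⟩, ?_⟩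
    · rw [map_sub, map_smul, hR.ev_η_F, smul_eq_mul, mul_one, sub_self]
    · rw [eF]
      refine ext_parts ?_ ?_
      · rw [map_add, map_smul, anchor_graphElt, anchor_graphElt, anchor_graphElt]
        module
      · rw [map_add, map_smul, formPart_graphElt, formPart_graphElt, formPart_graphElt, map_sub,
          map_smul]
        module

/-- The form `η` is the graph element with `v = 0` and `c = 1`, so adding its line frees the
coefficient `c`. -/
theorem bundleLstar_eq (h : IsCosymplectic n η θ) (hdim : Module.finrank ℝ E = 2 * n + 1) :
    (h.toGACPair hdim).bundleLstar = graphBundle η θ Complex.I True False := by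
  funext x
  rw [GACPair.bundleLstar, h.bundleE01_eq hdim]
  have eη : (⟨(0, η x), 0⟩ : CGTan E x) = graphElt η θ Complex.I x 0 1 := by
    refine ext_parts ?_ ?_
    · ext1 <;> simp [graphElt]
    · rw [graphElt, formPart_ofParts, map_zero]
      ext1 <;> simp
  apply le_antisymm
  · refine sup_le ?_ ?_
    · rw [GACPair.bundleLη, Submodule.span_singleton_le_iff_mem]
      exact ⟨0, 1, fun _ => map_zero _, False.elim, eη⟩
    · rintro _ ⟨v, c, hv, hc, rfl⟩
      exact ⟨v, c, hv, False.elim, rfl⟩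
  · rintro _ ⟨v, c, hv, hc, rfl⟩
    refine Submodule.mem_sup.2 ⟨c • ⟨(0, η x), 0⟩,
      Submodule.smul_mem _ _ (Submodule.mem_span_singleton_self _),
      graphElt η θ Complex.I x v 0, ⟨v, 0, hv, fun _ => rfl, rfl⟩, ?_⟩
    rw [eη]
    refine ext_parts ?_ ?_
    · rw [map_add, map_smul, anchor_graphElt, anchor_graphElt, anchor_graphElt]
      module
    · rw [map_add, map_smul, formPart_graphElt, formPart_graphElt, formPart_graphElt, map_zero]
      module

theorem isLieBialgebroid_L (h : IsCosymplectic n η θ) (hdim : Module.finrank ℝ E = 2 * n + 1)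
    {J : GACPair E M} (hJ : (h.toGACPair hdim).Equivalent J) :
    IsLieBialgebroid anchor cCourant J.bundleL J.bundleLstar := by
  rw [hJ.bundleL_eq, hJ.bundleLstar_eq, h.bundleL_eq, h.bundleLstar_eq]
  exact (h.isReebData hdim).isLieBialgebroid

theorem isLieBialgebroid_E (h : IsCosymplectic n η θ) (hdim : Module.finrank ℝ E = 2 * n + 1)
    {J : GACPair E M} (hJ : (h.toGACPair hdim).Equivalent J) :
    IsLieBialgebroid anchor cCourant J.bundleE10 J.bundleE01 := by
  rw [hJ.bundleE10_eq, hJ.bundleE01_eq, h.bundleE10_eq, h.bundleE01_eq]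
  exact (h.isReebData hdim).isLieBialgebroid

end IsCosymplectic

end Bundles

end GenContact

end

theorem mainTheorem5 {E : Type*} [NormedAddCommGroup E] [NormedSpace ℝ E] [FiniteDimensional ℝ E]
    {M : Type*} [TopologicalSpace M] [T2Space M] [SecondCountableTopology M] [ChartedSpace E M]
    [IsManifold 𝓘(ℝ, E) ∞ M] (n : ℕ) (hdim : Module.finrank ℝ E = 2 * n + 1)
    (η : ∀ x : M, GenContact.Cotan E x)
    (θ : ∀ x : M, GenContact.Tan E x →L[ℝ] GenContact.Tan E x →L[ℝ] ℝ)
    (h : GenContact.IsCosymplectic n η θ) :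
    (∃! J : GenContact.GACPair E M, J.IsAssociated η θ) ∧
    ∀ J₀ : GenContact.GACPair E M, J₀.IsAssociated η θ →
      ∀ 𝒥 : GenContact.GACStructure E M, GenContact.GACStructure.Represents J₀ 𝒥 →
        𝒥.IsStrong ∧
        ∀ J : GenContact.GACPair E M, GenContact.GACStructure.Represents J 𝒥 →
          GenContact.IsLieBialgebroid GenContact.anchor GenContact.cCourant
            J.bundleL J.bundleLstar ∧
          GenContact.IsLieBialgebroid GenContact.anchor GenContact.cCourant
            J.bundleE10 J.bundleE01 := by
  refine ⟨⟨h.toGACPair hdim, h.isAssociated_toGACPair hdim, fun J hJ => h.eq_toGACPair hdim hJ⟩,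
    fun J₀ hJ₀ 𝒥 h𝒥 => ?_⟩
  obtain rfl := h.eq_toGACPair hdim hJ₀
  have key : ∀ J : GenContact.GACPair E M, GenContact.GACStructure.Represents J 𝒥 →
      (h.toGACPair hdim).Equivalent J := fun J hJ => Quotient.exact (h𝒥.trans hJ.symm)
  refine ⟨fun J hJ => ?_, fun J hJ =>
    ⟨h.isLieBialgebroid_L hdim (key J hJ), h.isLieBialgebroid_E hdim (key J hJ)⟩⟩
  -- Being strong is the closedness axiom of the two Lie algebroids `L` and `L^*`.
  have hL := h.isLieBialgebroid_L hdim (key J hJ)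
  exact ⟨hL.left.closed, hL.right.closed⟩
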